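/- **Notation.** Let $n\in\mathbb N$, $\langle x\rangle=(1+|x|^2)^{1/2}$ for $x\in\mathbb R^n$ (Euclidean norm), $\lambda_{\alpha\beta}(x,\xi)=\langle x\rangle^{1-|\alpha|}\langle\xi\rangle^{1-|\beta|}$. $S^{1,1}$ is the space of $a\in C^\infty(\mathbb R^n\times\mathbb R^n)$ such that for all multi-indices $\alpha,\beta$ there is $C$ with $|\partial_x^\alpha\partial_\xi^\beta a|\le C\lambda_{\alpha\beta}$ everywhere. $\mathcal P$ is the set of real-valued $\varphi\in S^{1,1}$ such that $\langle\varphi'_x(x,\xi)\rangle\asymp\langle\xi\rangle$ and $\langle\varphi'_\xi(x,\xi)\rangle\asymp\langle x\rangle$ as $|(x,\xi)|\to\infty$. For $r>0$, $\tau\in[0,1)$, $\mathcal P_r(\tau)$ is the set of $\varphi\in\mathcal P$ with $|\det\varphi''_{x\xi}|\ge r$ everywhere and such that $J(x,\xi):=\varphi(x,\xi)-x\cdot\xi$ satisfies $$\sup_{x,\xi,\ |\alpha+\beta|\le2}|\partial_x^\alpha\partial_\xi^\beta J|/\lambda_{\alpha\beta}\le\tau .$$ For an integer $\ell\ge0$,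 $\mathcal P_r(\tau,\ell)$ is the set of $\varphi\in\mathcal P_r(\tau)$ with $\|J\|_\ell\le\tau$, where $$\|J\|_\ell=\sup_{x,\xi,\ |\alpha+\beta|\le1}\frac{|\partial_x^\alpha\partial_\xi^\beta J|}{\lambda_{\alpha\beta}}+\sum_{2\le|\alpha+\beta|\le2+\ell}\ \sup_{x,\xi}\frac{|\partial_x^\alpha\partial_\xi^\beta J|}{\lambda_{\alpha\beta}} .$$ For phase functions $\varphi_1,\dots,\varphi_{M+1}$ consider, at $(x,\xi)$, the system $$(*)\qquad Y_j=\varphi'_{j,\xi}(Y_{j-1},N_j),\quad N_j=\varphi'_{j+1,x}(Y_j,N_{j+1}),\qquad j=1,\dots,M,\quad Y_0:=x,\ N_{M+1}:=\xi,$$ in the unknowns $(Y,N)=(Y_1,\dots,Y_M,N_1,\dots,N_M)\in\mathbb R^{2Mn}$. If it has exactly one solution $(Y,N)(x,\xi)$ for every $(x,\xi)$, the multi-product is said to be well defined, and it is $$(\varphi_1\#\cdots\#\varphi_{M+1})(x,\xi)=\sum_{j=1}^M\bigl(\varphi_j(Y_{j-1},N_j)-Y_j\cdot N_j\bigr)+\varphi_{M+1}(Y_M,\xi).$$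 The product of a single factor ($M=0$) is that factor. **Theorem.** Let $r>0$, $\varphi_j\in\mathcal P_r(\tau_j)$ ($j\ge1$), $J_j=\varphi_j-x\cdot\xi$, and assume that $\tau_0:=\sum_{j\ge1}\tau_j<1/4$. If $n\ge2$, assume moreover that the bounds on the first and second derivatives of $J_j$ hold in the vector sense, that is, for all $j,x,\xi$, $$|J'_{j,x}|\le\tau_j\langle\xi\rangle,\quad |J'_{j,\xi}|\le\tau_j\langle x\rangle,\quad \|J''_{j,xx}\|\le\tau_j\tfrac{\langle\xi\rangle}{\langle x\rangle},\quad \|J''_{j,x\xi}\|\le\tau_j,\quad \|J''_{j,\xi\xi}\|\le\tau_j\tfrac{\langle x\rangle}{\langle\xi\rangle}$$ with Euclidean lengths and operator norms (for $n=1$ this is contained in $\varphi_j\in\mathcal P_r(\tau_j)$). Put $\bar\tau_{M+1}=\sum_{j=1}^{M+1}\tau_j$. Then $\phi=\varphi_1\#\cdots\#\varphi_{M+1}$ is well defined for every $M\ge1$, and: 1. There are $k\ge1$ and $r'>0$, independent of $M$, such that $k\bar\tau_{M+1}<1$ and $\varphi_1\#\cdots\#\varphi_{M+1}\in\mathcal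 P_{r'}(k\bar\tau_{M+1})$ for all $M\ge1$. Let $\mathcal J_{M+1}:=\varphi_1\#\cdots\#\varphi_{M+1}-x\cdot\xi$. If $\{J_j/\tau_j\}_{j\ge1}$ is bounded in $S^{1,1}$ (for all $\alpha,\beta$ there is $C$ with $|\partial_x^\alpha\partial_\xi^\beta J_j|\le C\tau_j\lambda_{\alpha\beta}$ for all $j$), then $\{\mathcal J_{M+1}/\bar\tau_{M+1}\}_{M\ge1}$ is bounded in $S^{1,1}$ (in the same sense). 2. If $(Y,N)$ is the solution of $(*)$ at $(x,\xi)$, then $\phi'_x(x,\xi)=\varphi'_{1,x}(x,N_1)$ and $\phi'_\xi(x,\xi)=\varphi'_{M+1,\xi}(Y_M,\xi)$. 3. For every $M\ge1$ all products in $$\varphi_1\#(\varphi_2\#\cdots\#\varphi_{M+1})=(\varphi_1\#\cdots\#\varphi_M)\#\varphi_{M+1}=\varphi_1\#\cdots\#\varphi_{M+1}$$ are well defined, and the equalities hold. 4. For every integer $\ell\ge0$ and every $r\in(0,1)$ there are $0<\tau^*<1/4$ and $c^*\ge1$ such that, for every $\rho>0$: if $\varphi_j\in\mathcal P_\rho(\tau_j,\ell)$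 for all $j\ge1$ and $\sum_{j\ge1}\tau_j\le\tau^*$, then, for every $M\ge1$, $\phi$ is well defined, $c^*\bar\tau_{M+1}<1$ and $\phi\in\mathcal P_r(c^*\bar\tau_{M+1},\ell)$. (No vector bounds are assumed here.) -/

import Mathlib

open scoped ContDiff ENNReal

namespace SGPhase

/-- The base space, with its Euclidean norm. -/
abbrev E (n : ℕ) : Type := EuclideanSpace ℝ (Fin n)

/-- Real valued functions `f (x, ξ)` of two variables in `ℝⁿ`. -/
abbrev Fun (n : ℕ) : Type := E n × E n → ℝ

/-- The Japanese bracket `⟨x⟩ = (1 + |x|²)^(1/2)`. -/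
noncomputable def jap {n : ℕ} (x : E n) : ℝ := Real.sqrt (1 + ‖x‖ ^ 2)

/-- The partial derivative with respect to the `i`-th coordinate of `x`. -/
noncomputable def pdX {n : ℕ} (i : Fin n) (f : Fun n) : Fun n :=
  fun p => fderiv ℝ f p (EuclideanSpace.single i 1, 0)

/-- The partial derivative with respect to the `i`-th coordinate of `ξ`. -/
noncomputable def pdXi {n : ℕ} (i : Fin n) (f : Fun n) : Fun n :=
  fun p => fderiv ℝ f p (0, EuclideanSpace.single i 1)

/-- Multi-indices. -/
abbrev MIdx (n : ℕ) : Type := Fin n → ℕ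

/-- The order `|α|` of a multi-index. -/
def MIdx.order {n : ℕ} (α : MIdx n) : ℕ := ∑ i, α i

/-- The mixed partial derivative `∂_x^α ∂_ξ^β f`. -/
noncomputable def mixedDeriv {n : ℕ} (α β : MIdx n) (f : Fun n) : Fun n :=
  (List.finRange n).foldr (fun i g => (pdX i)^[α i] g)
    ((List.finRange n).foldr (fun i g => (pdXi i)^[β i] g) f)

/-- The weight `⟨x⟩^(m - |α|) ⟨ξ⟩^(μ - |β|)`. -/
noncomputable def sgWeight {n : ℕ} (m μ : ℝ) (α β : MIdx n) (x ξ : E n) : ℝ :=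
  jap x ^ (m - (α.order : ℝ)) * jap ξ ^ (μ - (β.order : ℝ))

/-- The symbol class `S^{m, μ}(ℝ²ⁿ)` (real valued symbols). -/
def IsSGSymbol {n : ℕ} (m μ : ℝ) (a : Fun n) : Prop :=
  ContDiff ℝ ∞ a ∧ ∀ α β : MIdx n, ∃ C : ℝ, ∀ x ξ : E n,
    |mixedDeriv α β a (x, ξ)| ≤ C * sgWeight m μ α β x ξ

/-- `{a_j / w_j}_j` is a bounded subset of `S^{m, μ}(ℝ²ⁿ)`, where `w_j ≥ 0`. The denominator is
multiplied out; for `w_j = 0` this says that `a_j = 0`. -/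
def SGBounded {n : ℕ} (m μ : ℝ) (a : ℕ → Fun n) (w : ℕ → ℝ) : Prop :=
  (∀ j, ContDiff ℝ ∞ (a j)) ∧ ∀ α β : MIdx n, ∃ C : ℝ, ∀ (j : ℕ) (x ξ : E n),
    |mixedDeriv α β (a j) (x, ξ)| ≤ C * w j * sgWeight m μ α β x ξ

/-- The gradient `f'_x` with respect to the first variable. -/
noncomputable def gradX {n : ℕ} (f : Fun n) (x ξ : E n) : E n :=
  gradient (fun y => f (y, ξ)) x

/-- The gradient `f'_ξ` with respect to the second variable. -/
noncomputable def gradXi {n : ℕ} (f : Fun n) (x ξ : E n) : E n :=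
  gradient (fun η => f (x, η)) ξ

/-- The class `𝒫` of SG phase functions. The filter `cocompact` expresses `|(x, ξ)| → ∞`. -/
def IsPhase {n : ℕ} (φ : Fun n) : Prop :=
  IsSGSymbol 1 1 φ ∧
  Asymptotics.IsTheta (Filter.cocompact (E n × E n))
    (fun p => jap (gradX φ p.1 p.2)) (fun p => jap p.2) ∧
  Asymptotics.IsTheta (Filter.cocompact (E n × E n))
    (fun p => jap (gradXi φ p.1 p.2)) (fun p => jap p.1)

/-- `J(x, ξ) = φ(x, ξ) - x · ξ`. -/
noncomputable def jPart {n : ℕ} (φ : Fun n) : Fun n := fun p => φ p - inner ℝ p.1 p.2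

/-- The matrix `φ''_{xξ}`. -/
noncomputable def mixedHessian {n : ℕ} (φ : Fun n) (x ξ : E n) : Matrix (Fin n) (Fin n) ℝ :=
  Matrix.of fun i j => pdX i (pdXi j φ) (x, ξ)

/-- The class `𝒫_r(τ)` of regular SG phase functions; it is defined for `r > 0`, `τ ∈ [0, 1)`. -/
structure IsRegular {n : ℕ} (r τ : ℝ) (φ : Fun n) : Prop where
  r_pos : 0 < r
  tau_nonneg : 0 ≤ τ
  tau_lt_one : τ < 1
  phase : IsPhase φ
  det_ge : ∀ x ξ, r ≤ |(mixedHessian φ x ξ).det|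
  bound : ∀ α β : MIdx n, α.order + β.order ≤ 2 → ∀ x ξ,
    |mixedDeriv α β (jPart φ) (x, ξ)| / sgWeight 1 1 α β x ξ ≤ τ

/-- `sup_{x, ξ} |∂_x^α ∂_ξ^β J(x, ξ)| / (⟨x⟩^(1 - |α|) ⟨ξ⟩^(1 - |β|))`, a value in `[0, ∞]`. -/
noncomputable def wSup {n : ℕ} (α β : MIdx n) (J : Fun n) : ℝ≥0∞ :=
  ⨆ (x : E n) (ξ : E n), ENNReal.ofReal (|mixedDeriv α β J (x, ξ)| / sgWeight 1 1 α β x ξ)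

/-- The pairs of multi-indices with `2 ≤ |α + β| ≤ 2 + ℓ`. -/
def idxPairs (n ℓ : ℕ) : Finset (MIdx n × MIdx n) :=
  ((Fintype.piFinset fun _ => Finset.range (ℓ + 3)) ×ˢ
    (Fintype.piFinset fun _ => Finset.range (ℓ + 3))).filter
      fun γ => 2 ≤ γ.1.order + γ.2.order ∧ γ.1.order + γ.2.order ≤ 2 + ℓ

/-- The seminorm `‖J‖_{2, ℓ}`. -/
noncomputable def seminormTwo {n : ℕ} (ℓ : ℕ) (J : Fun n) : ℝ≥0∞ :=
  ∑ γ ∈ idxPairs n ℓ, wSup γ.1 γ.2 J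

/-- The seminorm `‖J‖_ℓ`. -/
noncomputable def seminorm {n : ℕ} (ℓ : ℕ) (J : Fun n) : ℝ≥0∞ :=
  (⨆ (α : MIdx n) (β : MIdx n) (_ : α.order + β.order ≤ 1), wSup α β J) + seminormTwo ℓ J

/-- The class `𝒫_r(τ, ℓ)`. -/
def IsRegularL {n : ℕ} (r τ : ℝ) (ℓ : ℕ) (φ : Fun n) : Prop :=
  IsRegular r τ φ ∧ seminorm ℓ (jPart φ) ≤ ENNReal.ofReal τ

/-- The bounds of orders one and two on `J` for the Euclidean lengths of the gradients and the
operator norms of the blocks `J''_{xx}`, `J''_{xξ}`, `J''_{ξξ}` of the Hessian. -/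
structure VectorBound {n : ℕ} (τ : ℝ) (J : Fun n) : Prop where
  x : ∀ x ξ, ‖gradX J x ξ‖ ≤ τ * jap ξ
  xi : ∀ x ξ, ‖gradXi J x ξ‖ ≤ τ * jap x
  xx : ∀ x ξ, ‖fderiv ℝ (fun y => gradX J y ξ) x‖ ≤ τ * (jap ξ / jap x)
  xxi : ∀ x ξ, ‖fderiv ℝ (fun η => gradX J x η) ξ‖ ≤ τ
  xixi : ∀ x ξ, ‖fderiv ℝ (fun η => gradXi J x η) ξ‖ ≤ τ * (jap x / jap ξ)

/-- The critical point system of the phase functions `φ_1 = φ 0, …, φ_{M+1} = φ M` at `(x, ξ)`, in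
the unknowns `Y_1 = Y 0, …, Y_M = Y (M - 1)` and `N_1 = N 0, …, N_M = N (M - 1)`. With `Y_0 = x` and
`N_{M+1} = ξ` it reads `Y_j = φ'_{j,ξ}(Y_{j-1}, N_j)`, `N_j = φ'_{j+1,x}(Y_j, N_{j+1})`,
`j = 1, …, M`. -/
def IsCritical {n M : ℕ} (φ : Fin (M + 1) → Fun n) (x ξ : E n)
    (YN : (Fin M → E n) × (Fin M → E n)) : Prop :=
  let Y : Fin (M + 1) → E n := Fin.cons x YN.1
  let N : Fin (M + 1) → E n := Fin.snoc YN.2 ξ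
  ∀ j : Fin M,
    YN.1 j = gradXi (φ j.castSucc) (Y j.castSucc) (N j.castSucc) ∧
    YN.2 j = gradX (φ j.succ) (Y j.succ) (N j.succ)

/-- The function `ψ(x, Y, N, ξ) = ∑_{j=1}^M (φ_j(Y_{j-1}, N_j) - Y_j · N_j) + φ_{M+1}(Y_M, ξ)`. -/
noncomputable def psi {n M : ℕ} (φ : Fin (M + 1) → Fun n) (x ξ : E n)
    (YN : (Fin M → E n) × (Fin M → E n)) : ℝ :=
  let Y : Fin (M + 1) → E n := Fin.cons x YN.1
  let N : Fin (M + 1) → E n := Fin.snoc YN.2 ξ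
  (∑ j : Fin M, (φ j.castSucc (Y j.castSucc, N j.castSucc) - inner ℝ (YN.1 j) (YN.2 j))) +
    φ (Fin.last M) (Y (Fin.last M), ξ)

/-- The multi-product is well defined: the critical point system has exactly one solution for
every `(x, ξ)`. -/
def WellDefined {n M : ℕ} (φ : Fin (M + 1) → Fun n) : Prop :=
  ∀ x ξ : E n, ∃! YN, IsCritical φ x ξ YN

/-- The multi-product `φ_1 # ⋯ # φ_{M+1}`: the value of `ψ` at the critical point. It is meaningful
where the critical point exists and is unique. -/
noncomputable def multiProduct {n M : ℕ} (φ : Fin (M + 1) → Fun n) : Fun n :=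
  fun p => psi φ p.1 p.2 (Classical.epsilon (IsCritical φ p.1 p.2))

/-- The first `M + 1` members `φ_1, …, φ_{M+1}` of a sequence (`φ_{j+1}` is `φ j`). -/
def firsts {n : ℕ} (M : ℕ) (φ : ℕ → Fun n) : Fin (M + 1) → Fun n := fun j => φ j

end SGPhase

/-! ### Derivative bounds for coupled systems, uniform in the number of equations -/

namespace SGPhase

/-! Let `q_j = (Y_{j-1}, N_j)` be the point at which the j-th phase is evaluated. Summing the
critical point system gives `q_j = z + ∑_i A_{ji} ∇J_i(q_i)` with `z = (x, ξ)`, where `A_{ji}` feeds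
`J'_{i,ξ}` into the first component for `i < j` and `J'_{i,x}` into the second for `i > j` (`Sol`,
`sol_iff_chain`). In this form every estimate involves only `∑ τ_i` and never the number of factors.

The weights are removed by blowing up the base point: with coordinates `(x + ⟨x⟩u, ξ + ⟨ξ⟩v)` and
`J` divided by `⟨x⟩⟨ξ⟩`, SG estimates become plain derivative bounds near 0, and the system keeps
its form (`sol_scaled_iff`). Since `∑ τ_i < 1/4`, the rescaled system is a contraction of the ball
of radius 1/3 into itself, which gives existence. A discrete Gronwall argument puts every solution
into that ball, so uniqueness is global. Smooth dependence is the inverse function theorem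
(`contDiffAt_of_system`).

The value at the critical point, minus `x · ξ`, is `critVal`. By the envelope principle its gradient
is `∑_i ∇J_i(q_i)` (`sgrad_critVal`), which yields the gradient formulas and reduces derivative
bounds to those of `q`. For second derivatives, the quotient of the weights along a solution changes
by at most 3/2; the linearized system then bounds the Hessian blocks by 32/9 and 28/9 times `∑ τ_i`
(`linear_system_bound`). At 1/4 these are 8/9 and 7/9, both below 1: the first allows `k = 32/9`,
the second keeps the mixed Hessian invertible, with a determinant bound from compactness. For higher
orders, the top derivatives of `q` solve the same contractive linear system with a source made of
lower orders, hence bounds independent of `M` (`exists_iteratedFDeriv_system_bound`).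

Associativity holds because the gradient formulas allow critical chains to be cut and spliced. For
the refined classes, componentwise bounds give vector bounds with a loss of `n²`, which a small `τ*`
absorbs. -/

/-- A bound on the iterated derivative of a product of operator valued functions, the first of
which vanishes at the base point: the top order derivative of the second factor does not enter. -/
theorem norm_iteratedFDeriv_clm_comp_le_of_eq_zero {V W X Y : Type*}
    [NormedAddCommGroup V] [NormedSpace ℝ V] [NormedAddCommGroup W] [NormedSpace ℝ W]
    [NormedAddCommGroup X] [NormedSpace ℝ X] [NormedAddCommGroup Y] [NormedSpace ℝ Y]
    {h : V → X →L[ℝ] Y} {d : V → W →L[ℝ] X} (hh : ContDiff ℝ ∞ h) (hd : ContDiff ℝ ∞ d)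
    {x : V} (h0 : h x = 0) {K : ℕ} {P Q : ℝ} (hP : 0 ≤ P) (hQ : 0 ≤ Q)
    (h1 : ∀ l, 1 ≤ l → l ≤ K → ‖iteratedFDeriv ℝ l h x‖ ≤ P)
    (h2 : ∀ l, l < K → ‖iteratedFDeriv ℝ l d x‖ ≤ Q) :
    ‖iteratedFDeriv ℝ K (fun z => (h z).comp (d z)) x‖ ≤ 2 ^ K * P * Q := by
  have key := (ContinuousLinearMap.compL ℝ W X Y).norm_iteratedFDeriv_le_of_bilinear_of_le_one
    hh hd x (n := K) (by exact_mod_cast le_top) (ContinuousLinearMap.norm_compL_le ℝ W X Y)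
  refine key.trans ?_
  have : (2 : ℝ) ^ K * P * Q = ∑ i ∈ Finset.range (K + 1), (K.choose i : ℝ) * P * Q := by
    rw [← Finset.sum_mul, ← Finset.sum_mul]
    have := Nat.sum_range_choose K
    rw [← Nat.cast_sum, this]; push_cast; rfl
  rw [this]
  refine Finset.sum_le_sum fun i hi => ?_
  rw [Finset.mem_range] at hi
  rcases Nat.eq_zero_or_pos i with rfl | hi0
  · rw [norm_iteratedFDeriv_zero, h0, norm_zero]
    simp; positivity
  · gcongr
    · exact h1 i hi0 (by omega)
    · exact h2 _ (by omega)

/-- Uniform bounds on the derivatives of solutions of the system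
`q_j(z) = z + ∑_i A_{ji} g_i(q_i(z))`, whose linearization at `z = 0` is contractive. The constant
does not depend on the number of equations. -/
theorem exists_iteratedFDeriv_system_bound (W : Type*) [NormedAddCommGroup W] [NormedSpace ℝ W]
    (β : ℝ) (K : ℕ) :
    ∃ C : ℝ, 1 ≤ C ∧ ∀ (m : ℕ) (g q : Fin m → W → W) (A : Fin m → Fin m → W →L[ℝ] W)
      (b : Fin m → ℝ), (∀ i, ContDiff ℝ ∞ (g i)) → (∀ i, ContDiff ℝ ∞ (q i)) →
      (∀ j i, ‖A j i‖ ≤ 1) → (∀ j z, q j z = z + ∑ i, A j i (g i (q i z))) →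
      (∀ i, ∀ l ≤ K, ‖iteratedFDeriv ℝ l (g i) (q i 0)‖ ≤ b i) → ∑ i, b i ≤ β →
      ∑ i, ‖fderiv ℝ (g i) (q i 0)‖ ≤ 5 / 8 →
      (∀ i, ∀ k ≤ K, 1 ≤ k → ‖iteratedFDeriv ℝ k (q i) 0‖ ≤ C) ∧
      (∀ i, ∀ k ≤ K, ‖iteratedFDeriv ℝ k (fun z => g i (q i z)) 0‖ ≤ C * b i) := by
  induction K with
  | zero =>
    refine ⟨1, le_rfl, fun m g q A b hg hq hA hs hb hβ hc => ⟨fun i k hk hk' => by omega, ?_⟩⟩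
    intro i k hk
    obtain rfl : k = 0 := by omega
    have := hb i 0 le_rfl
    rw [norm_iteratedFDeriv_zero] at this ⊢
    simpa using this
  | succ K ih =>
    obtain ⟨C, hC1, hC⟩ := ih
    -- `2 ^ K` comes from the Leibniz rule, `K! C ^ K` from the composition `Dg_i ∘ q_i`, and the
    -- last `C` from the lower derivatives of `Dq_i`.
    set c : ℝ := 2 ^ K * (K.factorial * C ^ K) * C with hc
    have hc0 : 0 ≤ c := by positivity
    -- `8 / 3 = 1 / (1 - 5/8)` inverts the linearized system.
    set D : ℝ := max C (8 / 3 * (1 + c * |β|)) with hD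
    have hD1 : 1 ≤ D := hC1.trans (le_max_left _ _)
    set F : ℝ := max D ((K + 1).factorial * D ^ (K + 1)) with hF
    refine ⟨F, hD1.trans (le_max_left _ _), ?_⟩
    intro m g q A b hg hq hA hs hb hβ hlin
    obtain ⟨hq1, -⟩ := hC m g q A b hg hq hA hs (fun i l hl => hb i l (by omega)) hβ hlin
    have hb0 : ∀ i, 0 ≤ b i := fun i => (norm_nonneg _).trans (hb i 0 (by omega))
    have hβ0 : 0 ≤ β := (Finset.sum_nonneg fun i _ => hb0 i).trans hβ
    have htop : ∀ k : ℕ, (k : ℕ∞ω) ≤ (∞ : ℕ∞ω) := fun k => by exact_mod_cast le_top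
    -- the linear system satisfied by the top order derivatives
    set L : Fin m → W →L[ℝ] W := fun i => fderiv ℝ (g i) (q i 0) with hL
    have hdq : ∀ i, ContDiff ℝ ∞ (fderiv ℝ (q i)) := fun i =>
      (hq i).fderiv_right (by simp)
    have hdg : ∀ i, ContDiff ℝ ∞ (fderiv ℝ (g i)) := fun i =>
      (hg i).fderiv_right (by simp)
    -- The derivative of `g_i` is frozen at the base point. The remainder `h_i` vanishes at 0, so
    -- the unknown top derivative of `q_i` enters only through `L_i`.
    set h : Fin m → W → W →L[ℝ] W := fun i z => fderiv ℝ (g i) (q i z) - L i with hh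
    have hhs : ∀ i, ContDiff ℝ ∞ (h i) := fun i =>
      ((hdg i).comp (hq i)).sub contDiff_const
    have hder : ∀ j, fderiv ℝ (q j) = fun z => ContinuousLinearMap.id ℝ W +
        ∑ i, ((A j i).comp ((L i).comp (fderiv ℝ (q i) z)) +
          (A j i).comp ((h i z).comp (fderiv ℝ (q i) z))) := by
      intro j
      funext z
      have e : q j = fun z => z + ∑ i, A j i (g i (q i z)) := funext (hs j)
      have hd : HasFDerivAt (fun z => z + ∑ i, A j i (g i (q i z)))
          (ContinuousLinearMap.id ℝ W +
            ∑ i, (A j i).comp ((fderiv ℝ (g i) (q i z)).comp (fderiv ℝ (q i) z))) z := by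
        refine (hasFDerivAt_id z).add (HasFDerivAt.fun_sum fun i _ => ?_)
        refine (A j i).hasFDerivAt.comp z (HasFDerivAt.comp z ?_ ?_)
        · exact ((hg i).differentiable (by simp) _).hasFDerivAt
        · exact ((hq i).differentiable (by simp) _).hasFDerivAt
      rw [← e] at hd
      rw [hd.fderiv]
      congr 1
      refine Finset.sum_congr rfl fun i _ => ?_
      ext v
      simp [hh]
    have hcomp : ∀ i, ∀ l ≤ K,
        ‖iteratedFDeriv ℝ l (fun z => fderiv ℝ (g i) (q i z)) 0‖ ≤ K.factorial * C ^ K * b i := by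
      intro i l hl
      have := norm_iteratedFDeriv_comp_le (hdg i) (hq i) (htop l) 0 (C := b i) (D := C)
        (fun s hs' => by
          rw [norm_iteratedFDeriv_fderiv]
          exact hb i (s + 1) (by omega))
        (fun s hs1 hs2 => (hq1 i s (by omega) hs1).trans (le_self_pow₀ hC1 (by omega)))
      refine this.trans ?_
      have h1 : (l.factorial : ℝ) ≤ K.factorial := by exact_mod_cast Nat.factorial_le hl
      have h2 : C ^ l ≤ C ^ K := pow_le_pow_right₀ hC1 hl
      have := hb0 i
      calc (l.factorial : ℝ) * b i * C ^ l = l.factorial * C ^ l * b i := by ring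
        _ ≤ _ := by gcongr
    have hrem : ∀ j i, ‖iteratedFDeriv ℝ K
        (fun z => (A j i).comp ((h i z).comp (fderiv ℝ (q i) z))) 0‖ ≤ c * b i := by
      intro j i
      have h1 := norm_iteratedFDeriv_clm_comp_le_of_eq_zero (hhs i) (hdq i) (x := 0)
        (by simp [hh, hL]) (K := K) (P := K.factorial * C ^ K * b i) (Q := C)
        (by have := hb0 i; positivity) (by positivity)
        (fun l hl1 hl2 => by
          have : iteratedFDeriv ℝ l (h i) 0 =
              iteratedFDeriv ℝ l (fun z => fderiv ℝ (g i) (q i z)) 0 := by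
            have hsub := iteratedFDeriv_sub_apply (x := (0 : W)) (i := l)
              (((hdg i).comp (hq i)).of_le (htop l)).contDiffAt
              (contDiff_const (c := L i)).contDiffAt
            have hz : iteratedFDeriv ℝ l (fun _ : W => L i) 0 = 0 := by
              rw [iteratedFDeriv_const_of_ne (by omega)]; rfl
            rw [hz, sub_zero] at hsub
            exact hsub
          rw [this]
          exact hcomp i l hl2)
        (fun l hl => by
          rw [norm_iteratedFDeriv_fderiv]
          exact hq1 i _ (by omega) (by omega))
      have h2 := ContinuousLinearMap.norm_iteratedFDeriv_comp_left
        (ContinuousLinearMap.compL ℝ W W W (A j i)) (n := K)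
        (f := fun z => (h i z).comp (fderiv ℝ (q i) z)) (x := 0)
        ((hhs i).clm_comp (hdq i)).contDiffAt (htop K)
      have h3 : ‖ContinuousLinearMap.compL ℝ W W W (A j i)‖ ≤ 1 :=
        ((ContinuousLinearMap.compL ℝ W W W).le_opNorm _).trans
          (mul_le_one₀ (ContinuousLinearMap.norm_compL_le ℝ W W W) (norm_nonneg _) (hA j i))
      calc _ ≤ ‖ContinuousLinearMap.compL ℝ W W W (A j i)‖ *
            ‖iteratedFDeriv ℝ K (fun z => (h i z).comp (fderiv ℝ (q i) z)) 0‖ := h2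
        _ ≤ 1 * (2 ^ K * (K.factorial * C ^ K * b i) * C) := by gcongr
        _ = c * b i := by rw [hc]; ring
    have hmain : ∀ j i, ‖iteratedFDeriv ℝ K
        (fun z => (A j i).comp ((L i).comp (fderiv ℝ (q i) z))) 0‖ ≤
          ‖L i‖ * ‖iteratedFDeriv ℝ (K + 1) (q i) 0‖ := by
      intro j i
      have h2 := ContinuousLinearMap.norm_iteratedFDeriv_comp_left
        (ContinuousLinearMap.compL ℝ W W W ((A j i).comp (L i))) (n := K)
        (f := fun z => fderiv ℝ (q i) z) (x := 0) (hdq i).contDiffAt (htop K)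
      have h3 : ‖ContinuousLinearMap.compL ℝ W W W ((A j i).comp (L i))‖ ≤ ‖L i‖ := by
        refine ((ContinuousLinearMap.compL ℝ W W W).le_opNorm _).trans ?_
        calc _ ≤ 1 * (‖A j i‖ * ‖L i‖) := by
              gcongr
              · exact ContinuousLinearMap.norm_compL_le ℝ W W W
              · exact ContinuousLinearMap.opNorm_comp_le _ _
          _ ≤ 1 * (1 * ‖L i‖) := by gcongr; exact hA j i
          _ = _ := by ring
      have h4 : ‖iteratedFDeriv ℝ K (fun z => fderiv ℝ (q i) z) 0‖ =
          ‖iteratedFDeriv ℝ (K + 1) (q i) 0‖ := norm_iteratedFDeriv_fderiv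
      rw [h4] at h2
      exact h2.trans (by gcongr)
    have hsys : ∀ j, ‖iteratedFDeriv ℝ (K + 1) (q j) 0‖ ≤
        1 + ∑ i, (‖L i‖ * ‖iteratedFDeriv ℝ (K + 1) (q i) 0‖ + c * b i) := by
      intro j
      rw [← norm_iteratedFDeriv_fderiv, hder j]
      have s1 : ∀ i, ContDiff ℝ ∞ (fun z => (A j i).comp ((L i).comp (fderiv ℝ (q i) z))) :=
        fun i => contDiff_const.clm_comp (contDiff_const.clm_comp (hdq i))
      have s2 : ∀ i, ContDiff ℝ ∞ (fun z => (A j i).comp ((h i z).comp (fderiv ℝ (q i) z))) :=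
        fun i => contDiff_const.clm_comp ((hhs i).clm_comp (hdq i))
      have s3 : ContDiff ℝ ∞ (fun z => ∑ i, ((A j i).comp ((L i).comp (fderiv ℝ (q i) z)) +
          (A j i).comp ((h i z).comp (fderiv ℝ (q i) z)))) :=
        ContDiff.sum fun i _ => (s1 i).add (s2 i)
      rw [fun_iteratedFDeriv_add_apply contDiff_const.contDiffAt (s3.of_le (htop K)).contDiffAt,
        iteratedFDeriv_fun_sum_apply
          (fun i _ => (((s1 i).add (s2 i)).of_le (htop K)).contDiffAt)]
      refine (norm_add_le _ _).trans (add_le_add ?_ ((norm_sum_le _ _).trans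
        (Finset.sum_le_sum fun i _ => ?_)))
      · rcases Nat.eq_zero_or_pos K with rfl | hK
        · rw [norm_iteratedFDeriv_zero]; exact ContinuousLinearMap.norm_id_le
        · rw [iteratedFDeriv_const_of_ne (by omega)]; simp
      · rw [fun_iteratedFDeriv_add_apply ((s1 i).of_le (htop K)).contDiffAt
          ((s2 i).of_le (htop K)).contDiffAt]
        exact (norm_add_le _ _).trans (add_le_add (hmain j i) (hrem j i))
    have htopb : ∀ j, ‖iteratedFDeriv ℝ (K + 1) (q j) 0‖ ≤ 8 / 3 * (1 + c * |β|) := by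
      intro j
      have : Nonempty (Fin m) := ⟨j⟩
      -- At the index of the largest derivative `Q` the system reads `Q ≤ 1 + 5/8 Q + cβ`. The
      -- coefficients are summed over `i` before `Q` is taken out, so no factor `m` is lost.
      obtain ⟨j₀, hj₀⟩ := Finite.exists_max fun j => ‖iteratedFDeriv ℝ (K + 1) (q j) 0‖
      refine (hj₀ j).trans ?_
      set Q := ‖iteratedFDeriv ℝ (K + 1) (q j₀) 0‖ with hQ
      have h1 := hsys j₀
      have h2 : ∑ i, (‖L i‖ * ‖iteratedFDeriv ℝ (K + 1) (q i) 0‖ + c * b i) ≤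
          5 / 8 * Q + c * β := by
        rw [Finset.sum_add_distrib, ← Finset.mul_sum]
        refine add_le_add ?_ (by gcongr)
        calc _ ≤ ∑ i, ‖L i‖ * Q := Finset.sum_le_sum fun i _ => by gcongr; exact hj₀ i
          _ = (∑ i, ‖L i‖) * Q := by rw [Finset.sum_mul]
          _ ≤ _ := by gcongr
      rw [abs_of_nonneg hβ0]
      linarith
    have hqD : ∀ i, ∀ k ≤ K + 1, 1 ≤ k → ‖iteratedFDeriv ℝ k (q i) 0‖ ≤ D := by
      intro i k hk hk1
      rcases Nat.lt_or_ge k (K + 1) with h | h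
      · exact (hq1 i k (by omega) hk1).trans (le_max_left _ _)
      · obtain rfl : k = K + 1 := by omega
        exact (htopb i).trans (le_max_right _ _)
    refine ⟨fun i k hk hk1 => (hqD i k hk hk1).trans (le_max_left _ _), fun i k hk => ?_⟩
    have := norm_iteratedFDeriv_comp_le (hg i) (hq i) (htop k) 0 (C := b i) (D := D)
      (fun s hs' => hb i _ (by omega))
      (fun s hs1 hs2 => (hqD i s (by omega) hs1).trans (le_self_pow₀ hD1 (by omega)))
    refine this.trans ?_
    have h1 : (k.factorial : ℝ) ≤ (K + 1).factorial := by exact_mod_cast Nat.factorial_le hk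
    have h2 : D ^ k ≤ D ^ (K + 1) := pow_le_pow_right₀ hD1 hk
    have := hb0 i
    calc (k.factorial : ℝ) * b i * D ^ k = k.factorial * D ^ k * b i := by ring
      _ ≤ (K + 1).factorial * D ^ (K + 1) * b i := by gcongr
      _ ≤ F * b i := by gcongr; exact le_max_right _ _


variable {n : ℕ}

/-! ### Iterated partial derivatives along words -/

/-- The standard basis of `ℝⁿ × ℝⁿ`. -/
noncomputable def basisVec : Fin n ⊕ Fin n → E n × E n
  | .inl i => (EuclideanSpace.single i 1, 0)
  | .inr i => (0, EuclideanSpace.single i 1)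

theorem norm_basisVec_le (c : Fin n ⊕ Fin n) : ‖basisVec c‖ ≤ 1 := by
  cases c <;> simp [basisVec, Prod.norm_def]

/-- The iterated partial derivative of `f` along a word of basis vectors. -/
noncomputable def wordDeriv (w : List (Fin n ⊕ Fin n)) (f : Fun n) : Fun n :=
  w.foldr (fun c g p => fderiv ℝ g p (basisVec c)) f

@[simp] theorem wordDeriv_nil (f : Fun n) : wordDeriv [] f = f := rfl

theorem wordDeriv_cons (c : Fin n ⊕ Fin n) (w : List (Fin n ⊕ Fin n)) (f : Fun n) :
    wordDeriv (c :: w) f = fun p => fderiv ℝ (wordDeriv w f) p (basisVec c) := rfl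

theorem wordDeriv_append (v w : List (Fin n ⊕ Fin n)) (f : Fun n) :
    wordDeriv (v ++ w) f = wordDeriv v (wordDeriv w f) := by
  simp [wordDeriv, List.foldr_append]

theorem contDiff_wordDeriv {f : Fun n} (hf : ContDiff ℝ ∞ f) (w : List (Fin n ⊕ Fin n)) :
    ContDiff ℝ ∞ (wordDeriv w f) := by
  induction w with
  | nil => exact hf
  | cons c w ih =>
    rw [wordDeriv_cons]
    exact (ih.fderiv_right (m := ∞) (by simp)).clm_apply contDiff_const

/-- Symmetry of the second derivative exchanges adjacent letters. Hence derivatives along arbitrary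
words are controlled by the sorted ones that multi-indices describe. -/
theorem wordDeriv_perm {f : Fun n} (hf : ContDiff ℝ ∞ f) {v w : List (Fin n ⊕ Fin n)}
    (h : v.Perm w) : wordDeriv v f = wordDeriv w f := by
  induction h with
  | nil => rfl
  | cons c _ ih => rw [wordDeriv_cons, wordDeriv_cons, ih]
  | swap c d w =>
    have hg := contDiff_wordDeriv hf w
    funext p
    simp only [wordDeriv_cons]
    have hd : DifferentiableAt ℝ (fderiv ℝ (wordDeriv w f)) p :=
      (hg.fderiv_right (m := ∞) (by simp)).differentiable (by simp) p
    rw [fderiv_clm_apply hd (differentiableAt_const _),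
      fderiv_clm_apply hd (differentiableAt_const _)]
    have hs : IsSymmSndFDerivAt ℝ (wordDeriv w f) p :=
      (contDiff_infty.1 hg 2).contDiffAt.isSymmSndFDerivAt (by simp)
    simpa using hs.eq _ _
  | trans _ _ h1 h2 => exact h1.trans h2

/-- The word that sorts the letters of `∂_x^α ∂_ξ^β`. -/
def idxWord (α β : MIdx n) : List (Fin n ⊕ Fin n) :=
  (List.finRange n).flatMap (fun i => List.replicate (α i) (.inl i)) ++
    (List.finRange n).flatMap (fun i => List.replicate (β i) (.inr i))

theorem wordDeriv_flatMap_replicate (l : List (Fin n)) (γ : MIdx n) (e : Fin n → Fin n ⊕ Fin n)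
    (f : Fun n) : wordDeriv (l.flatMap fun i => List.replicate (γ i) (e i)) f =
      l.foldr (fun i g => (fun g p => fderiv ℝ g p (basisVec (e i)))^[γ i] g) f := by
  induction l with
  | nil => rfl
  | cons i l ih =>
    rw [List.flatMap_cons, wordDeriv_append, ih, List.foldr_cons]
    generalize γ i = k
    induction k with
    | zero => rfl
    | succ k ihk => rw [List.replicate_succ, wordDeriv_cons, ihk, Function.iterate_succ_apply']

theorem mixedDeriv_eq_wordDeriv (α β : MIdx n) (f : Fun n) :
    mixedDeriv α β f = wordDeriv (idxWord α β) f := by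
  rw [idxWord, wordDeriv_append, wordDeriv_flatMap_replicate, wordDeriv_flatMap_replicate]
  rfl

/-- Letters are counted through Boolean equality on the sum type, which has to be known to agree
with equality. -/
instance : LawfulBEq (Fin n ⊕ Fin n) where
  eq_of_beq {a b} h := by
    rcases a with a | a <;> rcases b with b | b
    · exact congrArg _ (eq_of_beq (α := Fin n) h)
    · exact absurd h Bool.false_ne_true
    · exact absurd h Bool.false_ne_true
    · exact congrArg _ (eq_of_beq (α := Fin n) h)
  rfl {a} := by
    rcases a with a | a
    · exact beq_self_eq_true (α := Fin n) a
    · exact beq_self_eq_true (α := Fin n) a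

theorem count_flatMap_replicate (γ : MIdx n) {e : Fin n → Fin n ⊕ Fin n}
    (he : Function.Injective e) (i : Fin n) :
    ((List.finRange n).flatMap fun i => List.replicate (γ i) (e i)).count (e i) = γ i := by
  rw [List.count_flatMap, ← Fin.sum_univ_def]
  rw [Finset.sum_eq_single i]
  · simp
  · intro j _ hj
    simp only [Function.comp, List.count_replicate]
    rw [if_neg]
    simpa using fun h => hj (he h)
  · simp

theorem length_flatMap_replicate (γ : MIdx n) (e : Fin n → Fin n ⊕ Fin n) :
    ((List.finRange n).flatMap fun i => List.replicate (γ i) (e i)).length = γ.order := by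
  rw [List.length_flatMap, MIdx.order, Fin.sum_univ_def]
  simp

theorem length_idxWord (α β : MIdx n) : (idxWord α β).length = α.order + β.order := by
  rw [idxWord, List.length_append, length_flatMap_replicate, length_flatMap_replicate]

theorem perm_idxWord (w : List (Fin n ⊕ Fin n)) :
    w.Perm (idxWord (fun i => w.count (.inl i)) (fun i => w.count (.inr i))) := by
  rw [List.perm_iff_count]
  have key : ∀ (γ : MIdx n) (e : Fin n → Fin n ⊕ Fin n) (c : Fin n ⊕ Fin n), (∀ i, e i ≠ c) →
      ((List.finRange n).flatMap fun i => List.replicate (γ i) (e i)).count c = 0 := by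
    intro γ e c h
    refine List.count_eq_zero.2 fun hm => ?_
    obtain ⟨i, -, hi⟩ := List.mem_flatMap.1 hm
    exact h i (List.eq_of_mem_replicate hi).symm
  rintro (i | i)
  · rw [idxWord, List.count_append, count_flatMap_replicate _ Sum.inl_injective,
      key _ _ _ (by simp), add_zero]
  · rw [idxWord, List.count_append, count_flatMap_replicate _ Sum.inr_injective,
      key _ _ _ (by simp), zero_add]

theorem iteratedFDeriv_basisVec {f : Fun n} (hf : ContDiff ℝ ∞ f) (k : ℕ)
    (w : Fin k → Fin n ⊕ Fin n) (p : E n × E n) :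
    iteratedFDeriv ℝ k f p (fun i => basisVec (w i)) = wordDeriv (List.ofFn w) f p := by
  induction k generalizing p with
  | zero => simp
  | succ k ih =>
    rw [iteratedFDeriv_succ_apply_left, List.ofFn_succ, wordDeriv_cons]
    have h1 : wordDeriv (List.ofFn fun i : Fin k => w i.succ) f =
        fun p => iteratedFDeriv ℝ k f p (fun i => basisVec (w i.succ)) :=
      funext fun p => (ih (fun i => w i.succ) p).symm
    rw [h1]
    have hd : DifferentiableAt ℝ (iteratedFDeriv ℝ k f) p :=
      (hf.differentiable_iteratedFDeriv (by exact_mod_cast WithTop.coe_lt_top _)) p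
    exact (fderiv_continuousMultilinear_apply_const_apply hd _ _).symm

theorem abs_wordDeriv_le {f : Fun n} (hf : ContDiff ℝ ∞ f) (w : List (Fin n ⊕ Fin n))
    (p : E n × E n) : |wordDeriv w f p| ≤ ‖iteratedFDeriv ℝ w.length f p‖ := by
  have h := iteratedFDeriv_basisVec hf w.length w.get p
  rw [List.ofFn_get] at h
  rw [← h, ← Real.norm_eq_abs]
  refine (ContinuousMultilinearMap.le_opNorm _ _).trans ?_
  refine mul_le_of_le_one_right (norm_nonneg _) ?_
  exact Finset.prod_le_one (fun _ _ => norm_nonneg _) fun _ _ => norm_basisVec_le _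

theorem exists_eq_sum_basisVec (v : E n × E n) : ∃ c : Fin n ⊕ Fin n → ℝ,
    v = ∑ i, c i • basisVec i ∧ ∀ i, |c i| ≤ ‖v‖ := by
  refine ⟨Sum.elim (fun i => v.1 i) (fun i => v.2 i), ?_, ?_⟩
  · rw [Fintype.sum_sum_type]
    have key : ∀ u : E n, u = ∑ i, u i • EuclideanSpace.single i (1 : ℝ) := by
      intro u
      ext j
      simp [Finset.sum_apply, Pi.single_apply]
    ext1
    · simpa [Prod.fst_sum, basisVec] using key v.1
    · simpa [Prod.snd_sum, basisVec] using key v.2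
  · rintro (i | i)
    · exact (PiLp.norm_apply_le v.1 i).trans (norm_fst_le v)
    · exact (PiLp.norm_apply_le v.2 i).trans (norm_snd_le v)

/-- Each of the `k` arguments is expanded in the `2n` basis vectors with coefficients bounded by its
norm; there are `(2n)^k` words. -/
theorem norm_iteratedFDeriv_le_of_wordDeriv {f : Fun n} (hf : ContDiff ℝ ∞ f) {k : ℕ}
    {p : E n × E n} {C : ℝ} (hC : 0 ≤ C)
    (h : ∀ w : List (Fin n ⊕ Fin n), w.length = k → |wordDeriv w f p| ≤ C) :
    ‖iteratedFDeriv ℝ k f p‖ ≤ (n + n : ℝ) ^ k * C := by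
  refine ContinuousMultilinearMap.opNorm_le_bound (by positivity) fun v => ?_
  choose c hc hcv using fun i => exists_eq_sum_basisVec (v i)
  have hv : v = fun i => ∑ l, c i l • basisVec l := funext hc
  have h1 : iteratedFDeriv ℝ k f p v = ∑ r : Fin k → Fin n ⊕ Fin n,
      (∏ i, c i (r i)) * iteratedFDeriv ℝ k f p (fun i => basisVec (r i)) := by
    conv_lhs => rw [hv]
    have := (iteratedFDeriv ℝ k f p).toMultilinearMap.map_sum (fun i l => c i l • basisVec l)
    refine this.trans (Finset.sum_congr rfl fun r _ => ?_)
    exact ((iteratedFDeriv ℝ k f p).toMultilinearMap.map_smul_univ _ _)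
  rw [h1]
  refine (norm_sum_le _ _).trans ?_
  calc _ ≤ ∑ r : Fin k → Fin n ⊕ Fin n, (∏ i, ‖v i‖) * C := by
        refine Finset.sum_le_sum fun r _ => ?_
        rw [norm_mul, norm_prod, iteratedFDeriv_basisVec hf]
        refine mul_le_mul (Finset.prod_le_prod (fun _ _ => norm_nonneg _)
          fun i _ => hcv i _) (h _ (by simp)) (norm_nonneg _) (by positivity)
    _ = _ := by
        simp
        ring

/-! ### The Japanese bracket and the weights -/

theorem one_le_jap (x : E n) : 1 ≤ jap x := by
  rw [jap, Real.one_le_sqrt]; nlinarith [sq_nonneg ‖x‖]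

theorem jap_pos (x : E n) : 0 < jap x := zero_lt_one.trans_le (one_le_jap x)

theorem norm_le_jap (x : E n) : ‖x‖ ≤ jap x := by
  rw [jap]; exact Real.le_sqrt_of_sq_le (by linarith)

theorem jap_add_le (x y : E n) : jap (x + y) ≤ jap x + ‖y‖ := by
  have h1 : jap x ^ 2 = 1 + ‖x‖ ^ 2 := Real.sq_sqrt (by positivity)
  have h2 := norm_le_jap x
  have h3 := jap_pos x
  rw [jap]
  refine Real.sqrt_le_iff.2 ⟨by positivity, ?_⟩
  have h4 : ‖x + y‖ ^ 2 ≤ (‖x‖ + ‖y‖) ^ 2 := by gcongr; exact norm_add_le _ _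
  nlinarith [mul_le_mul_of_nonneg_right h2 (norm_nonneg y)]

theorem jap_sub_le (x y : E n) : jap x - ‖y‖ ≤ jap (x + y) := by
  have := jap_add_le (x + y) (-y)
  simp at this
  linarith

theorem sgWeight_pos (m μ : ℝ) (α β : MIdx n) (x ξ : E n) : 0 < sgWeight m μ α β x ξ :=
  mul_pos (Real.rpow_pos_of_pos (jap_pos x) _) (Real.rpow_pos_of_pos (jap_pos ξ) _)

theorem sgWeight_one (α β : MIdx n) (x ξ : E n) : sgWeight 1 1 α β x ξ =
    jap x * jap ξ / (jap x ^ α.order * jap ξ ^ β.order) := by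
  rw [sgWeight, Real.rpow_sub (jap_pos x), Real.rpow_sub (jap_pos ξ), Real.rpow_one, Real.rpow_one,
    Real.rpow_natCast, Real.rpow_natCast, div_mul_div_comm]

/-! ### Rescaling at a base point -/

/-- The linear part of the rescaling at `p`. -/
noncomputable def scaleL (p : E n × E n) : (E n × E n) →L[ℝ] (E n × E n) :=
  (jap p.1 • ContinuousLinearMap.id ℝ (E n)).prodMap (jap p.2 • ContinuousLinearMap.id ℝ (E n))

@[simp] theorem scaleL_apply (p w : E n × E n) :
    scaleL p w = (jap p.1 • w.1, jap p.2 • w.2) := rfl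

/-- The affine map that blows up the neighbourhood of `p` of size `(⟨x⟩, ⟨ξ⟩)`. -/
noncomputable def rescale (p w : E n × E n) : E n × E n := p + scaleL p w

/-- The inverse of `rescale p`. -/
noncomputable def unscale (p w : E n × E n) : E n × E n :=
  ((jap p.1)⁻¹ • (w.1 - p.1), (jap p.2)⁻¹ • (w.2 - p.2))

theorem rescale_unscale (p w : E n × E n) : rescale p (unscale p w) = w := by
  have h1 := (jap_pos p.1).ne'
  have h2 := (jap_pos p.2).ne'
  ext1 <;> simp [rescale, unscale, smul_smul, h1, h2]

theorem unscale_rescale (p w : E n × E n) : unscale p (rescale p w) = w := by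
  have h1 := (jap_pos p.1).ne'
  have h2 := (jap_pos p.2).ne'
  ext1 <;> simp [rescale, unscale, smul_smul, h1, h2]

@[simp] theorem rescale_zero (p : E n × E n) : rescale p 0 = p := by simp [rescale]

theorem contDiff_rescale (p : E n × E n) : ContDiff ℝ ∞ (rescale p) :=
  contDiff_const.add (scaleL p).contDiff

theorem contDiff_unscale (p : E n × E n) : ContDiff ℝ ∞ (unscale p) := by
  unfold unscale
  fun_prop

theorem hasFDerivAt_rescale (p w : E n × E n) : HasFDerivAt (rescale p) (scaleL p) w :=
  (scaleL p).hasFDerivAt.const_add p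

/-- The rescaled function, normalized by the weight of order zero. -/
noncomputable def scaled (p : E n × E n) (f : Fun n) : Fun n :=
  fun w => (jap p.1 * jap p.2)⁻¹ * f (rescale p w)

theorem contDiff_scaled {f : Fun n} (hf : ContDiff ℝ ∞ f) (p : E n × E n) :
    ContDiff ℝ ∞ (scaled p f) :=
  contDiff_const.mul (hf.comp (contDiff_rescale p))

/-- The factor that a letter contributes to a derivative of the rescaled function. -/
noncomputable def letterScale (p : E n × E n) : Fin n ⊕ Fin n → ℝ
  | .inl _ => jap p.1
  | .inr _ => jap p.2

theorem scaleL_basisVec (p : E n × E n) (c : Fin n ⊕ Fin n) :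
    scaleL p (basisVec c) = letterScale p c • basisVec c := by
  cases c <;> ext1 <;> simp [basisVec, letterScale]

theorem wordDeriv_scaled {f : Fun n} (hf : ContDiff ℝ ∞ f) (p : E n × E n)
    (w : List (Fin n ⊕ Fin n)) : wordDeriv w (scaled p f) = fun z =>
      (jap p.1 * jap p.2)⁻¹ * (w.map (letterScale p)).prod * wordDeriv w f (rescale p z) := by
  induction w with
  | nil => funext z; simp [scaled]
  | cons c w ih =>
    rw [wordDeriv_cons, ih]
    funext z
    have h : HasFDerivAt (fun z => (jap p.1 * jap p.2)⁻¹ * (w.map (letterScale p)).prod *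
        wordDeriv w f (rescale p z)) (((jap p.1 * jap p.2)⁻¹ * (w.map (letterScale p)).prod) •
          (fderiv ℝ (wordDeriv w f) (rescale p z)).comp (scaleL p)) z := by
      refine HasFDerivAt.const_mul ?_ _
      refine HasFDerivAt.comp z ?_ (hasFDerivAt_rescale p z)
      exact ((contDiff_wordDeriv hf w).differentiable (by simp) _).hasFDerivAt
    rw [h.fderiv, wordDeriv_cons]
    simp only [smul_apply, ContinuousLinearMap.comp_apply, scaleL_basisVec,
      map_smul, smul_eq_mul, List.map_cons, List.prod_cons]
    ring

theorem prod_letterScale_idxWord (p : E n × E n) (α β : MIdx n) :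
    ((idxWord α β).map (letterScale p)).prod = jap p.1 ^ α.order * jap p.2 ^ β.order := by
  rw [idxWord, List.map_append, List.prod_append]
  congr 1
  · rw [← length_flatMap_replicate α Sum.inl]
    rw [List.prod_eq_pow_card _ (jap p.1)]
    · simp
    · simp [letterScale]
  · rw [← length_flatMap_replicate β Sum.inr]
    rw [List.prod_eq_pow_card _ (jap p.2)]
    · simp
    · simp [letterScale]

/-- By the chain rule each letter contributes a factor `⟨x⟩` or `⟨ξ⟩`, so the quotient in the SG
seminorm is an unweighted derivative at 0. -/
theorem mixedDeriv_eq_mul_wordDeriv_scaled {f : Fun n} (hf : ContDiff ℝ ∞ f) (x ξ : E n)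
    (α β : MIdx n) : mixedDeriv α β f (x, ξ) =
      wordDeriv (idxWord α β) (scaled (x, ξ) f) 0 * sgWeight 1 1 α β x ξ := by
  rw [wordDeriv_scaled hf, mixedDeriv_eq_wordDeriv, prod_letterScale_idxWord, sgWeight_one]
  have h1 := (jap_pos x).ne'
  have h2 := (jap_pos ξ).ne'
  simp only [rescale_zero]
  field_simp

/-- Away from the base point the weights are only comparable, here within a factor 2: the two
weights of order zero cost 4, the `k` derivatives cost `2 ^ k`. -/
theorem abs_wordDeriv_scaled_le {f : Fun n} (hf : ContDiff ℝ ∞ f) {p z : E n × E n} {k : ℕ}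
    {C : ℝ} (hC : 0 ≤ C) (h1 : jap p.1 ≤ 2 * jap (rescale p z).1)
    (h2 : jap p.2 ≤ 2 * jap (rescale p z).2)
    (h3 : jap (rescale p z).1 ≤ 2 * jap p.1) (h4 : jap (rescale p z).2 ≤ 2 * jap p.2)
    (h : ∀ α β : MIdx n, α.order + β.order = k → |mixedDeriv α β f (rescale p z)| ≤
      C * sgWeight 1 1 α β (rescale p z).1 (rescale p z).2)
    (w : List (Fin n ⊕ Fin n)) (hw : w.length = k) :
    |wordDeriv w (scaled p f) z| ≤ 4 * 2 ^ k * C := by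
  have hp := perm_idxWord w
  set α : MIdx n := fun i => w.count (.inl i)
  set β : MIdx n := fun i => w.count (.inr i)
  have hk : α.order + β.order = k := by rw [← length_idxWord, ← hp.length_eq, hw]
  have h5 := h α β hk
  rw [wordDeriv_perm (contDiff_scaled hf p) hp, wordDeriv_scaled hf, prod_letterScale_idxWord,
    ← mixedDeriv_eq_wordDeriv]
  rw [sgWeight_one] at h5
  have a1 := jap_pos p.1
  have a2 := jap_pos p.2
  have a3 := jap_pos (rescale p z).1
  have a4 := jap_pos (rescale p z).2
  rw [abs_mul, abs_of_pos (by positivity)]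
  have e1 : jap p.1 ^ α.order ≤ 2 ^ α.order * jap (rescale p z).1 ^ α.order := by
    rw [← mul_pow]; gcongr
  have e2 : jap p.2 ^ β.order ≤ 2 ^ β.order * jap (rescale p z).2 ^ β.order := by
    rw [← mul_pow]; gcongr
  calc _ ≤ (jap p.1 * jap p.2)⁻¹ * ((2 ^ α.order * jap (rescale p z).1 ^ α.order) *
        (2 ^ β.order * jap (rescale p z).2 ^ β.order)) *
        (C * ((2 * jap p.1) * (2 * jap p.2) /
          (jap (rescale p z).1 ^ α.order * jap (rescale p z).2 ^ β.order))) := by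
        gcongr
        refine h5.trans ?_
        gcongr
    _ = _ := by
        rw [← hk, pow_add]
        field_simp
        ring


/-! ### The gradient in both variables -/

/-- The gradient `(f'_x, f'_ξ)`. -/
noncomputable def sgrad (f : Fun n) (p : E n × E n) : E n × E n :=
  (gradX f p.1 p.2, gradXi f p.1 p.2)

/-- The pairing of `ℝⁿ × ℝⁿ` with itself. -/
noncomputable def pairing (a b : E n × E n) : ℝ := inner ℝ a.1 b.1 + inner ℝ a.2 b.2

/-- The product carries the maximum norm, so its vectors are tested with this pairing in place of an
inner product. -/
theorem pairing_ext {a b : E n × E n} (h : ∀ v, pairing a v = pairing b v) : a = b := by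
  ext1
  · refine ext_inner_right ℝ fun v => ?_
    simpa [pairing] using h (v, 0)
  · refine ext_inner_right ℝ fun v => ?_
    simpa [pairing] using h (0, v)

theorem pairing_add_left (a b v : E n × E n) : pairing (a + b) v = pairing a v + pairing b v := by
  simp [pairing, inner_add_left]; ring

theorem pairing_sum_left {ι : Type*} (s : Finset ι) (a : ι → E n × E n) (v : E n × E n) :
    pairing (∑ i ∈ s, a i) v = ∑ i ∈ s, pairing (a i) v := by
  simp [pairing, Prod.fst_sum, Prod.snd_sum, sum_inner, Finset.sum_add_distrib]

/-- The vector that represents a linear form. -/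
noncomputable def gradL : ((E n × E n) →L[ℝ] ℝ) →L[ℝ] E n × E n :=
  ∑ c, (ContinuousLinearMap.apply ℝ ℝ (basisVec c)).smulRight (basisVec c)

theorem gradL_apply (l : (E n × E n) →L[ℝ] ℝ) : gradL l = ∑ c, l (basisVec c) • basisVec c := by
  simp [gradL]

theorem pairing_gradL (l : (E n × E n) →L[ℝ] ℝ) (v : E n × E n) :
    pairing (gradL l) v = l v := by
  have key : ∀ c : Fin n ⊕ Fin n, pairing (gradL l) (basisVec c) = l (basisVec c) := by
    intro c
    rw [gradL_apply, pairing_sum_left, Finset.sum_eq_single c]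
    · cases c <;> simp [pairing, basisVec, real_inner_smul_left]
    · intro d _ hd
      cases c <;> cases d <;> simp_all [pairing, basisVec, real_inner_smul_left, eq_comm]
      all_goals
        exact Or.inr (by rw [EuclideanSpace.inner_single_left]; simp [Ne.symm hd])
    · simp
  obtain ⟨c, hc, -⟩ := exists_eq_sum_basisVec v
  have lin : pairing (gradL l) v = ∑ d, c d * pairing (gradL l) (basisVec d) := by
    conv_lhs => rw [hc]
    simp only [pairing, Prod.fst_sum, Prod.snd_sum, inner_sum, Prod.smul_fst, Prod.smul_snd,
      real_inner_smul_right, mul_add, Finset.sum_add_distrib]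
  rw [lin]
  conv_rhs => rw [hc]
  simp [key]

theorem inner_gradX {f : Fun n} {p : E n × E n} (hf : DifferentiableAt ℝ f p) (v : E n) :
    inner ℝ (gradX f p.1 p.2) v = fderiv ℝ f p (v, 0) := by
  have h : HasFDerivAt (fun y => f (y, p.2))
      ((fderiv ℝ f p).comp (ContinuousLinearMap.inl ℝ (E n) (E n))) p.1 :=
    HasFDerivAt.comp (g := f) p.1 hf.hasFDerivAt (hasFDerivAt_prodMk_left p.1 p.2)
  rw [gradX, inner_gradient_left, h.fderiv]
  rfl

theorem inner_gradXi {f : Fun n} {p : E n × E n} (hf : DifferentiableAt ℝ f p) (v : E n) :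
    inner ℝ (gradXi f p.1 p.2) v = fderiv ℝ f p (0, v) := by
  have h : HasFDerivAt (fun y => f (p.1, y))
      ((fderiv ℝ f p).comp (ContinuousLinearMap.inr ℝ (E n) (E n))) p.2 :=
    HasFDerivAt.comp (g := f) p.2 hf.hasFDerivAt (hasFDerivAt_prodMk_right p.1 p.2)
  rw [gradXi, inner_gradient_left, h.fderiv]
  rfl

theorem pairing_sgrad {f : Fun n} {p : E n × E n} (hf : DifferentiableAt ℝ f p) (v : E n × E n) :
    pairing (sgrad f p) v = fderiv ℝ f p v := by
  rw [pairing, sgrad, inner_gradX hf, inner_gradXi hf, ← map_add]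
  simp

theorem sgrad_eq_gradL {f : Fun n} {p : E n × E n} (hf : DifferentiableAt ℝ f p) :
    sgrad f p = gradL (fderiv ℝ f p) :=
  pairing_ext fun v => by rw [pairing_sgrad hf, pairing_gradL]

/-- A fixed continuous linear map after the derivative: smoothness and bounds of all orders pass to
the gradient. -/
theorem sgrad_eq_comp {f : Fun n} (hf : ContDiff ℝ ∞ f) :
    sgrad f = fun p => gradL (fderiv ℝ f p) :=
  funext fun p => sgrad_eq_gradL (hf.differentiable (by simp) p)

theorem sgrad_eq_of_hasFDerivAt {f : Fun n} {p g : E n × E n} {l : (E n × E n) →L[ℝ] ℝ}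
    (h : HasFDerivAt f l p) (hl : ∀ v, l v = pairing g v) : sgrad f p = g :=
  pairing_ext fun v => by rw [pairing_sgrad h.differentiableAt, h.fderiv, hl]

theorem contDiff_sgrad {f : Fun n} (hf : ContDiff ℝ ∞ f) : ContDiff ℝ ∞ (sgrad f) := by
  rw [sgrad_eq_comp hf]
  exact gradL.contDiff.comp (hf.fderiv_right (m := ∞) (by simp))

theorem hasFDerivAt_sgrad {f : Fun n} (hf : ContDiff ℝ ∞ f) (p : E n × E n) :
    HasFDerivAt (sgrad f) (fderiv ℝ (sgrad f) p) p :=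
  ((contDiff_sgrad hf).differentiable (by simp) p).hasFDerivAt

theorem fderiv_sgrad {f : Fun n} (hf : ContDiff ℝ ∞ f) (p : E n × E n) :
    fderiv ℝ (sgrad f) p = gradL.comp (fderiv ℝ (fderiv ℝ f) p) := by
  rw [sgrad_eq_comp hf]
  have : DifferentiableAt ℝ (fderiv ℝ f) p :=
    (hf.fderiv_right (m := ∞) (by simp)).differentiable (by simp) p
  exact (gradL.hasFDerivAt.comp p this.hasFDerivAt).fderiv

theorem pairing_fderiv_sgrad {f : Fun n} (hf : ContDiff ℝ ∞ f) (p v w : E n × E n) :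
    pairing (fderiv ℝ (sgrad f) p v) w = fderiv ℝ (fderiv ℝ f) p v w := by
  rw [fderiv_sgrad hf, ContinuousLinearMap.comp_apply, pairing_gradL]

theorem pairing_fderiv_sgrad_comm {f : Fun n} (hf : ContDiff ℝ ∞ f) (p v w : E n × E n) :
    pairing (fderiv ℝ (sgrad f) p v) w = pairing (fderiv ℝ (sgrad f) p w) v := by
  rw [pairing_fderiv_sgrad hf, pairing_fderiv_sgrad hf]
  exact (contDiff_infty.1 hf 2).contDiffAt.isSymmSndFDerivAt (by simp) |>.eq _ _

theorem wordDeriv_singleton {f : Fun n} (hf : ContDiff ℝ ∞ f) (c : Fin n ⊕ Fin n)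
    (p : E n × E n) : wordDeriv [c] f p = pairing (sgrad f p) (basisVec c) := by
  rw [pairing_sgrad (hf.differentiable (by simp) p)]; rfl

theorem wordDeriv_pair {f : Fun n} (hf : ContDiff ℝ ∞ f) (c d : Fin n ⊕ Fin n)
    (p : E n × E n) :
    wordDeriv [c, d] f p = pairing (fderiv ℝ (sgrad f) p (basisVec c)) (basisVec d) := by
  rw [pairing_fderiv_sgrad hf, wordDeriv_cons, wordDeriv_cons, wordDeriv_nil]
  beta_reduce
  have : DifferentiableAt ℝ (fderiv ℝ f) p :=
    (hf.fderiv_right (m := ∞) (by simp)).differentiable (by simp) p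
  rw [fderiv_clm_apply this (differentiableAt_const _)]
  simp

/-! ### Block bounds for the Hessian -/

/-- Bounds for the blocks of the Hessian of `f` at `p`. -/
def HessBound (κ₁ τ κ₂ : ℝ) (f : Fun n) (p : E n × E n) : Prop :=
  ∀ e, ‖(fderiv ℝ (sgrad f) p e).1‖ ≤ κ₁ * ‖e.1‖ + τ * ‖e.2‖ ∧
    ‖(fderiv ℝ (sgrad f) p e).2‖ ≤ τ * ‖e.1‖ + κ₂ * ‖e.2‖

theorem HessBound.mono {κ₁ τ κ₂ κ₁' κ₂' : ℝ} {f : Fun n} {p : E n × E n}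
    (h : HessBound κ₁ τ κ₂ f p) (h1 : κ₁ ≤ κ₁') (h2 : κ₂ ≤ κ₂') : HessBound κ₁' τ κ₂' f p :=
  fun e => ⟨(h e).1.trans (by gcongr), (h e).2.trans (by gcongr)⟩

theorem HessBound.norm_fderiv_le {κ τ : ℝ} {f : Fun n} {p : E n × E n}
    (hκ : 0 ≤ κ) (hτ : 0 ≤ τ) (h : HessBound κ τ κ f p) : ‖fderiv ℝ (sgrad f) p‖ ≤ κ + τ := by
  refine ContinuousLinearMap.opNorm_le_bound _ (by positivity) fun e => ?_
  have h1 := norm_fst_le e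
  have h2 := norm_snd_le e
  rw [Prod.norm_def]
  refine max_le ((h e).1.trans ?_) ((h e).2.trans ?_)
  · calc _ ≤ κ * ‖e‖ + τ * ‖e‖ := by gcongr
      _ = _ := by ring
  · calc _ ≤ τ * ‖e‖ + κ * ‖e‖ := by gcongr
      _ = _ := by ring

theorem VectorBound.mono {τ τ' : ℝ} {J : Fun n} (h : VectorBound τ J) (hτ : τ ≤ τ') :
    VectorBound τ' J where
  x x ξ := (h.x x ξ).trans (by have := jap_pos ξ; gcongr)
  xi x ξ := (h.xi x ξ).trans (by have := jap_pos x; gcongr)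
  xx x ξ := (h.xx x ξ).trans (by have := jap_pos x; have := jap_pos ξ; gcongr)
  xxi x ξ := (h.xxi x ξ).trans hτ
  xixi x ξ := (h.xixi x ξ).trans (by have := jap_pos x; have := jap_pos ξ; gcongr)

theorem fderiv_gradX_left {f : Fun n} (hf : ContDiff ℝ ∞ f) (p : E n × E n) (v : E n) :
    fderiv ℝ (fun y => gradX f y p.2) p.1 v = (fderiv ℝ (sgrad f) p (v, 0)).1 := by
  have h : HasFDerivAt (fun y => gradX f y p.2) ((ContinuousLinearMap.fst ℝ (E n) (E n)).comp
      ((fderiv ℝ (sgrad f) p).comp (ContinuousLinearMap.inl ℝ (E n) (E n)))) p.1 :=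
    (ContinuousLinearMap.fst ℝ (E n) (E n)).hasFDerivAt.comp p.1
      (HasFDerivAt.comp (g := sgrad f) p.1 (hasFDerivAt_sgrad hf p)
        (hasFDerivAt_prodMk_left p.1 p.2))
  rw [h.fderiv]; rfl

theorem fderiv_gradX_right {f : Fun n} (hf : ContDiff ℝ ∞ f) (p : E n × E n) (v : E n) :
    fderiv ℝ (fun η => gradX f p.1 η) p.2 v = (fderiv ℝ (sgrad f) p (0, v)).1 := by
  have h : HasFDerivAt (fun η => gradX f p.1 η) ((ContinuousLinearMap.fst ℝ (E n) (E n)).comp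
      ((fderiv ℝ (sgrad f) p).comp (ContinuousLinearMap.inr ℝ (E n) (E n)))) p.2 :=
    (ContinuousLinearMap.fst ℝ (E n) (E n)).hasFDerivAt.comp p.2
      (HasFDerivAt.comp (g := sgrad f) p.2 (hasFDerivAt_sgrad hf p)
        (hasFDerivAt_prodMk_right p.1 p.2))
  rw [h.fderiv]; rfl

theorem fderiv_gradXi_right {f : Fun n} (hf : ContDiff ℝ ∞ f) (p : E n × E n) (v : E n) :
    fderiv ℝ (fun η => gradXi f p.1 η) p.2 v = (fderiv ℝ (sgrad f) p (0, v)).2 := by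
  have h : HasFDerivAt (fun η => gradXi f p.1 η) ((ContinuousLinearMap.snd ℝ (E n) (E n)).comp
      ((fderiv ℝ (sgrad f) p).comp (ContinuousLinearMap.inr ℝ (E n) (E n)))) p.2 :=
    (ContinuousLinearMap.snd ℝ (E n) (E n)).hasFDerivAt.comp p.2
      (HasFDerivAt.comp (g := sgrad f) p.2 (hasFDerivAt_sgrad hf p)
        (hasFDerivAt_prodMk_right p.1 p.2))
  rw [h.fderiv]; rfl

theorem norm_le_of_inner_self_le {v : E n} {c : ℝ} (hc : 0 ≤ c) (h : inner ℝ v v ≤ c * ‖v‖) :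
    ‖v‖ ≤ c := by
  rw [real_inner_self_eq_norm_mul_norm] at h
  rcases eq_or_lt_of_le (norm_nonneg v) with h0 | h0
  · rw [← h0]; exact hc
  · exact le_of_mul_le_mul_right h h0

theorem VectorBound.hessBound {τ : ℝ} {J : Fun n} (h : VectorBound τ J) (hJ : ContDiff ℝ ∞ J)
    (p : E n × E n) : HessBound (τ * (jap p.2 / jap p.1)) τ (τ * (jap p.1 / jap p.2)) J p := by
  have hτ : 0 ≤ τ := (norm_nonneg _).trans (h.xxi p.1 p.2)
  have e11 : ∀ v, ‖(fderiv ℝ (sgrad J) p (v, 0)).1‖ ≤ τ * (jap p.2 / jap p.1) * ‖v‖ := fun v => by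
    rw [← fderiv_gradX_left hJ]
    exact ContinuousLinearMap.le_of_opNorm_le _ (h.xx p.1 p.2) _
  have e12 : ∀ v, ‖(fderiv ℝ (sgrad J) p (0, v)).1‖ ≤ τ * ‖v‖ := fun v => by
    rw [← fderiv_gradX_right hJ]
    exact ContinuousLinearMap.le_of_opNorm_le _ (h.xxi p.1 p.2) _
  have e22 : ∀ v, ‖(fderiv ℝ (sgrad J) p (0, v)).2‖ ≤ τ * (jap p.1 / jap p.2) * ‖v‖ := fun v => by
    rw [← fderiv_gradXi_right hJ]
    exact ContinuousLinearMap.le_of_opNorm_le _ (h.xixi p.1 p.2) _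
  -- This block is not among the assumed bounds; it is the transpose of the `xξ` block, by symmetry
  -- of the Hessian.
  have e21 : ∀ v, ‖(fderiv ℝ (sgrad J) p (v, 0)).2‖ ≤ τ * ‖v‖ := fun v => by
    refine norm_le_of_inner_self_le (by positivity) ?_
    set w := (fderiv ℝ (sgrad J) p (v, 0)).2 with hw
    have h1 := pairing_fderiv_sgrad_comm hJ p (v, 0) (0, w)
    have h2 : inner ℝ w w = inner ℝ (fderiv ℝ (sgrad J) p (0, w)).1 v := by
      simpa [pairing, ← hw] using h1
    rw [h2]
    refine (real_inner_le_norm _ _).trans ?_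
    calc _ ≤ τ * ‖w‖ * ‖v‖ := by gcongr; exact e12 w
      _ = _ := by ring
  intro e
  have he : e = (e.1, 0) + (0, e.2) := by ext1 <;> simp
  have hd : fderiv ℝ (sgrad J) p e =
      fderiv ℝ (sgrad J) p (e.1, 0) + fderiv ℝ (sgrad J) p (0, e.2) := by
    rw [← map_add, ← he]
  rw [hd]
  exact ⟨(norm_add_le _ _).trans (add_le_add (e11 _) (e12 _)),
    (norm_add_le _ _).trans (add_le_add (e21 _) (e22 _))⟩

/-! ### The gradient of a rescaled function -/

/-- The factor by which gradients change under rescaling. -/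
noncomputable def dualScale (p v : E n × E n) : E n × E n :=
  ((jap p.2)⁻¹ • v.1, (jap p.1)⁻¹ • v.2)

/-- The chain rule multiplies each component by its own weight, and the normalization divides by
both, so the inverse of the other weight remains. -/
theorem sgrad_scaled {f : Fun n} (hf : ContDiff ℝ ∞ f) (p z : E n × E n) :
    sgrad (scaled p f) z = dualScale p (sgrad f (rescale p z)) := by
  have hd := hf.differentiable (by simp) (rescale p z)
  have h : HasFDerivAt (scaled p f)
      ((jap p.1 * jap p.2)⁻¹ • (fderiv ℝ f (rescale p z)).comp (scaleL p)) z :=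
    (HasFDerivAt.comp z hd.hasFDerivAt (hasFDerivAt_rescale p z)).const_mul _
  refine sgrad_eq_of_hasFDerivAt h fun v => ?_
  have h1 := (jap_pos p.1).ne'
  have h2 := (jap_pos p.2).ne'
  simp only [smul_apply, ContinuousLinearMap.comp_apply, ← pairing_sgrad hd, pairing, dualScale,
    scaleL_apply, inner_smul_left, inner_smul_right, smul_eq_mul]
  simp
  field_simp

theorem fderiv_sgrad_scaled {f : Fun n} (hf : ContDiff ℝ ∞ f) (p z e : E n × E n) :
    fderiv ℝ (sgrad (scaled p f)) z e =
      dualScale p (fderiv ℝ (sgrad f) (rescale p z) (scaleL p e)) := by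
  have e1 : sgrad (scaled p f) = fun z => dualScale p (sgrad f (rescale p z)) :=
    funext (sgrad_scaled hf p)
  have h0 := HasFDerivAt.comp z (hasFDerivAt_sgrad hf (rescale p z)) (hasFDerivAt_rescale p z)
  have h : HasFDerivAt (fun z => dualScale p (sgrad f (rescale p z)))
      ((((jap p.2)⁻¹ • (ContinuousLinearMap.fst ℝ (E n) (E n))).prod
        ((jap p.1)⁻¹ • (ContinuousLinearMap.snd ℝ (E n) (E n)))).comp
        ((fderiv ℝ (sgrad f) (rescale p z)).comp (scaleL p))) z :=
    (((jap p.2)⁻¹ • (ContinuousLinearMap.fst ℝ (E n) (E n))).prod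
        ((jap p.1)⁻¹ • (ContinuousLinearMap.snd ℝ (E n) (E n)))).hasFDerivAt.comp z h0
  rw [e1, h.fderiv]
  rfl

/-- The mixed blocks are invariant under rescaling, while the diagonal blocks acquire a quotient of
weights. This is why quotients of weights have to be controlled along solutions. -/
theorem HessBound.scaled {κ₁ τ κ₂ : ℝ} {f : Fun n} {p z : E n × E n}
    (h : HessBound κ₁ τ κ₂ f (rescale p z)) (hf : ContDiff ℝ ∞ f) :
    HessBound (κ₁ * (jap p.1 / jap p.2)) τ (κ₂ * (jap p.2 / jap p.1)) (scaled p f) z := by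
  intro e
  rw [fderiv_sgrad_scaled hf]
  have h1 := jap_pos p.1
  have h2 := jap_pos p.2
  obtain ⟨ha, hb⟩ := h (scaleL p e)
  simp only [scaleL_apply, norm_smul, Real.norm_of_nonneg h1.le, Real.norm_of_nonneg h2.le]
    at ha hb
  refine ⟨?_, ?_⟩
  · simp only [dualScale, norm_smul, norm_inv, Real.norm_of_nonneg h2.le]
    rw [inv_mul_le_iff₀ h2]
    refine ha.trans (le_of_eq ?_)
    field_simp
  · simp only [dualScale, norm_smul, norm_inv, Real.norm_of_nonneg h1.le]
    rw [inv_mul_le_iff₀ h1]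
    refine hb.trans (le_of_eq ?_)
    field_simp


/-! ### The critical point system in summed form -/

/-- The coupling of the unknowns of the summed system. -/
noncomputable def couple {m : ℕ} (j i : Fin m) : (E n × E n) →L[ℝ] E n × E n :=
  if i < j then (ContinuousLinearMap.inl ℝ (E n) (E n)).comp (ContinuousLinearMap.snd ℝ (E n) (E n))
  else if j < i then
    (ContinuousLinearMap.inr ℝ (E n) (E n)).comp (ContinuousLinearMap.fst ℝ (E n) (E n))
  else 0

theorem couple_fst {m : ℕ} (j i : Fin m) (v : E n × E n) :
    (couple j i v).1 = if i < j then v.2 else 0 := by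
  unfold couple
  split_ifs <;> simp

theorem couple_snd {m : ℕ} (j i : Fin m) (v : E n × E n) :
    (couple j i v).2 = if j < i then v.1 else 0 := by
  unfold couple
  split_ifs with h1 h2
  · exact absurd h2 h1.not_gt
  all_goals simp

theorem norm_couple_apply_le {m : ℕ} (j i : Fin m) (v : E n × E n) : ‖couple j i v‖ ≤ ‖v‖ := by
  rw [Prod.norm_def, couple_fst, couple_snd]
  refine max_le ?_ ?_
  · split_ifs
    · exact norm_snd_le v
    · simp
  · split_ifs
    · exact norm_fst_le v
    · simp

theorem norm_couple_le {m : ℕ} (j i : Fin m) : ‖(couple j i : (E n × E n) →L[ℝ] _)‖ ≤ 1 :=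
  ContinuousLinearMap.opNorm_le_bound _ zero_le_one fun v => by
    rw [one_mul]; exact norm_couple_apply_le j i v

/-- The coupling exchanges the two components, so each weight meets its own inverse. This makes the
summed system invariant under rescaling. -/
theorem scaleL_couple_dualScale {m : ℕ} (j i : Fin m) (p v : E n × E n) :
    scaleL p (couple j i (dualScale p v)) = couple j i v := by
  have h1 := (jap_pos p.1).ne'
  have h2 := (jap_pos p.2).ne'
  ext1
  · simp only [scaleL_apply, couple_fst, dualScale]
    split_ifs <;> simp [smul_smul, h1]
  · simp only [scaleL_apply, couple_snd, dualScale]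
    split_ifs <;> simp [smul_smul, h2]

/-- The critical point system in summed form: `q j` is the point at which the `j`-th phase function
is evaluated. -/
def Sol {m : ℕ} (J : Fin m → Fun n) (z : E n × E n) (q : Fin m → E n × E n) : Prop :=
  ∀ j, q j = z + ∑ i, couple j i (sgrad (J i) (q i))

theorem Sol.fst {m : ℕ} {J : Fin m → Fun n} {z : E n × E n} {q : Fin m → E n × E n}
    (h : Sol J z q) (j : Fin m) :
    (q j).1 = z.1 + ∑ i with i < j, (sgrad (J i) (q i)).2 := by
  conv_lhs => rw [h j]
  rw [Prod.fst_add, Prod.fst_sum, Finset.sum_filter]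
  simp only [couple_fst]

theorem Sol.snd {m : ℕ} {J : Fin m → Fun n} {z : E n × E n} {q : Fin m → E n × E n}
    (h : Sol J z q) (j : Fin m) :
    (q j).2 = z.2 + ∑ i with j < i, (sgrad (J i) (q i)).1 := by
  conv_lhs => rw [h j]
  rw [Prod.snd_add, Prod.snd_sum, Finset.sum_filter]
  simp only [couple_snd]

theorem rescale_injective (p : E n × E n) : Function.Injective (rescale p) :=
  Function.LeftInverse.injective (unscale_rescale p)

theorem sol_scaled_iff {m : ℕ} {J : Fin m → Fun n} (hJ : ∀ i, ContDiff ℝ ∞ (J i))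
    (p z : E n × E n) (q : Fin m → E n × E n) :
    Sol (fun i => scaled p (J i)) z q ↔ Sol J (rescale p z) (fun i => rescale p (q i)) := by
  refine forall_congr' fun j => ?_
  rw [← (rescale_injective p).eq_iff]
  have : rescale p (z + ∑ i, couple j i (sgrad (scaled p (J i)) (q i))) =
      rescale p z + ∑ i, couple j i (sgrad (J i) (rescale p (q i))) := by
    simp only [rescale, map_add, map_sum, sgrad_scaled (hJ _), scaleL_couple_dualScale]
    abel
  rw [this]

/-- Families of functions `J_i` for which the summed system is uniquely solvable. -/
structure Admissible {m : ℕ} (J : Fin m → Fun n) (τ : Fin m → ℝ) : Prop where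
  smooth : ∀ i, ContDiff ℝ ∞ (J i)
  nonneg : ∀ i, 0 ≤ τ i
  sum_lt : ∑ i, τ i < 1 / 4
  vb : ∀ i, VectorBound (τ i) (J i)

/-- Well-founded induction: by transitivity the predecessors of `i ∈ s j` lie in `s j`, so the bound
already known for `i` is at most the one sought for `j`. It serves `Y` with the order `<` and `N`
with the reversed order. -/
theorem gronwall_sum {ι : Type*} [Finite ι] (r : ι → ι → Prop) [IsStrictOrder ι r] {c : ℝ}
    (hc : 0 ≤ c) (s : ι → Finset ι) (hs : ∀ i j, i ∈ s j ↔ r i j) {τ h : ι → ℝ}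
    (hτ : ∀ i, 0 ≤ τ i) (ht : ∀ j, ∑ i ∈ s j, τ i < 1)
    (hh : ∀ j, h j ≤ c + ∑ i ∈ s j, τ i * h i) (j : ι) :
    h j ≤ c / (1 - ∑ i ∈ s j, τ i) := by
  have wf : WellFounded r := Finite.wellFounded_of_trans_of_irrefl r
  induction j using wf.induction with
  | _ j ih =>
  refine (hh j).trans ?_
  have hj := ht j
  have h1 : ∑ i ∈ s j, τ i * h i ≤ ∑ i ∈ s j, τ i * (c / (1 - ∑ i ∈ s j, τ i)) := by
    refine Finset.sum_le_sum fun i hi => mul_le_mul_of_nonneg_left ?_ (hτ i)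
    have hij := (hs i j).1 hi
    refine (ih i hij).trans ?_
    have : ∑ l ∈ s i, τ l ≤ ∑ l ∈ s j, τ l :=
      Finset.sum_le_sum_of_subset_of_nonneg
        (fun l hl => (hs l j).2 (_root_.trans ((hs l i).1 hl) hij)) fun l _ _ => hτ l
    exact div_le_div_of_nonneg_left hc (by linarith) (by linarith)
  rw [← Finset.sum_mul] at h1
  calc _ ≤ c + (∑ i ∈ s j, τ i) * (c / (1 - ∑ i ∈ s j, τ i)) := by linarith
    _ = _ := by
      have : 1 - ∑ i ∈ s j, τ i ≠ 0 := by linarith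
      field_simp
      ring

/-! ### A priori bounds along solutions of the summed system -/

section Apriori

variable {m : ℕ} {J : Fin m → Fun n} {τ : Fin m → ℝ}

theorem Admissible.sum_le (h : Admissible J τ) (s : Finset (Fin m)) : ∑ i ∈ s, τ i < 1 / 4 :=
  (Finset.sum_le_univ_sum_of_nonneg h.nonneg).trans_lt h.sum_lt

/-- The first component of `q j` is moved by the earlier functions only, the second by the later
ones only, so the two deviations share the single budget 1/4. -/
theorem Admissible.sum_add_sum_le (h : Admissible J τ) (j : Fin m) :
    ∑ i with i < j, τ i + ∑ i with j < i, τ i < 1 / 4 := by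
  rw [← Finset.sum_union]
  · exact h.sum_le _
  · rw [Finset.disjoint_filter]
    intro i _ h1 h2
    exact h1.not_gt h2

theorem Admissible.norm_fst_sub_le (h : Admissible J τ) {z : E n × E n} {q : Fin m → E n × E n}
    (hq : Sol J z q) (j : Fin m) : ‖(q j).1 - z.1‖ ≤ ∑ i with i < j, τ i * jap (q i).1 := by
  rw [hq.fst j, add_sub_cancel_left]
  exact (norm_sum_le _ _).trans (Finset.sum_le_sum fun i _ => (h.vb i).xi _ _)

theorem Admissible.norm_snd_sub_le (h : Admissible J τ) {z : E n × E n} {q : Fin m → E n × E n}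
    (hq : Sol J z q) (j : Fin m) : ‖(q j).2 - z.2‖ ≤ ∑ i with j < i, τ i * jap (q i).2 := by
  rw [hq.snd j, add_sub_cancel_left]
  exact (norm_sum_le _ _).trans (Finset.sum_le_sum fun i _ => (h.vb i).x _ _)

theorem Admissible.jap_fst_le (h : Admissible J τ) {z : E n × E n} {q : Fin m → E n × E n}
    (hq : Sol J z q) (j : Fin m) : jap (q j).1 ≤ jap z.1 / (1 - ∑ i with i < j, τ i) := by
  refine gronwall_sum (fun i j : Fin m => i < j) (jap_pos _).le
    (fun j => Finset.univ.filter (· < j)) (by simp) h.nonneg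
    (fun j => (h.sum_le _).trans (by norm_num)) (h := fun j => jap (q j).1) (fun j => ?_) j
  have := jap_add_le z.1 ((q j).1 - z.1)
  rw [add_sub_cancel] at this
  exact this.trans (by have := h.norm_fst_sub_le hq j; linarith)

theorem Admissible.jap_snd_le (h : Admissible J τ) {z : E n × E n} {q : Fin m → E n × E n}
    (hq : Sol J z q) (j : Fin m) : jap (q j).2 ≤ jap z.2 / (1 - ∑ i with j < i, τ i) := by
  refine gronwall_sum (fun i j : Fin m => j < i) (jap_pos _).le
    (fun j => Finset.univ.filter (j < ·)) (by simp) h.nonneg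
    (fun j => (h.sum_le _).trans (by norm_num)) (h := fun j => jap (q j).2) (fun j => ?_) j
  have := jap_add_le z.2 ((q j).2 - z.2)
  rw [add_sub_cancel] at this
  exact this.trans (by have := h.norm_snd_sub_le hq j; linarith)

theorem sum_mul_le_of_le_div {ι : Type*} (r : ι → ι → Prop) [IsStrictOrder ι r] {c : ℝ}
    (hc : 0 ≤ c) (s : ι → Finset ι) (hs : ∀ i j, i ∈ s j ↔ r i j) {τ h : ι → ℝ}
    (hτ : ∀ i, 0 ≤ τ i) (ht : ∀ j, ∑ i ∈ s j, τ i < 1)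
    (hh : ∀ j, h j ≤ c / (1 - ∑ i ∈ s j, τ i)) (j : ι) :
    ∑ i ∈ s j, τ i * h i ≤ (∑ i ∈ s j, τ i) / (1 - ∑ i ∈ s j, τ i) * c := by
  have hj := ht j
  calc _ ≤ ∑ i ∈ s j, τ i * (c / (1 - ∑ i ∈ s j, τ i)) := by
        refine Finset.sum_le_sum fun i hi => mul_le_mul_of_nonneg_left ((hh i).trans ?_) (hτ i)
        have hij := (hs i j).1 hi
        have : ∑ l ∈ s i, τ l ≤ ∑ l ∈ s j, τ l :=
          Finset.sum_le_sum_of_subset_of_nonneg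
            (fun l hl => (hs l j).2 (_root_.trans ((hs l i).1 hl) hij)) fun l _ _ => hτ l
        exact div_le_div_of_nonneg_left hc (by linarith) (by linarith)
    _ = _ := by rw [← Finset.sum_mul]; ring

theorem Admissible.norm_fst_sub_le_div (h : Admissible J τ) {z : E n × E n}
    {q : Fin m → E n × E n} (hq : Sol J z q) (j : Fin m) :
    ‖(q j).1 - z.1‖ ≤ (∑ i with i < j, τ i) / (1 - ∑ i with i < j, τ i) * jap z.1 :=
  (h.norm_fst_sub_le hq j).trans <|
    sum_mul_le_of_le_div (fun i j : Fin m => i < j) (jap_pos _).le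
      (fun j => Finset.univ.filter (· < j)) (by simp) h.nonneg
      (fun _ => (h.sum_le _).trans (by norm_num)) (h := fun i => jap (q i).1) (h.jap_fst_le hq) j

theorem Admissible.norm_snd_sub_le_div (h : Admissible J τ) {z : E n × E n}
    {q : Fin m → E n × E n} (hq : Sol J z q) (j : Fin m) :
    ‖(q j).2 - z.2‖ ≤ (∑ i with j < i, τ i) / (1 - ∑ i with j < i, τ i) * jap z.2 :=
  (h.norm_snd_sub_le hq j).trans <|
    sum_mul_le_of_le_div (fun i j : Fin m => j < i) (jap_pos _).le
      (fun j => Finset.univ.filter (j < ·)) (by simp) h.nonneg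
      (fun _ => (h.sum_le _).trans (by norm_num)) (h := fun i => jap (q i).2) (h.jap_snd_le hq) j

theorem div_one_sub_le_third {a : ℝ} (h : a ≤ 1 / 4) : a / (1 - a) ≤ 1 / 3 := by
  rw [div_le_iff₀ (by linarith)]; linarith

theorem Admissible.norm_fst_sub_le_third (h : Admissible J τ) {z : E n × E n}
    {q : Fin m → E n × E n} (hq : Sol J z q) (j : Fin m) :
    ‖(q j).1 - z.1‖ ≤ 1 / 3 * jap z.1 :=
  (h.norm_fst_sub_le_div hq j).trans <| mul_le_mul_of_nonneg_right
    (div_one_sub_le_third (h.sum_le _).le) (jap_pos _).le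

theorem Admissible.norm_snd_sub_le_third (h : Admissible J τ) {z : E n × E n}
    {q : Fin m → E n × E n} (hq : Sol J z q) (j : Fin m) :
    ‖(q j).2 - z.2‖ ≤ 1 / 3 * jap z.2 :=
  (h.norm_snd_sub_le_div hq j).trans <| mul_le_mul_of_nonneg_right
    (div_one_sub_le_third (h.sum_le _).le) (jap_pos _).le

/-- `1 / (1 - a)` is the possible growth of one weight and `1 - b / (1 - b)` the possible shrinking
of the other. Both sides agree at `a = 0`, `b = 1/4`, so 3/2 is sharp for this inequality. -/
theorem div_mul_le_three_halves {a b : ℝ} (ha : 0 ≤ a) (hb : 0 ≤ b) (hab : a + b < 1 / 4) :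
    1 / (1 - a) ≤ 3 / 2 * (1 - b / (1 - b)) := by
  have h1 : 0 < 1 - a := by linarith
  have h2 : 0 < 1 - b := by linarith
  have h3 : 1 - b / (1 - b) = (1 - 2 * b) / (1 - b) := by field_simp; ring
  rw [h3, ← mul_div_assoc, div_le_div_iff₀ h1 h2]
  nlinarith [mul_nonneg ha hb]

/-- Along a solution the quotient of the weights varies at most by the factor `3/2`. -/
theorem Admissible.jap_fst_mul_le (h : Admissible J τ) {z : E n × E n}
    {q : Fin m → E n × E n} (hq : Sol J z q) (j : Fin m) :
    jap (q j).1 * jap z.2 ≤ 3 / 2 * (jap (q j).2 * jap z.1) := by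
  have h1 := h.jap_fst_le hq j
  have h2 := h.norm_snd_sub_le_div hq j
  have h3 := jap_sub_le z.2 ((q j).2 - z.2)
  rw [add_sub_cancel] at h3
  have h4 := div_mul_le_three_halves (Finset.sum_nonneg fun i _ => h.nonneg i)
    (Finset.sum_nonneg fun i _ => h.nonneg i) (h.sum_add_sum_le j)
  set a := ∑ i with i < j, τ i
  set b := ∑ i with j < i, τ i
  have p1 := jap_pos z.1
  have p2 := jap_pos z.2
  calc jap (q j).1 * jap z.2 ≤ jap z.1 / (1 - a) * jap z.2 := by gcongr
    _ = 1 / (1 - a) * (jap z.1 * jap z.2) := by ring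
    _ ≤ 3 / 2 * (1 - b / (1 - b)) * (jap z.1 * jap z.2) := by gcongr
    _ = 3 / 2 * ((jap z.2 - b / (1 - b) * jap z.2) * jap z.1) := by ring
    _ ≤ _ := by gcongr; linarith

theorem Admissible.jap_snd_mul_le (h : Admissible J τ) {z : E n × E n}
    {q : Fin m → E n × E n} (hq : Sol J z q) (j : Fin m) :
    jap (q j).2 * jap z.1 ≤ 3 / 2 * (jap (q j).1 * jap z.2) := by
  have h1 := h.jap_snd_le hq j
  have h2 := h.norm_fst_sub_le_div hq j
  have h3 := jap_sub_le z.1 ((q j).1 - z.1)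
  rw [add_sub_cancel] at h3
  have h4 := div_mul_le_three_halves (Finset.sum_nonneg fun i _ => h.nonneg i)
    (Finset.sum_nonneg fun i _ => h.nonneg i) ((add_comm _ _).trans_lt (h.sum_add_sum_le j))
  set a := ∑ i with i < j, τ i
  set b := ∑ i with j < i, τ i
  have p1 := jap_pos z.1
  have p2 := jap_pos z.2
  calc jap (q j).2 * jap z.1 ≤ jap z.2 / (1 - b) * jap z.1 := by gcongr
    _ = 1 / (1 - b) * (jap z.2 * jap z.1) := by ring
    _ ≤ 3 / 2 * (1 - a / (1 - a)) * (jap z.2 * jap z.1) := by gcongr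
    _ = 3 / 2 * ((jap z.1 - a / (1 - a) * jap z.1) * jap z.2) := by ring
    _ ≤ _ := by gcongr; linarith

/-- Block bounds for the rescaled functions, in terms of a bound on the change of the quotient of
the weights. -/
theorem VectorBound.hessBound_scaled {t c : ℝ} {f : Fun n} (h : VectorBound t f)
    (hf : ContDiff ℝ ∞ f) {p z : E n × E n}
    (h1 : jap (rescale p z).1 * jap p.2 ≤ c * (jap (rescale p z).2 * jap p.1))
    (h2 : jap (rescale p z).2 * jap p.1 ≤ c * (jap (rescale p z).1 * jap p.2)) :
    HessBound (c * t) t (c * t) (scaled p f) z := by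
  have ht : 0 ≤ t := (norm_nonneg _).trans (h.xxi p.1 p.2)
  have a1 := jap_pos p.1
  have a2 := jap_pos p.2
  have a3 := jap_pos (rescale p z).1
  have a4 := jap_pos (rescale p z).2
  refine ((h.hessBound hf (rescale p z)).scaled hf).mono ?_ ?_
  · rw [mul_assoc, mul_comm c]
    gcongr
    rw [div_mul_div_comm, div_le_iff₀ (by positivity)]
    exact h2
  · rw [mul_assoc, mul_comm c]
    gcongr
    rw [div_mul_div_comm, div_le_iff₀ (by positivity)]
    exact h1

theorem norm_smul_inv_le {a c : ℝ} (ha : 0 < a) {v : E n} (h : ‖v‖ ≤ c * a) :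
    ‖a⁻¹ • v‖ ≤ c := by
  rw [norm_smul, norm_inv, Real.norm_of_nonneg ha.le, inv_mul_le_iff₀ ha, mul_comm]
  exact h

theorem norm_unscale_le {p w : E n × E n} {c : ℝ} (h1 : ‖w.1 - p.1‖ ≤ c * jap p.1)
    (h2 : ‖w.2 - p.2‖ ≤ c * jap p.2) : ‖unscale p w‖ ≤ c :=
  max_le (norm_smul_inv_le (jap_pos _) h1) (norm_smul_inv_le (jap_pos _) h2)

/-- The weights on the rescaled ball of radius `1/3`. -/
theorem jap_rescale_bounds {p w : E n × E n} (h : ‖w‖ ≤ 1 / 3) :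
    jap (rescale p w).1 ≤ 4 / 3 * jap p.1 ∧ 2 / 3 * jap p.1 ≤ jap (rescale p w).1 ∧
    jap (rescale p w).2 ≤ 4 / 3 * jap p.2 ∧ 2 / 3 * jap p.2 ≤ jap (rescale p w).2 := by
  have key : ∀ a v : E n, ‖v‖ ≤ 1 / 3 →
      jap (a + jap a • v) ≤ 4 / 3 * jap a ∧ 2 / 3 * jap a ≤ jap (a + jap a • v) := by
    intro a v hv
    have h1 := jap_add_le a (jap a • v)
    have h2 := jap_sub_le a (jap a • v)
    have h3 : ‖jap a • v‖ ≤ jap a * (1 / 3) := by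
      rw [norm_smul, Real.norm_of_nonneg (jap_pos a).le]
      exact mul_le_mul_of_nonneg_left hv (jap_pos a).le
    constructor <;> linarith
  obtain ⟨h1, h2⟩ := key p.1 w.1 ((norm_fst_le w).trans h)
  obtain ⟨h3, h4⟩ := key p.2 w.2 ((norm_snd_le w).trans h)
  exact ⟨h1, h2, h3, h4⟩

/-- On the ball of radius 1/3 quotients of weights change by at most `(4/3) / (2/3) = 2`, so a row
of the block bounds adds up to `2t + t`. -/
theorem VectorBound.norm_fderiv_sgrad_scaled_le {t : ℝ} {f : Fun n} (h : VectorBound t f)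
    (hf : ContDiff ℝ ∞ f) {p w : E n × E n} (hw : ‖w‖ ≤ 1 / 3) :
    ‖fderiv ℝ (sgrad (scaled p f)) w‖ ≤ 3 * t := by
  have ht : 0 ≤ t := (norm_nonneg _).trans (h.xxi p.1 p.2)
  obtain ⟨h1, h2, h3, h4⟩ := jap_rescale_bounds (p := p) hw
  have a1 := jap_pos p.1
  have a2 := jap_pos p.2
  have := (h.hessBound_scaled hf (p := p) (z := w) (c := 2) (by
      calc _ ≤ (4 / 3 * jap p.1) * jap p.2 := by gcongr
        _ = 2 * ((2 / 3 * jap p.2) * jap p.1) := by ring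
        _ ≤ _ := by gcongr) (by
      calc _ ≤ (4 / 3 * jap p.2) * jap p.1 := by gcongr
        _ = 2 * ((2 / 3 * jap p.1) * jap p.2) := by ring
        _ ≤ _ := by gcongr)).norm_fderiv_le (by positivity) ht
  linarith

theorem VectorBound.norm_sgrad_scaled_le {t : ℝ} {f : Fun n} (h : VectorBound t f)
    (hf : ContDiff ℝ ∞ f) {p w : E n × E n} (hw : ‖w‖ ≤ 1 / 3) :
    ‖sgrad (scaled p f) w‖ ≤ 4 / 3 * t := by
  have ht : 0 ≤ t := (norm_nonneg _).trans (h.xxi p.1 p.2)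
  obtain ⟨h1, h2, h3, h4⟩ := jap_rescale_bounds (p := p) hw
  rw [sgrad_scaled hf]
  refine max_le (norm_smul_inv_le (jap_pos _) ?_) (norm_smul_inv_le (jap_pos _) ?_)
  · calc _ ≤ t * jap (rescale p w).2 := h.x _ _
      _ ≤ t * (4 / 3 * jap p.2) := by gcongr
      _ = _ := by ring
  · calc _ ≤ t * jap (rescale p w).1 := h.xi _ _
      _ ≤ t * (4 / 3 * jap p.1) := by gcongr
      _ = _ := by ring

/-! ### Unique solvability -/

/-- Mean value inequality on the convex ball; the Lipschitz constants `3 τ_i` sum to less than 3/4.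
-/
theorem Admissible.lipschitz (h : Admissible J τ) (p : E n × E n) {q q' : Fin m → E n × E n}
    (hq : ‖q‖ ≤ 1 / 3) (hq' : ‖q'‖ ≤ 1 / 3) (j : Fin m) :
    ‖∑ i, couple j i (sgrad (scaled p (J i)) (q i)) -
      ∑ i, couple j i (sgrad (scaled p (J i)) (q' i))‖ ≤ 3 / 4 * ‖q - q'‖ := by
  rw [← Finset.sum_sub_distrib]
  calc _ ≤ ∑ i, 3 * τ i * ‖q - q'‖ := by
        refine (norm_sum_le _ _).trans (Finset.sum_le_sum fun i _ => ?_)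
        rw [← map_sub]
        refine (norm_couple_apply_le _ _ _).trans ?_
        have hm := (convex_closedBall (0 : E n × E n) (1 / 3)).norm_image_sub_le_of_norm_fderiv_le
          (𝕜 := ℝ) (f := sgrad (scaled p (J i))) (C := 3 * τ i) (x := q' i) (y := q i)
          (fun x _ => (contDiff_sgrad (contDiff_scaled (h.smooth i) p)).differentiable (by simp) x)
          (fun x hx => (h.vb i).norm_fderiv_sgrad_scaled_le (h.smooth i) (by simpa using hx))
          (by simpa using (norm_le_pi_norm q' i).trans hq')
          (by simpa using (norm_le_pi_norm q i).trans hq)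
        refine hm.trans ?_
        have := h.nonneg i
        gcongr
        exact norm_le_pi_norm (q - q') i
    _ = 3 * (∑ i, τ i) * ‖q - q'‖ := by rw [Finset.mul_sum, Finset.sum_mul]
    _ ≤ _ := by
        have := h.sum_lt
        gcongr
        linarith

theorem Admissible.exists_sol (h : Admissible J τ) (p : E n × E n) : ∃ q, Sol J p q := by
  set T : (Fin m → E n × E n) → Fin m → E n × E n :=
    fun q j => ∑ i, couple j i (sgrad (scaled p (J i)) (q i)) with hT
  -- The rescaled gradients are bounded by `4/3 τ_i`, and `4/3 · 1/4 = 1/3` is the radius of the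
  -- ball.
  have hmaps : Set.MapsTo T (Metric.closedBall 0 (1 / 3)) (Metric.closedBall 0 (1 / 3)) := by
    intro q hq
    rw [mem_closedBall_zero_iff] at hq ⊢
    refine (pi_norm_le_iff_of_nonneg (by norm_num)).2 fun j => ?_
    calc ‖T q j‖ ≤ ∑ i, 4 / 3 * τ i := by
          refine (norm_sum_le _ _).trans (Finset.sum_le_sum fun i _ => ?_)
          exact (norm_couple_apply_le _ _ _).trans
            ((h.vb i).norm_sgrad_scaled_le (h.smooth i) ((norm_le_pi_norm q i).trans hq))
      _ ≤ _ := by rw [← Finset.mul_sum]; have := h.sum_lt; linarith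
  have hcontr : ContractingWith (3 / 4) (hmaps.restrict T _ _) := by
    refine ⟨by rw [← NNReal.coe_lt_coe]; norm_num, LipschitzWith.of_dist_le_mul fun q q' => ?_⟩
    have hq := mem_closedBall_zero_iff.1 q.2
    have hq' := mem_closedBall_zero_iff.1 q'.2
    rw [Subtype.dist_eq, Subtype.dist_eq, dist_eq_norm, dist_eq_norm]
    refine (pi_norm_le_iff_of_nonneg (by positivity)).2 fun j => ?_
    simpa using h.lipschitz p hq hq' j
  obtain ⟨q, -, hq, -⟩ := hcontr.exists_fixedPoint' Metric.isClosed_closedBall.isComplete hmaps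
    (x := 0) (by simp) (edist_ne_top _ _)
  refine ⟨fun i => rescale p (q i), ?_⟩
  have := (sol_scaled_iff h.smooth p 0 q).1 fun j => by
    rw [zero_add]; exact (congrFun hq j).symm
  simpa using this

theorem Admissible.norm_unscale_le (h : Admissible J τ) {p : E n × E n} {q : Fin m → E n × E n}
    (hq : Sol J p q) (i : Fin m) : ‖unscale p (q i)‖ ≤ 1 / 3 :=
  SGPhase.norm_unscale_le (h.norm_fst_sub_le_third hq i) (h.norm_snd_sub_le_third hq i)

/-- The contraction argument only sees the ball, but the Gronwall bound places every solution in it,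
so no smallness is assumed. -/
theorem Admissible.sol_unique (h : Admissible J τ) {p : E n × E n} {q q' : Fin m → E n × E n}
    (hq : Sol J p q) (hq' : Sol J p q') : q = q' := by
  have key : ∀ {q : Fin m → E n × E n}, Sol J p q →
      Sol (fun i => scaled p (J i)) 0 (fun i => unscale p (q i)) := by
    intro q hq
    rw [sol_scaled_iff h.smooth]
    simpa [rescale_unscale] using hq
  have hn : ∀ {q : Fin m → E n × E n}, Sol J p q → ‖fun i => unscale p (q i)‖ ≤ 1 / 3 :=
    fun hq => (pi_norm_le_iff_of_nonneg (by norm_num)).2 fun i => h.norm_unscale_le hq i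
  have h1 : ‖(fun i => unscale p (q i)) - fun i => unscale p (q' i)‖ ≤
      3 / 4 * ‖(fun i => unscale p (q i)) - fun i => unscale p (q' i)‖ := by
    refine (pi_norm_le_iff_of_nonneg (by positivity)).2 fun j => ?_
    have h2 := h.lipschitz p (hn hq) (hn hq') j
    have e1 := key hq j
    have e2 := key hq' j
    rw [zero_add] at e1 e2
    beta_reduce at e1 e2
    rw [Pi.sub_apply, e1, e2]
    exact h2
  have h0 : ‖(fun i => unscale p (q i)) - fun i => unscale p (q' i)‖ = 0 := by
    have := norm_nonneg ((fun i => unscale p (q i)) - fun i => unscale p (q' i))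
    linarith
  rw [norm_eq_zero, sub_eq_zero] at h0
  funext i
  rw [← rescale_unscale p (q i), ← rescale_unscale p (q' i)]
  exact congrArg _ (congrFun h0 i)

/-! ### Smooth dependence -/

/-- At the points of a solution the factor 3/2 replaces the factor 2 of the ball. With 2, the
computation in `linear_system_bound` would lead to 8/5 at `∑ τ_i = 1/4`, and not to 8/9 < 1. -/
theorem Admissible.hessBound_scaled (h : Admissible J τ) {p : E n × E n}
    {q : Fin m → E n × E n} (hq : Sol J p q) (i : Fin m) :
    HessBound (3 / 2 * τ i) (τ i) (3 / 2 * τ i) (scaled p (J i)) (unscale p (q i)) := by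
  refine (h.vb i).hessBound_scaled (h.smooth i) ?_ ?_
  · rw [rescale_unscale]; exact h.jap_fst_mul_le hq i
  · rw [rescale_unscale]; exact h.jap_snd_mul_le hq i

/-- `(3/2 + 1) · 1/4 = 5/8`, the contraction constant of the linearized system. -/
theorem Admissible.sum_norm_fderiv_le (h : Admissible J τ) {p : E n × E n}
    {q : Fin m → E n × E n} (hq : Sol J p q) :
    ∑ i, ‖fderiv ℝ (sgrad (scaled p (J i))) (unscale p (q i))‖ ≤ 5 / 8 := by
  calc _ ≤ ∑ i, 5 / 2 * τ i := Finset.sum_le_sum fun i _ => by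
        have := h.nonneg i
        have := (h.hessBound_scaled hq i).norm_fderiv_le (by positivity) (by positivity)
        linarith
    _ ≤ _ := by rw [← Finset.mul_sum]; have := h.sum_lt; linarith

/-- Solutions are the preimages under `Θ` of the constant families `(z, …, z)`. Its derivative is `1
- B` with `‖B‖ < 1`, invertible by the Neumann series, so `Θ` has a smooth local inverse; global
uniqueness identifies it with `q` on the diagonal. -/
theorem contDiffAt_of_system {W : Type*} [NormedAddCommGroup W] [NormedSpace ℝ W]
    [CompleteSpace W] {g : Fin m → W → W} {A : Fin m → Fin m → W →L[ℝ] W}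
    (hg : ∀ i, ContDiff ℝ ∞ (g i)) (hA : ∀ j i, ‖A j i‖ ≤ 1) {q : W → Fin m → W} {z₀ : W}
    (hq : ∀ j, q z₀ j = z₀ + ∑ i, A j i (g i (q z₀ i)))
    (huniq : ∀ z q', (∀ j, q' j = z + ∑ i, A j i (g i (q' i))) → q' = q z)
    (hlin : ∑ i, ‖fderiv ℝ (g i) (q z₀ i)‖ < 1) : ContDiffAt ℝ ∞ q z₀ := by
  set Θ : (Fin m → W) → Fin m → W := fun v j => v j - ∑ i, A j i (g i (v i)) with hΘ
  have hs : ContDiff ℝ ∞ Θ := by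
    refine contDiff_pi.2 fun j => (contDiff_apply ℝ W j).sub (ContDiff.sum fun i _ => ?_)
    exact (A j i).contDiff.comp ((hg i).comp (contDiff_apply ℝ W i))
  set B : (Fin m → W) →L[ℝ] Fin m → W := ContinuousLinearMap.pi fun j =>
    ∑ i, (A j i).comp ((fderiv ℝ (g i) (q z₀ i)).comp (ContinuousLinearMap.proj i)) with hB
  have hBn : ‖B‖ < 1 := by
    refine lt_of_le_of_lt (ContinuousLinearMap.opNorm_le_bound _
      (Finset.sum_nonneg fun i _ => norm_nonneg _) fun v => ?_) hlin
    refine (pi_norm_le_iff_of_nonneg (by positivity)).2 fun j => ?_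
    simp only [hB, ContinuousLinearMap.coe_pi', sum_apply]
    refine (norm_sum_le _ _).trans ?_
    rw [Finset.sum_mul]
    refine Finset.sum_le_sum fun i _ => ?_
    calc _ ≤ 1 * (‖fderiv ℝ (g i) (q z₀ i)‖ * ‖v‖) := by
          refine (ContinuousLinearMap.le_of_opNorm_le _ (hA j i) _).trans ?_
          gcongr
          refine (ContinuousLinearMap.le_opNorm (fderiv ℝ (g i) (q z₀ i)) (v i)).trans ?_
          gcongr
          exact norm_le_pi_norm v i
      _ = _ := one_mul _
  have hd : HasFDerivAt Θ (1 - B) (q z₀) := by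
    rw [hasFDerivAt_pi']
    intro j
    have : (ContinuousLinearMap.proj j).comp (1 - B) = (ContinuousLinearMap.proj j) -
        ∑ i, (A j i).comp ((fderiv ℝ (g i) (q z₀ i)).comp
          (ContinuousLinearMap.proj (R := ℝ) (φ := fun _ : Fin m => W) i)) := by
      ext v; simp [hB]
    rw [this]
    refine HasFDerivAt.sub (ContinuousLinearMap.proj (R := ℝ) (φ := fun _ : Fin m => W)
      j).hasFDerivAt (HasFDerivAt.fun_sum fun i _ => ?_)
    refine (A j i).hasFDerivAt.comp _ (HasFDerivAt.comp _ ?_ ?_)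
    · exact ((hg i).differentiable (by simp) _).hasFDerivAt
    · exact (ContinuousLinearMap.proj (R := ℝ) (φ := fun _ : Fin m => W) i).hasFDerivAt
  set e : (Fin m → W) ≃L[ℝ] Fin m → W :=
    ContinuousLinearEquiv.unitsEquiv ℝ _ (Units.oneSub B hBn) with he
  have hd' : HasFDerivAt Θ (e : (Fin m → W) →L[ℝ] Fin m → W) (q z₀) := by
    have he1 : (e : (Fin m → W) →L[ℝ] Fin m → W) = 1 - B := rfl
    rw [he1]
    exact hd
  have hn : (∞ : ℕ∞ω) ≠ 0 := by simp
  have hval : Θ (q z₀) = fun _ => z₀ := by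
    funext j
    simp only [hΘ]
    nth_rewrite 1 [hq j]
    abel
  have hinv := hs.contDiffAt.to_localInverse hd' hn
  rw [hval] at hinv
  have hev : ∀ᶠ y in nhds (Θ (q z₀)), Θ (hs.contDiffAt.localInverse hd' hn y) = y :=
    (hs.contDiffAt.hasStrictFDerivAt' hd' hn).eventually_right_inverse
  rw [hval] at hev
  have hc : ContDiffAt ℝ ∞ (fun z : W => fun _ : Fin m => z) z₀ :=
    (contDiff_pi.2 fun _ => contDiff_id).contDiffAt
  have hcomp : ContDiffAt ℝ ∞
      (fun z : W => hs.contDiffAt.localInverse hd' hn fun _ : Fin m => z) z₀ :=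
    ContDiffAt.comp z₀ (g := hs.contDiffAt.localInverse hd' hn) hinv hc
  refine hcomp.congr_of_eventuallyEq ?_
  filter_upwards [hc.continuousAt.eventually hev] with z hz
  refine (huniq z _ fun j => ?_).symm
  have := congrFun hz j
  simp only [hΘ] at this
  exact (sub_eq_iff_eq_add.1 this)

/-- Smoothness at `p` is tested in the coordinates blown up at `p`, where the linearization is known
to be contractive. -/
theorem Admissible.contDiff (h : Admissible J τ) {q : E n × E n → Fin m → E n × E n}
    (hq : ∀ z, Sol J z (q z)) : ContDiff ℝ ∞ q := by
  rw [contDiff_iff_contDiffAt]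
  intro p
  have hsol : ∀ z, Sol (fun i => scaled p (J i)) z (fun i => unscale p (q (rescale p z) i)) := by
    intro z
    rw [sol_scaled_iff h.smooth]
    simpa only [rescale_unscale] using hq _
  have key : ContDiffAt ℝ ∞ (fun z i => unscale p (q (rescale p z) i)) 0 := by
    refine contDiffAt_of_system (fun i => contDiff_sgrad (contDiff_scaled (h.smooth i) p))
      (fun j i => norm_couple_le j i) (hsol 0) (fun z q' hq' => ?_) ?_
    · have h1 := (sol_scaled_iff h.smooth p z q').1 hq'
      have h2 := h.sol_unique h1 (hq _)
      funext i
      rw [← congrFun h2 i, unscale_rescale]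
    · simp only [rescale_zero]
      exact (h.sum_norm_fderiv_le (hq p)).trans_lt (by norm_num)
  have e : q = fun z i => rescale p
      ((fun z i => unscale p (q (rescale p z) i)) (unscale p z) i) := by
    funext z i
    simp only [rescale_unscale]
  have e0 : unscale p p = 0 := by
    conv_lhs => rw [← rescale_zero p]
    rw [rescale_zero]
    nth_rewrite 2 [← rescale_zero p]
    exact unscale_rescale p 0
  rw [e]
  refine contDiffAt_pi.2 fun i => (contDiff_rescale p).contDiffAt.comp p ?_
  have h3 : ContDiffAt ℝ ∞ (fun z i => unscale p (q (rescale p z) i)) (unscale p p) := by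
    rw [e0]; exact key
  exact contDiffAt_pi.1 (h3.comp p (contDiff_unscale p).contDiffAt) i

end Apriori


section CriticalValue

variable {m : ℕ} {J : Fin m → Fun n} {τ : Fin m → ℝ}

/-! ### The critical value -/

/-- The critical value, with `x · ξ` subtracted. -/
noncomputable def critVal (J : Fin m → Fun n) (z : E n × E n) (q : Fin m → E n × E n) : ℝ :=
  ∑ i, (J i (q i) - inner ℝ (sgrad (J i) (q i)).2 ((q i).2 - z.2))

theorem contDiff_critVal (hJ : ∀ i, ContDiff ℝ ∞ (J i)) {q : E n × E n → Fin m → E n × E n}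
    (hq : ContDiff ℝ ∞ q) : ContDiff ℝ ∞ (fun z => critVal J z (q z)) := by
  refine ContDiff.sum fun i _ => ?_
  have hqi : ContDiff ℝ ∞ (fun z => q z i) := contDiff_pi.1 hq i
  refine ((hJ i).comp hqi).sub (ContDiff.inner ℝ ?_ ?_)
  · exact contDiff_snd.comp ((contDiff_sgrad (hJ i)).comp hqi)
  · exact (contDiff_snd.comp hqi).sub contDiff_snd

/-- The linearization of the summed system. -/
theorem fderiv_sol (hJ : ∀ i, ContDiff ℝ ∞ (J i)) {q : E n × E n → Fin m → E n × E n}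
    (hq : ContDiff ℝ ∞ q) (hsol : ∀ z, Sol J z (q z)) (z v : E n × E n) (j : Fin m) :
    fderiv ℝ (fun z => q z j) z v =
      v + ∑ i, couple j i (fderiv ℝ (sgrad (J i)) (q z i) (fderiv ℝ (fun z => q z i) z v)) := by
  have hqi : ∀ i, HasFDerivAt (fun z => q z i) (fderiv ℝ (fun z => q z i) z) z := fun i =>
    ((contDiff_pi.1 hq i).differentiable (by simp) z).hasFDerivAt
  have e : (fun z => q z j) = fun z => z + ∑ i, couple j i (sgrad (J i) (q z i)) :=
    funext fun z => hsol z j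
  have hd : HasFDerivAt (fun z => z + ∑ i, couple j i (sgrad (J i) (q z i)))
      (ContinuousLinearMap.id ℝ (E n × E n) + ∑ i, (couple j i).comp
        ((fderiv ℝ (sgrad (J i)) (q z i)).comp (fderiv ℝ (fun z => q z i) z))) z := by
    refine (hasFDerivAt_id z).add (HasFDerivAt.fun_sum fun i _ => ?_)
    exact (couple j i).hasFDerivAt.comp z
      (HasFDerivAt.comp (g := sgrad (J i)) z (hasFDerivAt_sgrad (hJ i) (q z i)) (hqi i))
  rw [← e] at hd
  rw [hd.fderiv]
  simp

/-- The gradient of the critical value is the sum of the gradients along the solution. -/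
theorem sgrad_critVal (hJ : ∀ i, ContDiff ℝ ∞ (J i)) {q : E n × E n → Fin m → E n × E n}
    (hq : ContDiff ℝ ∞ q) (hsol : ∀ z, Sol J z (q z)) (z : E n × E n) :
    sgrad (fun z => critVal J z (q z)) z = ∑ i, sgrad (J i) (q z i) := by
  set Dq : Fin m → (E n × E n) →L[ℝ] E n × E n := fun i => fderiv ℝ (fun z => q z i) z with hDq
  set G : Fin m → (E n × E n) →L[ℝ] E n × E n := fun i =>
    (fderiv ℝ (sgrad (J i)) (q z i)).comp (Dq i) with hG
  have hqi : ∀ i, HasFDerivAt (fun z => q z i) (Dq i) z := fun i =>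
    ((contDiff_pi.1 hq i).differentiable (by simp) z).hasFDerivAt
  have hgi : ∀ i, HasFDerivAt (fun z => (sgrad (J i) (q z i)).2)
      ((ContinuousLinearMap.snd ℝ _ _).comp (G i)) z := fun i =>
    (ContinuousLinearMap.snd ℝ (E n) (E n)).hasFDerivAt.comp z
      (HasFDerivAt.comp (g := sgrad (J i)) z (hasFDerivAt_sgrad (hJ i) (q z i)) (hqi i))
  have hNi : ∀ i, HasFDerivAt (fun z => (q z i).2 - z.2)
      ((ContinuousLinearMap.snd ℝ _ _).comp (Dq i) - ContinuousLinearMap.snd ℝ _ _) z := fun i =>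
    ((ContinuousLinearMap.snd ℝ (E n) (E n)).hasFDerivAt.comp z (hqi i)).sub
      (ContinuousLinearMap.snd ℝ (E n) (E n)).hasFDerivAt
  have hd : HasFDerivAt (fun z => critVal J z (q z)) (∑ i,
      ((fderiv ℝ (J i) (q z i)).comp (Dq i) -
        (fderivInnerCLM ℝ ((sgrad (J i) (q z i)).2, (q z i).2 - z.2)).comp
          (((ContinuousLinearMap.snd ℝ _ _).comp (G i)).prod
            ((ContinuousLinearMap.snd ℝ _ _).comp (Dq i) - ContinuousLinearMap.snd ℝ _ _)))) z := by
    refine HasFDerivAt.fun_sum fun i _ => HasFDerivAt.sub ?_ ?_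
    · exact HasFDerivAt.comp z ((hJ i).differentiable (by simp) _).hasFDerivAt (hqi i)
    · exact (hgi i).inner ℝ (hNi i)
  refine sgrad_eq_of_hasFDerivAt hd fun v => ?_
  have hY : ∀ i, (Dq i v).1 = v.1 + ∑ k with k < i, (G k v).2 := by
    intro i
    simp only [hDq]
    rw [fderiv_sol hJ hq hsol z v i, Prod.fst_add, Prod.fst_sum, Finset.sum_filter]
    simp only [couple_fst]
    rfl
  have hN : ∀ i, (q z i).2 - z.2 = ∑ k with i < k, (sgrad (J k) (q z k)).1 := fun i => by
    rw [(hsol z).snd i, add_sub_cancel_left]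
  -- The two occurrences of `⟨J'_{i,ξ}, dN_i⟩` cancel. Inserting `hY` and `hN` in the rest leaves
  -- two double sums, over `k < i` and over `i < k`, which coincide after exchanging the indices;
  -- only the pairing of `∇J_i` with `v` survives the summation.
  have hterm : ∀ i, ((fderiv ℝ (J i) (q z i)).comp (Dq i) -
        (fderivInnerCLM ℝ ((sgrad (J i) (q z i)).2, (q z i).2 - z.2)).comp
          (((ContinuousLinearMap.snd ℝ _ _).comp (G i)).prod
            ((ContinuousLinearMap.snd ℝ _ _).comp (Dq i) - ContinuousLinearMap.snd ℝ _ _))) v =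
      pairing (sgrad (J i) (q z i)) v +
        (∑ k, if k < i then inner ℝ (sgrad (J i) (q z i)).1 (G k v).2 else 0) -
        ∑ k, if i < k then inner ℝ (sgrad (J k) (q z k)).1 (G i v).2 else 0 := by
    intro i
    have e1 : fderiv ℝ (J i) (q z i) (Dq i v) = pairing (sgrad (J i) (q z i)) (Dq i v) :=
      (pairing_sgrad ((hJ i).differentiable (by simp) _) _).symm
    have e2 : ∑ k, (if k < i then inner ℝ (sgrad (J i) (q z i)).1 (G k v).2 else 0) =
        inner ℝ (sgrad (J i) (q z i)).1 ((Dq i v).1 - v.1) := by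
      rw [hY i, add_sub_cancel_left, inner_sum, Finset.sum_filter]
    have e3 : ∑ k, (if i < k then inner ℝ (sgrad (J k) (q z k)).1 (G i v).2 else 0) =
        inner ℝ (G i v).2 ((q z i).2 - z.2) := by
      rw [real_inner_comm, hN i, sum_inner, Finset.sum_filter]
    rw [e2, e3]
    simp only [sub_apply, ContinuousLinearMap.comp_apply, e1,
      fderivInnerCLM_apply, ContinuousLinearMap.prod_apply, ContinuousLinearMap.coe_snd',
      pairing, inner_sub_right]
    ring
  rw [sum_apply, Finset.sum_congr rfl fun i _ => hterm i, Finset.sum_sub_distrib,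
    Finset.sum_add_distrib, ← pairing_sum_left]
  rw [Finset.sum_comm (f := fun i k =>
    if i < k then inner ℝ (sgrad (J k) (q z k)).1 (G i v).2 else 0)]
  ring

/-- The solution in rescaled coordinates. -/
theorem sol_unscale (hJ : ∀ i, ContDiff ℝ ∞ (J i)) {q : E n × E n → Fin m → E n × E n}
    (hsol : ∀ z, Sol J z (q z)) (p z : E n × E n) :
    Sol (fun i => scaled p (J i)) z (fun i => unscale p (q (rescale p z) i)) := by
  rw [sol_scaled_iff hJ]
  simpa only [rescale_unscale] using hsol _

theorem contDiff_unscale_comp {q : E n × E n → Fin m → E n × E n} (hq : ContDiff ℝ ∞ q)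
    (p : E n × E n) : ContDiff ℝ ∞ (fun z i => unscale p (q (rescale p z) i)) :=
  contDiff_pi.2 fun i =>
    (contDiff_unscale p).comp ((contDiff_pi.1 hq i).comp (contDiff_rescale p))

theorem dualScale_sum {ι : Type*} (s : Finset ι) (p : E n × E n) (v : ι → E n × E n) :
    dualScale p (∑ i ∈ s, v i) = ∑ i ∈ s, dualScale p (v i) := by
  ext1 <;> simp [dualScale, Prod.fst_sum, Prod.snd_sum, Finset.smul_sum]

theorem sgrad_scaled_critVal (hJ : ∀ i, ContDiff ℝ ∞ (J i)) {q : E n × E n → Fin m → E n × E n}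
    (hq : ContDiff ℝ ∞ q) (hsol : ∀ z, Sol J z (q z)) (p : E n × E n) :
    sgrad (scaled p fun z => critVal J z (q z)) =
      fun z => ∑ i, sgrad (scaled p (J i)) (unscale p (q (rescale p z) i)) := by
  funext z
  rw [sgrad_scaled (contDiff_critVal hJ hq), sgrad_critVal hJ hq hsol, dualScale_sum]
  refine Finset.sum_congr rfl fun i _ => ?_
  rw [sgrad_scaled (hJ i), rescale_unscale]

/-! ### Bounds of orders zero, one and two -/

/-- The maxima `U`, `V` of the two components satisfy a 2 × 2 system of inequalities, solved with `∑
τ_i` replaced by 1/4. The factor `∑ τ_i` in front of the final bounds is kept, so that they are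
linear in it. -/
theorem linear_system_bound (hτ : ∀ i, 0 ≤ τ i) (hs : ∑ i, τ i ≤ 1 / 4) {e : E n × E n}
    {u G : Fin m → E n × E n} (hu : ∀ j, u j = e + ∑ i, couple j i (G i))
    (h1 : ∀ i, ‖(G i).1‖ ≤ 3 / 2 * τ i * ‖(u i).1‖ + τ i * ‖(u i).2‖)
    (h2 : ∀ i, ‖(G i).2‖ ≤ τ i * ‖(u i).1‖ + 3 / 2 * τ i * ‖(u i).2‖) :
    ‖(∑ i, G i).1‖ ≤ 32 / 9 * (∑ i, τ i) * ‖e.1‖ + 28 / 9 * (∑ i, τ i) * ‖e.2‖ ∧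
    ‖(∑ i, G i).2‖ ≤ 28 / 9 * (∑ i, τ i) * ‖e.1‖ + 32 / 9 * (∑ i, τ i) * ‖e.2‖ := by
  set U := ‖fun i => (u i).1‖
  set V := ‖fun i => (u i).2‖
  set t := ∑ i, τ i with ht
  have ht0 : 0 ≤ t := Finset.sum_nonneg fun i _ => hτ i
  have hU0 : 0 ≤ U := norm_nonneg _
  have hV0 : 0 ≤ V := norm_nonneg _
  have hU : ∀ i, ‖(u i).1‖ ≤ U := fun i => norm_le_pi_norm (fun i => (u i).1) i
  have hV : ∀ i, ‖(u i).2‖ ≤ V := fun i => norm_le_pi_norm (fun i => (u i).2) i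
  have g1 : ∀ i, ‖(G i).1‖ ≤ τ i * (3 / 2 * U + V) := fun i => by
    have := hτ i
    calc _ ≤ 3 / 2 * τ i * U + τ i * V := (h1 i).trans (by gcongr; exacts [hU i, hV i])
      _ = _ := by ring
  have g2 : ∀ i, ‖(G i).2‖ ≤ τ i * (U + 3 / 2 * V) := fun i => by
    have := hτ i
    calc _ ≤ τ i * U + 3 / 2 * τ i * V := (h2 i).trans (by gcongr; exacts [hU i, hV i])
      _ = _ := by ring
  have s1 : ∑ i, ‖(G i).1‖ ≤ t * (3 / 2 * U + V) := by
    rw [ht, Finset.sum_mul]; exact Finset.sum_le_sum fun i _ => g1 i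
  have s2 : ∑ i, ‖(G i).2‖ ≤ t * (U + 3 / 2 * V) := by
    rw [ht, Finset.sum_mul]; exact Finset.sum_le_sum fun i _ => g2 i
  have bU : U ≤ ‖e.1‖ + t * (U + 3 / 2 * V) := by
    refine (pi_norm_le_iff_of_nonneg (by positivity)).2 fun j => ?_
    rw [hu j, Prod.fst_add, Prod.fst_sum]
    refine (norm_add_le _ _).trans (add_le_add le_rfl (((norm_sum_le _ _).trans
      (Finset.sum_le_sum fun i _ => ?_)).trans s2))
    rw [couple_fst]; split_ifs <;> simp
  have bV : V ≤ ‖e.2‖ + t * (3 / 2 * U + V) := by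
    refine (pi_norm_le_iff_of_nonneg (by positivity)).2 fun j => ?_
    rw [hu j, Prod.snd_add, Prod.snd_sum]
    refine (norm_add_le _ _).trans (add_le_add le_rfl (((norm_sum_le _ _).trans
      (Finset.sum_le_sum fun i _ => ?_)).trans s1))
    rw [couple_snd]; split_ifs <;> simp
  have bU' : U ≤ ‖e.1‖ + 1 / 4 * (U + 3 / 2 * V) := bU.trans (by gcongr)
  have bV' : V ≤ ‖e.2‖ + 1 / 4 * (3 / 2 * U + V) := bV.trans (by gcongr)
  have cU : U ≤ 16 / 9 * ‖e.1‖ + 8 / 9 * ‖e.2‖ := by linarith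
  have cV : V ≤ 8 / 9 * ‖e.1‖ + 16 / 9 * ‖e.2‖ := by linarith
  constructor
  · rw [Prod.fst_sum]
    calc _ ≤ t * (3 / 2 * U + V) := (norm_sum_le _ _).trans s1
      _ ≤ t * (3 / 2 * (16 / 9 * ‖e.1‖ + 8 / 9 * ‖e.2‖) + (8 / 9 * ‖e.1‖ + 16 / 9 * ‖e.2‖)) := by
        gcongr
      _ = _ := by ring
  · rw [Prod.snd_sum]
    calc _ ≤ t * (U + 3 / 2 * V) := (norm_sum_le _ _).trans s2
      _ ≤ t * ((16 / 9 * ‖e.1‖ + 8 / 9 * ‖e.2‖) + 3 / 2 * (8 / 9 * ‖e.1‖ + 16 / 9 * ‖e.2‖)) := by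
        gcongr
      _ = _ := by ring

theorem Admissible.hessBound_critVal (h : Admissible J τ) {q : E n × E n → Fin m → E n × E n}
    (hsol : ∀ z, Sol J z (q z)) (p : E n × E n) :
    HessBound (32 / 9 * ∑ i, τ i) (28 / 9 * ∑ i, τ i) (32 / 9 * ∑ i, τ i)
      (scaled p fun z => critVal J z (q z)) 0 := by
  have hq := h.contDiff hsol
  have hf := fun i => contDiff_scaled (h.smooth i) p
  set Q : E n × E n → Fin m → E n × E n := fun z i => unscale p (q (rescale p z) i) with hQ
  have hQs : ContDiff ℝ ∞ Q := contDiff_unscale_comp hq p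
  intro e
  have hd : fderiv ℝ (sgrad (scaled p fun z => critVal J z (q z))) 0 e =
      ∑ i, fderiv ℝ (sgrad (scaled p (J i))) (Q 0 i) (fderiv ℝ (fun z => Q z i) 0 e) := by
    rw [sgrad_scaled_critVal h.smooth hq hsol p]
    have : HasFDerivAt (fun z => ∑ i, sgrad (scaled p (J i)) (Q z i))
        (∑ i, (fderiv ℝ (sgrad (scaled p (J i))) (Q 0 i)).comp (fderiv ℝ (fun z => Q z i) 0)) 0 :=
      HasFDerivAt.fun_sum fun i _ => HasFDerivAt.comp (g := sgrad (scaled p (J i))) 0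
        (hasFDerivAt_sgrad (hf i) (Q 0 i))
        ((contDiff_pi.1 hQs i).differentiable (by simp) 0).hasFDerivAt
    rw [this.fderiv]
    simp
  rw [hd]
  have hb : ∀ i, HessBound (3 / 2 * τ i) (τ i) (3 / 2 * τ i) (scaled p (J i)) (Q 0 i) := by
    intro i
    simp only [hQ, rescale_zero]
    exact h.hessBound_scaled (hsol p) i
  exact linear_system_bound h.nonneg h.sum_lt.le (e := e)
    (fun j => fderiv_sol hf hQs (sol_unscale h.smooth hsol p) 0 e j)
    (fun i => (hb i _).1) (fun i => (hb i _).2)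

theorem Admissible.jap_fst_le_four_thirds (h : Admissible J τ) {z : E n × E n}
    {q : Fin m → E n × E n} (hq : Sol J z q) (j : Fin m) : jap (q j).1 ≤ 4 / 3 * jap z.1 := by
  have h1 := jap_add_le z.1 ((q j).1 - z.1)
  rw [add_sub_cancel] at h1
  have := h.norm_fst_sub_le_third hq j
  linarith

theorem Admissible.jap_snd_le_four_thirds (h : Admissible J τ) {z : E n × E n}
    {q : Fin m → E n × E n} (hq : Sol J z q) (j : Fin m) : jap (q j).2 ≤ 4 / 3 * jap z.2 := by
  have h1 := jap_add_le z.2 ((q j).2 - z.2)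
  rw [add_sub_cancel] at h1
  have := h.norm_snd_sub_le_third hq j
  linarith

theorem Admissible.norm_sgrad_critVal_fst_le (h : Admissible J τ)
    {q : E n × E n → Fin m → E n × E n} (hsol : ∀ z, Sol J z (q z)) (z : E n × E n) :
    ‖(sgrad (fun z => critVal J z (q z)) z).1‖ ≤ 4 / 3 * (∑ i, τ i) * jap z.2 := by
  rw [sgrad_critVal h.smooth (h.contDiff hsol) hsol, Prod.fst_sum, Finset.mul_sum, Finset.sum_mul]
  refine (norm_sum_le _ _).trans (Finset.sum_le_sum fun i _ => ?_)
  have := h.nonneg i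
  calc _ ≤ τ i * jap (q z i).2 := (h.vb i).x _ _
    _ ≤ τ i * (4 / 3 * jap z.2) := by gcongr; exact h.jap_snd_le_four_thirds (hsol z) i
    _ = _ := by ring

theorem Admissible.norm_sgrad_critVal_snd_le (h : Admissible J τ)
    {q : E n × E n → Fin m → E n × E n} (hsol : ∀ z, Sol J z (q z)) (z : E n × E n) :
    ‖(sgrad (fun z => critVal J z (q z)) z).2‖ ≤ 4 / 3 * (∑ i, τ i) * jap z.1 := by
  rw [sgrad_critVal h.smooth (h.contDiff hsol) hsol, Prod.snd_sum, Finset.mul_sum, Finset.sum_mul]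
  refine (norm_sum_le _ _).trans (Finset.sum_le_sum fun i _ => ?_)
  have := h.nonneg i
  calc _ ≤ τ i * jap (q z i).1 := (h.vb i).xi _ _
    _ ≤ τ i * (4 / 3 * jap z.1) := by gcongr; exact h.jap_fst_le_four_thirds (hsol z) i
    _ = _ := by ring

/-- Because `critVal` pairs `J'_{i,ξ}` with `N_i - ξ`, each summand is of size `b_i ⟨x⟩⟨ξ⟩`; the
constant is `16/9 + 4/9`. -/
theorem Admissible.abs_critVal_le (h : Admissible J τ) {b : Fin m → ℝ} (hτb : ∀ i, τ i ≤ b i)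
    (h0 : ∀ i p, |J i p| ≤ b i * (jap p.1 * jap p.2))
    {q : E n × E n → Fin m → E n × E n} (hsol : ∀ z, Sol J z (q z)) (z : E n × E n) :
    |critVal J z (q z)| ≤ 20 / 9 * (∑ i, b i) * (jap z.1 * jap z.2) := by
  rw [critVal, Finset.mul_sum, Finset.sum_mul]
  refine (Finset.abs_sum_le_sum_abs _ _).trans (Finset.sum_le_sum fun i _ => ?_)
  have hb := (h.nonneg i).trans (hτb i)
  have p1 := jap_pos z.1
  have p2 := jap_pos z.2
  have q1 := jap_pos (q z i).1
  have q2 := jap_pos (q z i).2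
  have hY := h.jap_fst_le_four_thirds (hsol z) i
  have hN := h.jap_snd_le_four_thirds (hsol z) i
  refine (abs_sub _ _).trans ?_
  have e1 : |J i (q z i)| ≤ b i * ((4 / 3 * jap z.1) * (4 / 3 * jap z.2)) :=
    (h0 i _).trans (by gcongr)
  have e2 : |inner ℝ (sgrad (J i) (q z i)).2 ((q z i).2 - z.2)| ≤
      (b i * (4 / 3 * jap z.1)) * (1 / 3 * jap z.2) := by
    refine (abs_real_inner_le_norm _ _).trans ?_
    gcongr
    · calc _ ≤ τ i * jap (q z i).1 := (h.vb i).xi _ _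
        _ ≤ b i * (4 / 3 * jap z.1) := by gcongr; exact hτb i
    · exact h.norm_snd_sub_le_third (hsol z) i
  calc _ ≤ _ := add_le_add e1 e2
    _ = _ := by ring

/-! ### Bounds of all orders -/

/-- The pairing with a basis vector, as a linear form. -/
noncomputable def coordL (c : Fin n ⊕ Fin n) : (E n × E n) →L[ℝ] ℝ :=
  LinearMap.mkContinuous
    { toFun := fun v => pairing v (basisVec c)
      map_add' := fun a b => pairing_add_left a b _
      map_smul' := fun r a => by simp [pairing, real_inner_smul_left, mul_add] } 1 <| by
    intro v
    rw [one_mul]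
    change |pairing v (basisVec c)| ≤ ‖v‖
    cases c with
    | inl i =>
      have := (abs_real_inner_le_norm v.1 (EuclideanSpace.single i (1 : ℝ)))
      simp only [pairing, basisVec, inner_zero_right, add_zero]
      refine this.trans ?_
      simpa using norm_fst_le v
    | inr i =>
      have := (abs_real_inner_le_norm v.2 (EuclideanSpace.single i (1 : ℝ)))
      simp only [pairing, basisVec, inner_zero_right, zero_add]
      refine this.trans ?_
      simpa using norm_snd_le v

theorem norm_coordL_le (c : Fin n ⊕ Fin n) : ‖coordL c‖ ≤ 1 :=
  LinearMap.mkContinuous_norm_le _ zero_le_one _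

/-- The last letter of a word is differentiated first and picks a component of the gradient. The
envelope formula thus applies to every derivative of positive order. -/
theorem abs_wordDeriv_append_le {f : Fun n} (hf : ContDiff ℝ ∞ f) (w : List (Fin n ⊕ Fin n))
    (c : Fin n ⊕ Fin n) (p : E n × E n) :
    |wordDeriv (w ++ [c]) f p| ≤ ‖iteratedFDeriv ℝ w.length (sgrad f) p‖ := by
  have e : wordDeriv [c] f = fun p => coordL c (sgrad f p) :=
    funext fun p => wordDeriv_singleton hf c p
  rw [wordDeriv_append, e]
  refine (abs_wordDeriv_le ((coordL c).contDiff.comp (contDiff_sgrad hf)) w p).trans ?_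
  have := ContinuousLinearMap.norm_iteratedFDeriv_comp_left (coordL c) (n := w.length)
    (f := sgrad f) (x := p) (N := ∞) (contDiff_sgrad hf).contDiffAt (by exact_mod_cast le_top)
  exact this.trans (mul_le_of_le_one_left (norm_nonneg _) (norm_coordL_le c))

theorem norm_iteratedFDeriv_sgrad_le {f : Fun n} (hf : ContDiff ℝ ∞ f) (l : ℕ) (p : E n × E n) :
    ‖iteratedFDeriv ℝ l (sgrad f) p‖ ≤
      ‖(gradL : _ →L[ℝ] E n × E n)‖ * ‖iteratedFDeriv ℝ (l + 1) f p‖ := by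
  have := ContinuousLinearMap.norm_iteratedFDeriv_comp_left (gradL : _ →L[ℝ] E n × E n) (n := l)
    (f := fderiv ℝ f) (x := p) (N := ∞) (hf.fderiv_right (m := ∞) (by simp)).contDiffAt
    (by exact_mod_cast le_top)
  rw [norm_iteratedFDeriv_fderiv] at this
  rw [sgrad_eq_comp hf]
  exact this

/-- Bounds of all positive orders on the critical value, uniform in the number of functions. -/
theorem exists_mixedDeriv_critVal_bound (n K : ℕ) (B : ℝ) :
    ∃ C : ℝ, 0 ≤ C ∧ ∀ (m : ℕ) (J : Fin m → Fun n) (τ b : Fin m → ℝ), Admissible J τ →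
      (∀ i, 0 ≤ b i) → ∑ i, b i ≤ B →
      (∀ i, ∀ α β : MIdx n, 1 ≤ α.order + β.order → α.order + β.order ≤ K + 1 → ∀ x ξ,
        |mixedDeriv α β (J i) (x, ξ)| ≤ b i * sgWeight 1 1 α β x ξ) →
      ∀ q : E n × E n → Fin m → E n × E n, (∀ z, Sol J z (q z)) →
      ∀ α β : MIdx n, 1 ≤ α.order + β.order → α.order + β.order ≤ K + 1 → ∀ x ξ,
        |mixedDeriv α β (fun z => critVal J z (q z)) (x, ξ)| ≤
          C * (∑ i, b i) * sgWeight 1 1 α β x ξ := by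
  -- `(2n)^(l+1)` from the basis expansion times `4 · 2^(l+1)` from comparing weights. Adding 1 to
  -- the base `4n` makes its powers increasing in `l`, also for `n = 0`.
  set c : ℝ := ‖(gradL : _ →L[ℝ] E n × E n)‖ * (4 * (1 + 4 * n) ^ (K + 1)) with hc
  have hc0 : 0 ≤ c := by positivity
  obtain ⟨C, hC1, hC⟩ := exists_iteratedFDeriv_system_bound (E n × E n) (c * B) K
  refine ⟨C * c, by positivity, ?_⟩
  intro m J τ b h hb hbB hJ q hsol α β h1 h2 x ξ
  have hq := h.contDiff hsol
  have hf := fun i => contDiff_scaled (h.smooth i) (x, ξ)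
  set p : E n × E n := (x, ξ)
  set Q : E n × E n → Fin m → E n × E n := fun z i => unscale p (q (rescale p z) i) with hQ
  have hQs : ContDiff ℝ ∞ Q := contDiff_unscale_comp hq p
  have hQ0 : ∀ i, Q 0 i = unscale p (q p i) := fun i => by simp only [hQ, rescale_zero]
  have hQn : ∀ i, ‖Q 0 i‖ ≤ 1 / 3 := fun i => by
    rw [hQ0]; exact h.norm_unscale_le (hsol p) i
  have hbound : ∀ i, ∀ l ≤ K,
      ‖iteratedFDeriv ℝ l (sgrad (scaled p (J i))) (Q 0 i)‖ ≤ c * b i := by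
    intro i l hl
    obtain ⟨b1, b2, b3, b4⟩ := jap_rescale_bounds (p := p) (hQn i)
    have p1 := jap_pos p.1
    have p2 := jap_pos p.2
    have hbi := hb i
    have hw := norm_iteratedFDeriv_le_of_wordDeriv (hf i) (k := l + 1) (p := Q 0 i)
      (C := 4 * 2 ^ (l + 1) * b i) (by positivity) fun w hw =>
        abs_wordDeriv_scaled_le (h.smooth i) (hb i) (by linarith) (by linarith) (by linarith)
          (by linarith) (fun α β hαβ => hJ i α β (by omega) (by omega) _ _) w hw
    calc _ ≤ ‖(gradL : _ →L[ℝ] E n × E n)‖ * ((n + n : ℝ) ^ (l + 1) * (4 * 2 ^ (l + 1) * b i)) :=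
          (norm_iteratedFDeriv_sgrad_le (hf i) l _).trans (by gcongr)
      _ = ‖(gradL : _ →L[ℝ] E n × E n)‖ * (4 * (4 * n : ℝ) ^ (l + 1)) * b i := by
          have : (4 * n : ℝ) ^ (l + 1) = (n + n : ℝ) ^ (l + 1) * 2 ^ (l + 1) := by
            rw [← mul_pow]; congr 1; ring
          rw [this]; ring
      _ ≤ ‖(gradL : _ →L[ℝ] E n × E n)‖ * (4 * (1 + 4 * n) ^ (K + 1)) * b i := by
          gcongr
          calc (4 * n : ℝ) ^ (l + 1) ≤ (1 + 4 * n) ^ (l + 1) := by gcongr; linarith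
            _ ≤ _ := pow_le_pow_right₀ (by linarith [(Nat.cast_nonneg n : (0 : ℝ) ≤ n)]) (by omega)
  obtain ⟨-, hsys⟩ := hC m (fun i => sgrad (scaled p (J i))) (fun i z => Q z i)
    (fun j i => couple j i) (fun i => c * b i) (fun i => contDiff_sgrad (hf i))
    (fun i => contDiff_pi.1 hQs i) (fun j i => norm_couple_le j i)
    (fun j z => sol_unscale h.smooth hsol p z j) hbound
    (by rw [← Finset.mul_sum]; gcongr)
    (by simp only [hQ0]; exact h.sum_norm_fderiv_le (hsol p))
  have hΦ := contDiff_critVal h.smooth hq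
  rw [mixedDeriv_eq_mul_wordDeriv_scaled hΦ, abs_mul, abs_of_pos (sgWeight_pos _ _ _ _ _ _)]
  refine mul_le_mul_of_nonneg_right ?_ (sgWeight_pos _ _ _ _ _ _).le
  have hlen := length_idxWord α β
  -- The order is at least one, so the word has a last letter, which turns the critical value into
  -- its gradient.
  rcases List.eq_nil_or_concat (idxWord α β) with hnil | ⟨w, a, hw⟩
  · rw [hnil] at hlen; simp at hlen; omega
  rw [hw] at hlen ⊢
  simp only [List.concat_eq_append, List.length_append, List.length_singleton] at hlen ⊢
  refine (abs_wordDeriv_append_le (contDiff_scaled hΦ p) w a 0).trans ?_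
  have hsm : ∀ i, ContDiff ℝ ∞ (fun z => sgrad (scaled p (J i)) (Q z i)) := fun i =>
    (contDiff_sgrad (hf i)).comp (contDiff_pi.1 hQs i)
  rw [sgrad_scaled_critVal h.smooth hq hsol p, iteratedFDeriv_fun_sum_apply (fun i _ =>
    ((hsm i).of_le (by exact_mod_cast le_top)).contDiffAt)]
  refine (norm_sum_le _ _).trans ?_
  rw [Finset.mul_sum]
  refine Finset.sum_le_sum fun i _ => ?_
  rw [mul_assoc]
  exact hsys i w.length (by omega)

end CriticalValue


/-! ### The critical point system for sequences -/

/-- The critical point system of `φ_0, …, φ_M` for sequences indexed by `ℕ`. -/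
def Chain (φ : ℕ → Fun n) (M : ℕ) (Y N : ℕ → E n) : Prop :=
  ∀ j < M, Y (j + 1) = gradXi (φ j) (Y j) (N j) ∧ N j = gradX (φ (j + 1)) (Y (j + 1)) (N (j + 1))

/-- The value of the generating function along a sequence. -/
noncomputable def chainVal (φ : ℕ → Fun n) (M : ℕ) (Y N : ℕ → E n) : ℝ :=
  ∑ j ∈ Finset.range M, (φ j (Y j, N j) - inner ℝ (Y (j + 1)) (N j)) + φ M (Y M, N M)

theorem cons_seq (M : ℕ) (Y : ℕ → E n) :
    (Fin.cons (Y 0) (fun j : Fin M => Y (j + 1)) : Fin (M + 1) → E n) = fun j : Fin (M + 1) => Y j := by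
  funext j
  refine Fin.cases ?_ (fun i => ?_) j <;> simp

theorem snoc_seq (M : ℕ) (N : ℕ → E n) :
    (Fin.snoc (fun j : Fin M => N j) (N M) : Fin (M + 1) → E n) = fun j : Fin (M + 1) => N j := by
  funext j
  refine Fin.lastCases ?_ (fun i => ?_) j <;> simp

/-- Sequences put the data `Y 0 = x`, `N M = ξ` on the same footing as the unknowns `Y 1, …, Y M`
and `N 0, …, N (M - 1)`; `φ j` is evaluated at `(Y j, N j)`. -/
theorem isCritical_seq_iff (φ : ℕ → Fun n) (M : ℕ) (Y N : ℕ → E n) :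
    IsCritical (firsts M φ) (Y 0) (N M) (fun j : Fin M => Y (j + 1), fun j : Fin M => N j) ↔
      Chain φ M Y N := by
  simp only [IsCritical, cons_seq, snoc_seq, firsts]
  constructor
  · intro h j hj
    simpa using h ⟨j, hj⟩
  · intro h j
    simpa using h j j.2

theorem psi_seq (φ : ℕ → Fun n) (M : ℕ) (Y N : ℕ → E n) :
    psi (firsts M φ) (Y 0) (N M) (fun j : Fin M => Y (j + 1), fun j : Fin M => N j) =
      chainVal φ M Y N := by
  simp only [psi, cons_seq, snoc_seq, firsts, chainVal, Fin.val_castSucc, Fin.val_last]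
  rw [Fin.sum_univ_eq_sum_range (fun j => φ j (Y j, N j) - inner ℝ (Y (j + 1)) (N j)) M]

theorem exists_seq {M : ℕ} (x ξ : E n) (YN : (Fin M → E n) × (Fin M → E n)) :
    ∃ Y N : ℕ → E n, Y 0 = x ∧ N M = ξ ∧
      YN = (fun j : Fin M => Y (j + 1), fun j : Fin M => N j) := by
  -- The subtraction is truncated, so `k = 0` has to be excluded separately.
  refine ⟨fun k => if h : k - 1 < M ∧ k ≠ 0 then YN.1 ⟨k - 1, h.1⟩ else x,
    fun k => if h : k < M then YN.2 ⟨k, h⟩ else ξ, by simp, by simp, ?_⟩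
  ext1 <;> funext j <;> simp

theorem Chain.eq_of_wellDefined {φ : ℕ → Fun n} {M : ℕ} (h : WellDefined (firsts M φ))
    {Y N Y' N' : ℕ → E n} (hc : Chain φ M Y N) (hc' : Chain φ M Y' N') (h0 : Y 0 = Y' 0)
    (hM : N M = N' M) : (∀ j ≤ M, Y j = Y' j) ∧ ∀ j ≤ M, N j = N' j := by
  have h1 := (isCritical_seq_iff φ M Y N).2 hc
  have h2 := (isCritical_seq_iff φ M Y' N').2 hc'
  rw [← h0, ← hM] at h2
  have e := (h (Y 0) (N M)).unique h1 h2
  rw [Prod.mk.injEq] at e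
  refine ⟨fun j hj => ?_, fun j hj => ?_⟩
  · rcases j with _ | j
    · exact h0
    · exact congrFun e.1 ⟨j, hj⟩
  · rcases hj.lt_or_eq with hj | rfl
    · exact congrFun e.2 ⟨j, hj⟩
    · exact hM

theorem exists_chain {φ : ℕ → Fun n} {M : ℕ} (h : WellDefined (firsts M φ)) (x ξ : E n) :
    ∃ Y N, Y 0 = x ∧ N M = ξ ∧ Chain φ M Y N := by
  obtain ⟨YN, hYN, -⟩ := h x ξ
  obtain ⟨Y, N, hY, hN, rfl⟩ := exists_seq x ξ YN
  subst hY hN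
  exact ⟨Y, N, rfl, rfl, (isCritical_seq_iff φ M Y N).1 hYN⟩

theorem wellDefined_of_chain {φ : ℕ → Fun n} {M : ℕ}
    (hex : ∀ x ξ, ∃ Y N, Y 0 = x ∧ N M = ξ ∧ Chain φ M Y N)
    (huniq : ∀ Y N Y' N', Chain φ M Y N → Chain φ M Y' N' → Y 0 = Y' 0 → N M = N' M →
      ∀ j < M, Y (j + 1) = Y' (j + 1) ∧ N j = N' j) : WellDefined (firsts M φ) := by
  intro x ξ
  obtain ⟨Y, N, rfl, rfl, hc⟩ := hex x ξ
  refine ⟨_, (isCritical_seq_iff φ M Y N).2 hc, fun YN hYN => ?_⟩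
  obtain ⟨Y', N', hY, hN, rfl⟩ := exists_seq (Y 0) (N M) YN
  rw [← hY, ← hN] at hYN
  have h := huniq Y' N' Y N ((isCritical_seq_iff φ M Y' N').1 hYN) hc hY hN
  ext1
  · funext j; exact (h j j.2).1
  · funext j; exact (h j j.2).2

theorem multiProduct_eq_chainVal {φ : ℕ → Fun n} {M : ℕ} (h : WellDefined (firsts M φ))
    {Y N : ℕ → E n} (hc : Chain φ M Y N) :
    multiProduct (firsts M φ) (Y 0, N M) = chainVal φ M Y N := by
  have hcr := (isCritical_seq_iff φ M Y N).2 hc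
  have he : IsCritical (firsts M φ) (Y 0) (N M)
      (Classical.epsilon (IsCritical (firsts M φ) (Y 0) (N M))) :=
    Classical.epsilon_spec ⟨_, hcr⟩
  rw [multiProduct, (h (Y 0) (N M)).unique he hcr, psi_seq]

/-! ### Associativity -/

/-- A pair of functions, as the beginning of a sequence. -/
def pairSeq (a b : Fun n) (k : ℕ) : Fun n := if k = 0 then a else b

theorem firsts_pairSeq (a b : Fun n) : firsts 1 (pairSeq a b) = ![a, b] := by
  funext j
  fin_cases j <;> rfl

theorem chain_pairSeq_iff (a b : Fun n) (Y N : ℕ → E n) : Chain (pairSeq a b) 1 Y N ↔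
    Y 1 = gradXi a (Y 0) (N 0) ∧ N 0 = gradX b (Y 1) (N 1) := by
  simp [Chain, pairSeq]

theorem chainVal_pairSeq (a b : Fun n) (Y N : ℕ → E n) : chainVal (pairSeq a b) 1 Y N =
    a (Y 0, N 0) - inner ℝ (Y 1) (N 0) + b (Y 1, N 1) := by
  simp [chainVal, pairSeq]

/-- By the gradient formula for the tail, a full chain restricts to a critical pair. Conversely a
critical pair extends to a full chain by the tail chain with data `Y 1`, `N 1`. So existence and
uniqueness carry over, and the values agree along corresponding chains. -/
theorem multiProduct_pair_left {φ : ℕ → Fun n} {m : ℕ} (hfull : WellDefined (firsts (m + 1) φ))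
    (htail : WellDefined (firsts m fun j => φ (j + 1)))
    (hgrad : ∀ Y N, Chain (fun j => φ (j + 1)) m Y N →
      gradX (multiProduct (firsts m fun j => φ (j + 1))) (Y 0) (N m) = gradX (φ 1) (Y 0) (N 0)) :
    WellDefined ![φ 0, multiProduct (firsts m fun j => φ (j + 1))] ∧
      multiProduct ![φ 0, multiProduct (firsts m fun j => φ (j + 1))] =
        multiProduct (firsts (m + 1) φ) := by
  set Φ := multiProduct (firsts m fun j => φ (j + 1))
  have tail : ∀ {Y N}, Chain φ (m + 1) Y N →
      Chain (fun j => φ (j + 1)) m (fun j => Y (j + 1)) (fun j => N (j + 1)) :=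
    fun h j hj => h (j + 1) (by omega)
  have restrict : ∀ {Y N}, Chain φ (m + 1) Y N →
      Chain (pairSeq (φ 0) Φ) 1 Y (fun k => if k = 0 then N 0 else N (m + 1)) := by
    intro Y N h
    rw [chain_pairSeq_iff]
    refine ⟨(h 0 (by omega)).1, ?_⟩
    have := hgrad _ _ (tail h)
    simp only [zero_add] at this
    simpa [this] using (h 0 (by omega)).2
  have extend : ∀ {Y N}, Chain (pairSeq (φ 0) Φ) 1 Y N → ∃ Y' N', Chain φ (m + 1) Y' N' ∧
      Y' 0 = Y 0 ∧ N' (m + 1) = N 1 ∧ Y' 1 = Y 1 ∧ N' 0 = N 0 := by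
    intro Y N h
    rw [chain_pairSeq_iff] at h
    obtain ⟨Yt, Nt, hY, hN, hc⟩ := exists_chain htail (Y 1) (N 1)
    have hg := hgrad _ _ hc
    rw [hY, hN] at hg
    -- The tail chain is shifted by one and the first entries of the pair are put in front.
    refine ⟨fun k => k.casesOn (Y 0) Yt, fun k => k.casesOn (N 0) Nt, ?_, rfl, hN, hY, rfl⟩
    intro j hj
    rcases j with _ | j
    · refine ⟨hY.trans h.1, ?_⟩
      change N 0 = gradX (φ 1) (Yt 0) (Nt 0)
      rw [h.2, hg, hY]
    · exact hc j (by omega)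
  have hwd : WellDefined (firsts 1 (pairSeq (φ 0) Φ)) := by
    refine wellDefined_of_chain (fun x ξ => ?_) fun Y N Y' N' hc hc' h0 h1 j hj => ?_
    · obtain ⟨Y, N, rfl, rfl, hc⟩ := exists_chain hfull x ξ
      exact ⟨_, _, rfl, rfl, restrict hc⟩
    · obtain rfl : j = 0 := by omega
      obtain ⟨Z, P, hZ, hZ0, hP1, hZ1, hP0⟩ := extend hc
      obtain ⟨Z', P', hZ', hZ0', hP1', hZ1', hP0'⟩ := extend hc'
      have := hZ.eq_of_wellDefined hfull hZ' (by rw [hZ0, hZ0', h0]) (by rw [hP1, hP1', h1])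
      rw [← hZ1, ← hZ1', ← hP0, ← hP0']
      exact ⟨this.1 1 (by omega), this.2 0 (by omega)⟩
  rw [← firsts_pairSeq]
  refine ⟨hwd, ?_⟩
  funext ⟨x, ξ⟩
  obtain ⟨Y, N, rfl, rfl, hc⟩ := exists_chain hfull x ξ
  rw [multiProduct_eq_chainVal hfull hc]
  have h1 := multiProduct_eq_chainVal hwd (restrict hc)
  have h2 := multiProduct_eq_chainVal htail (tail hc)
  simp only [chainVal_pairSeq, one_ne_zero, if_false, if_true] at h1
  rw [h1]
  change _ + Φ (Y (0 + 1), N (m + 1)) = _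
  change Φ (Y (0 + 1), N (m + 1)) = _ at h2
  rw [h2, chainVal, chainVal, Finset.sum_range_succ' _ m]
  simp only [zero_add]
  ring

/-- The mirror image: a critical pair is extended by a chain of the head, whose `ξ`-gradient formula
supplies the missing equation. -/
theorem multiProduct_pair_right {φ : ℕ → Fun n} {m : ℕ} (hfull : WellDefined (firsts (m + 1) φ))
    (hhead : WellDefined (firsts m φ))
    (hgrad : ∀ Y N, Chain φ m Y N →
      gradXi (multiProduct (firsts m φ)) (Y 0) (N m) = gradXi (φ m) (Y m) (N m)) :
    WellDefined ![multiProduct (firsts m φ), φ (m + 1)] ∧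
      multiProduct ![multiProduct (firsts m φ), φ (m + 1)] =
        multiProduct (firsts (m + 1) φ) := by
  set Φ := multiProduct (firsts m φ)
  have head : ∀ {Y N}, Chain φ (m + 1) Y N → Chain φ m Y N := fun h j hj => h j (by omega)
  have restrict : ∀ {Y N}, Chain φ (m + 1) Y N →
      Chain (pairSeq Φ (φ (m + 1))) 1 (fun k => if k = 0 then Y 0 else Y (m + 1))
        (fun k => N (m + k)) := by
    intro Y N h
    rw [chain_pairSeq_iff]
    have := hgrad _ _ (head h)
    exact ⟨by simpa [this] using (h m (by omega)).1, by simpa using (h m (by omega)).2⟩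
  have extend : ∀ {Y N}, Chain (pairSeq Φ (φ (m + 1))) 1 Y N → ∃ Y' N', Chain φ (m + 1) Y' N' ∧
      Y' 0 = Y 0 ∧ N' (m + 1) = N 1 ∧ Y' (m + 1) = Y 1 ∧ N' m = N 0 := by
    intro Y N h
    rw [chain_pairSeq_iff] at h
    obtain ⟨Yt, Nt, hY, hN, hc⟩ := exists_chain hhead (Y 0) (N 0)
    have hg := hgrad _ _ hc
    rw [hY, hN] at hg
    refine ⟨Function.update Yt (m + 1) (Y 1), Function.update Nt (m + 1) (N 1), ?_,
      by simp [Function.update_of_ne, hY], by simp, by simp, by simp [Function.update_of_ne, hN]⟩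
    intro j hj
    rcases Nat.lt_succ_iff_lt_or_eq.1 hj with hj | rfl
    · rw [Function.update_of_ne (by omega), Function.update_of_ne (by omega),
        Function.update_of_ne (by omega), Function.update_of_ne (by omega)]
      exact hc j hj
    · rw [Function.update_self, Function.update_self, Function.update_of_ne (by omega),
        Function.update_of_ne (by omega), hN]
      exact ⟨h.1.trans hg, h.2⟩
  have hwd : WellDefined (firsts 1 (pairSeq Φ (φ (m + 1)))) := by
    refine wellDefined_of_chain (fun x ξ => ?_) fun Y N Y' N' hc hc' h0 h1 j hj => ?_
    · obtain ⟨Y, N, rfl, rfl, hc⟩ := exists_chain hfull x ξ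
      exact ⟨fun k => if k = 0 then Y 0 else Y (m + 1), fun k => N (m + k), rfl, rfl, restrict hc⟩
    · obtain rfl : j = 0 := by omega
      obtain ⟨Z, P, hZ, hZ0, hP1, hZ1, hP0⟩ := extend hc
      obtain ⟨Z', P', hZ', hZ0', hP1', hZ1', hP0'⟩ := extend hc'
      have := hZ.eq_of_wellDefined hfull hZ' (by rw [hZ0, hZ0', h0]) (by rw [hP1, hP1', h1])
      rw [zero_add, ← hZ1, ← hZ1', ← hP0, ← hP0']
      exact ⟨this.1 (m + 1) le_rfl, this.2 m (by omega)⟩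
  rw [← firsts_pairSeq]
  refine ⟨hwd, ?_⟩
  funext ⟨x, ξ⟩
  obtain ⟨Y, N, rfl, rfl, hc⟩ := exists_chain hfull x ξ
  rw [multiProduct_eq_chainVal hfull hc]
  have h1 := multiProduct_eq_chainVal hwd (restrict hc)
  have h2 := multiProduct_eq_chainVal hhead (head hc)
  simp only [chainVal_pairSeq, one_ne_zero, if_false, if_true, add_zero] at h1
  change Φ (Y 0, N m) = _ at h2
  rw [h1, h2, chainVal, chainVal, Finset.sum_range_succ]
  ring

/-! ### Reduction to the summed system -/

theorem contDiff_inner_prod : ContDiff ℝ ∞ (fun p : E n × E n => (inner ℝ p.1 p.2 : ℝ)) :=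
  contDiff_fst.inner ℝ contDiff_snd

theorem contDiff_jPart {φ : Fun n} (h : ContDiff ℝ ∞ φ) : ContDiff ℝ ∞ (jPart φ) :=
  h.sub contDiff_inner_prod

theorem sgrad_jPart {φ : Fun n} (h : ContDiff ℝ ∞ φ) (p : E n × E n) :
    sgrad (jPart φ) p = sgrad φ p - (p.2, p.1) := by
  have h1 := h.differentiable (by simp) p
  have h2 : HasFDerivAt (fun p : E n × E n => (inner ℝ p.1 p.2 : ℝ))
      ((fderivInnerCLM ℝ (p.1, p.2)).comp ((ContinuousLinearMap.fst ℝ (E n) (E n)).prod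
        (ContinuousLinearMap.snd ℝ (E n) (E n)))) p :=
    HasFDerivAt.inner ℝ (ContinuousLinearMap.fst ℝ (E n) (E n)).hasFDerivAt
      (ContinuousLinearMap.snd ℝ (E n) (E n)).hasFDerivAt
  refine sgrad_eq_of_hasFDerivAt (h1.hasFDerivAt.sub h2) fun v => ?_
  rw [sub_apply, ← pairing_sgrad h1]
  simp only [pairing, ContinuousLinearMap.comp_apply, ContinuousLinearMap.prod_apply,
    ContinuousLinearMap.coe_fst', ContinuousLinearMap.coe_snd', fderivInnerCLM_apply,
    Prod.fst_sub, Prod.snd_sub, inner_sub_left, real_inner_comm p.2 v.1]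
  ring

theorem gradX_eq {φ : Fun n} (h : ContDiff ℝ ∞ φ) (x ξ : E n) :
    gradX φ x ξ = ξ + (sgrad (jPart φ) (x, ξ)).1 := by
  rw [sgrad_jPart h]; simp [sgrad]

theorem gradXi_eq {φ : Fun n} (h : ContDiff ℝ ∞ φ) (x ξ : E n) :
    gradXi φ x ξ = x + (sgrad (jPart φ) (x, ξ)).2 := by
  rw [sgrad_jPart h]; simp [sgrad]

theorem sum_fin_lt_eq {V : Type*} [AddCommMonoid V] (M : ℕ) (b : ℕ → V) (j : Fin (M + 1)) :
    ∑ i : Fin (M + 1) with i < j, b i = ∑ i ∈ Finset.range j, b i := by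
  rw [Finset.sum_filter]
  have := Fin.sum_univ_eq_sum_range (fun i => if i < (j : ℕ) then b i else 0) (M + 1)
  simp only [Fin.lt_def]
  rw [this, ← Finset.sum_filter]
  congr 1
  ext i
  simp only [Finset.mem_filter, Finset.mem_range]
  have := j.2
  omega

theorem sum_fin_gt_eq {V : Type*} [AddCommMonoid V] (M : ℕ) (a : ℕ → V) (j : Fin (M + 1)) :
    ∑ i : Fin (M + 1) with j < i, a i = ∑ i ∈ Finset.Ico (j + 1 : ℕ) (M + 1), a i := by
  rw [Finset.sum_filter]
  have := Fin.sum_univ_eq_sum_range (fun i => if (j : ℕ) < i then a i else 0) (M + 1)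
  simp only [Fin.lt_def]
  rw [this, ← Finset.sum_filter]
  congr 1
  ext i
  simp only [Finset.mem_filter, Finset.mem_range, Finset.mem_Ico]
  omega

/-- A chain prescribes the successive differences of `Y` and `N`. Summing them forward from `Y 0`
and backward from `N M` gives the summed system; subtracting neighbouring equations goes back. -/
theorem sol_iff_chain {φ : ℕ → Fun n} (hφ : ∀ j, ContDiff ℝ ∞ (φ j)) {M : ℕ} (Y N : ℕ → E n) :
    Sol (fun i : Fin (M + 1) => jPart (φ i)) (Y 0, N M) (fun i => (Y i, N i)) ↔
      Chain φ M Y N := by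
  set b : ℕ → E n := fun i => (sgrad (jPart (φ i)) (Y i, N i)).2 with hb
  set a : ℕ → E n := fun i => (sgrad (jPart (φ i)) (Y i, N i)).1 with ha
  have hchain : Chain φ M Y N ↔
      ∀ j < M, Y (j + 1) = Y j + b j ∧ N j = N (j + 1) + a (j + 1) := by
    refine forall₂_congr fun j _ => ?_
    rw [gradX_eq (hφ _), gradXi_eq (hφ _)]
  have hsum : ∀ j, j < M → ∑ i ∈ Finset.Ico (j + 1) (M + 1), a i =
      a (j + 1) + ∑ i ∈ Finset.Ico (j + 2) (M + 1), a i := fun j hj =>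
    Finset.sum_eq_sum_Ico_succ_bot (by omega) a
  rw [hchain]
  constructor
  · intro h j hj
    have f0 := h.fst ⟨j, by omega⟩
    have f1 := h.fst ⟨j + 1, by omega⟩
    have s0 := h.snd ⟨j, by omega⟩
    have s1 := h.snd ⟨j + 1, by omega⟩
    rw [sum_fin_lt_eq M b] at f0 f1
    rw [sum_fin_gt_eq M a] at s0 s1
    dsimp only at f0 f1 s0 s1
    constructor
    · rw [f1, f0, Finset.sum_range_succ, add_assoc]
    · rw [s0, s1, hsum j hj]; abel
  · intro h
    have hY : ∀ j ≤ M, Y j = Y 0 + ∑ i ∈ Finset.range j, b i := by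
      intro j
      induction j with
      | zero => simp
      | succ j ih =>
        intro hj
        rw [(h j hj).1, ih (by omega), Finset.sum_range_succ, add_assoc]
    -- Downward induction from the known end `N M`, with `k = M - j`.
    have hN : ∀ k ≤ M, N (M - k) = N M + ∑ i ∈ Finset.Ico (M - k + 1) (M + 1), a i := by
      intro k
      induction k with
      | zero => simp
      | succ k ih =>
        intro hk
        rw [(h (M - (k + 1)) (by omega)).2, hsum _ (by omega)]
        have e : M - (k + 1) + 1 = M - k := by omega
        rw [e, show M - (k + 1) + 2 = M - k + 1 by omega, ih (by omega)]
        abel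
    intro j
    have hj := j.2
    ext1
    · rw [Prod.fst_add, Prod.fst_sum]
      simp only [couple_fst]
      rw [← Finset.sum_filter, sum_fin_lt_eq M b]
      exact hY j (by omega)
    · rw [Prod.snd_add, Prod.snd_sum]
      simp only [couple_snd]
      rw [← Finset.sum_filter, sum_fin_gt_eq M a]
      have := hN (M - j) (by omega)
      rwa [Nat.sub_sub_self (by omega)] at this

/-- Along a chain `J'_{j,ξ} = Y_{j+1} - Y_j`, so the terms that pair it with `N M` telescope;
together with the last summand they leave `Y 0 · N M`. -/
theorem chainVal_eq_critVal {φ : ℕ → Fun n} (hφ : ∀ j, ContDiff ℝ ∞ (φ j)) {M : ℕ}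
    {Y N : ℕ → E n} (hc : Chain φ M Y N) : chainVal φ M Y N =
      critVal (fun i : Fin (M + 1) => jPart (φ i)) (Y 0, N M) (fun i => (Y i, N i)) +
        inner ℝ (Y 0) (N M) := by
  have hY : ∀ j < M, (sgrad (jPart (φ j)) (Y j, N j)).2 = Y (j + 1) - Y j := fun j hj => by
    rw [(hc j hj).1, gradXi_eq (hφ j), add_sub_cancel_left]
  rw [critVal, Fin.sum_univ_eq_sum_range (fun i => jPart (φ i) (Y i, N i) -
    inner ℝ (sgrad (jPart (φ i)) (Y i, N i)).2 (N i - N M)) (M + 1), Finset.sum_range_succ,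
    chainVal, sub_self, inner_zero_right, sub_zero]
  have e : ∑ j ∈ Finset.range M, (jPart (φ j) (Y j, N j) -
      inner ℝ (sgrad (jPart (φ j)) (Y j, N j)).2 (N j - N M)) =
      ∑ j ∈ Finset.range M, ((φ j (Y j, N j) - inner ℝ (Y (j + 1)) (N j)) +
        (inner ℝ (Y (j + 1)) (N M) - inner ℝ (Y j) (N M))) := by
    refine Finset.sum_congr rfl fun j hj => ?_
    rw [hY j (Finset.mem_range.1 hj), jPart]
    simp only [inner_sub_left, inner_sub_right]
    ring
  rw [e, Finset.sum_add_distrib, Finset.sum_range_sub (fun j => (inner ℝ (Y j) (N M) : ℝ)), jPart]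
  ring


/-! ### Componentwise bounds -/

theorem wordDeriv_add {f g : Fun n} (hf : ContDiff ℝ ∞ f) (hg : ContDiff ℝ ∞ g)
    (w : List (Fin n ⊕ Fin n)) :
    wordDeriv w (fun p => f p + g p) = fun p => wordDeriv w f p + wordDeriv w g p := by
  induction w with
  | nil => rfl
  | cons c w ih =>
    rw [wordDeriv_cons, ih]
    funext p
    rw [fderiv_fun_add ((contDiff_wordDeriv hf w).differentiable (by simp) p)
      ((contDiff_wordDeriv hg w).differentiable (by simp) p)]
    rfl

theorem wordDeriv_neg (f : Fun n) (w : List (Fin n ⊕ Fin n)) :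
    wordDeriv w (fun p => -f p) = fun p => -wordDeriv w f p := by
  induction w with
  | nil => rfl
  | cons c w ih =>
    rw [wordDeriv_cons, ih]
    funext p
    rw [fderiv_fun_neg]
    rfl

theorem IsSGSymbol.add {m μ : ℝ} {f g : Fun n} (hf : IsSGSymbol m μ f) (hg : IsSGSymbol m μ g) :
    IsSGSymbol m μ (fun p => f p + g p) := by
  refine ⟨hf.1.add hg.1, fun α β => ?_⟩
  obtain ⟨C, hC⟩ := hf.2 α β
  obtain ⟨D, hD⟩ := hg.2 α β
  refine ⟨C + D, fun x ξ => ?_⟩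
  have h1 := hC x ξ
  have h2 := hD x ξ
  rw [mixedDeriv_eq_wordDeriv] at h1 h2 ⊢
  rw [wordDeriv_add hf.1 hg.1, add_mul]
  exact (abs_add_le _ _).trans (add_le_add h1 h2)

theorem IsSGSymbol.neg {m μ : ℝ} {f : Fun n} (hf : IsSGSymbol m μ f) :
    IsSGSymbol m μ (fun p => -f p) := by
  refine ⟨hf.1.neg, fun α β => ?_⟩
  obtain ⟨C, hC⟩ := hf.2 α β
  refine ⟨C, fun x ξ => ?_⟩
  have h1 := hC x ξ
  rw [mixedDeriv_eq_wordDeriv] at h1 ⊢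
  rwa [wordDeriv_neg, abs_neg]

theorem sgrad_inner (p : E n × E n) :
    sgrad (fun p : E n × E n => (inner ℝ p.1 p.2 : ℝ)) p = (p.2, p.1) := by
  have h := sgrad_jPart (contDiff_inner_prod (n := n)) p
  have e : jPart (fun p : E n × E n => (inner ℝ p.1 p.2 : ℝ)) = fun _ => 0 := by
    funext p; simp [jPart]
  have h0 : sgrad (fun _ : E n × E n => (0 : ℝ)) p = 0 :=
    sgrad_eq_of_hasFDerivAt (hasFDerivAt_const _ _) fun v => by simp [pairing]
  rw [e, h0] at h
  exact (sub_eq_zero.1 h.symm)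

/-- The rescaled gradient of `x · ξ` is affine: a constant of norm at most 1 plus the exchange of
the variables. All orders are bounded at once. -/
theorem isSGSymbol_inner : IsSGSymbol 1 1 (fun p : E n × E n => (inner ℝ p.1 p.2 : ℝ)) := by
  refine ⟨contDiff_inner_prod, fun α β => ?_⟩
  set L : (E n × E n) →L[ℝ] E n × E n := (ContinuousLinearMap.snd ℝ (E n) (E n)).prod
    (ContinuousLinearMap.fst ℝ (E n) (E n)) with hL
  refine ⟨max 1 ‖L‖, fun x ξ => ?_⟩
  rw [mixedDeriv_eq_mul_wordDeriv_scaled contDiff_inner_prod, abs_mul,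
    abs_of_pos (sgWeight_pos _ _ _ _ _ _)]
  refine mul_le_mul_of_nonneg_right ?_ (sgWeight_pos _ _ _ _ _ _).le
  have p1 := jap_pos x
  have p2 := jap_pos ξ
  rcases List.eq_nil_or_concat (idxWord α β) with hnil | ⟨w, a, hw⟩
  · rw [hnil, wordDeriv_nil]
    refine le_trans ?_ (le_max_left _ _)
    simp only [scaled, rescale_zero]
    rw [abs_mul, abs_of_pos (by positivity), inv_mul_le_iff₀ (by positivity), mul_one]
    exact (abs_real_inner_le_norm _ _).trans
      (mul_le_mul (norm_le_jap x) (norm_le_jap ξ) (norm_nonneg _) p1.le)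
  · rw [hw, List.concat_eq_append]
    refine (abs_wordDeriv_append_le (contDiff_scaled contDiff_inner_prod _) w a 0).trans ?_
    set f := scaled (x, ξ) (fun p : E n × E n => (inner ℝ p.1 p.2 : ℝ)) with hf
    have e : sgrad f = fun z => ((jap ξ)⁻¹ • ξ, (jap x)⁻¹ • x) + L z := by
      funext z
      rw [hf, sgrad_scaled contDiff_inner_prod, sgrad_inner]
      ext1 <;> simp [dualScale, rescale, hL, smul_smul, p1.ne', p2.ne']
    rw [e]
    rcases Nat.eq_zero_or_pos w.length with h0 | h0
    · rw [h0, norm_iteratedFDeriv_zero, map_zero, add_zero]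
      refine le_trans (max_le ?_ ?_) (le_max_left _ _)
      · exact norm_smul_inv_le p2 (by rw [one_mul]; exact norm_le_jap ξ)
      · exact norm_smul_inv_le p1 (by rw [one_mul]; exact norm_le_jap x)
    · obtain ⟨k, hk⟩ := Nat.exists_eq_succ_of_ne_zero h0.ne'
      have hd : fderiv ℝ (fun z => ((jap ξ)⁻¹ • ξ, (jap x)⁻¹ • x) + L z) = fun _ => L :=
        funext fun z => (L.hasFDerivAt.const_add _).fderiv
      rw [hk, Nat.succ_eq_add_one, ← norm_iteratedFDeriv_fderiv, hd]
      refine le_trans ?_ (le_max_right _ _)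
      rcases Nat.eq_zero_or_pos k with rfl | hk0
      · rw [norm_iteratedFDeriv_zero]
      · rw [iteratedFDeriv_const_of_ne hk0.ne']; simp

theorem isSGSymbol_jPart {φ : Fun n} (h : IsSGSymbol 1 1 φ) : IsSGSymbol 1 1 (jPart φ) := by
  have := h.add isSGSymbol_inner.neg
  simp only [← sub_eq_add_neg] at this
  exact this

/-- Finitely many constants may be replaced by one. -/
theorem exists_common_bound {P : MIdx n → MIdx n → ℝ → Prop}
    (mono : ∀ α β C D, C ≤ D → P α β C → P α β D) (h : ∀ α β, ∃ C, P α β C) (K : ℕ) :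
    ∃ C, 0 ≤ C ∧ ∀ α β : MIdx n, α.order + β.order ≤ K → P α β C := by
  choose C hC using h
  set S : Finset (MIdx n × MIdx n) := (Fintype.piFinset fun _ => Finset.range (K + 1)) ×ˢ
    (Fintype.piFinset fun _ => Finset.range (K + 1))
  refine ⟨∑ γ ∈ S, |C γ.1 γ.2|, Finset.sum_nonneg fun _ _ => abs_nonneg _, fun α β hαβ => ?_⟩
  refine mono _ _ _ _ ((le_abs_self _).trans ?_) (hC α β)
  refine Finset.single_le_sum (f := fun γ : MIdx n × MIdx n => |C γ.1 γ.2|)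
    (fun _ _ => abs_nonneg _) (a := (α, β)) ?_
  have hle : ∀ (γ : MIdx n) (i : Fin n), γ i ≤ γ.order := fun γ i =>
    Finset.single_le_sum (f := γ) (fun _ _ => Nat.zero_le _) (Finset.mem_univ i)
  simp only [S, Finset.mem_product, Fintype.mem_piFinset, Finset.mem_range]
  exact ⟨fun i => by have := hle α i; omega, fun i => by have := hle β i; omega⟩

theorem abs_wordDeriv_scaled_zero_le {f : Fun n} (hf : ContDiff ℝ ∞ f) {p : E n × E n} {C : ℝ}
    {k : ℕ} (h : ∀ α β : MIdx n, α.order + β.order ≤ k →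
      |mixedDeriv α β f p| ≤ C * sgWeight 1 1 α β p.1 p.2)
    (w : List (Fin n ⊕ Fin n)) (hw : w.length ≤ k) : |wordDeriv w (scaled p f) 0| ≤ C := by
  have hp := perm_idxWord w
  set α : MIdx n := fun i => w.count (.inl i)
  set β : MIdx n := fun i => w.count (.inr i)
  have hk : α.order + β.order ≤ k := by rw [← length_idxWord, ← hp.length_eq]; exact hw
  rw [wordDeriv_perm (contDiff_scaled hf p) hp]
  have h1 := h α β hk
  rw [mixedDeriv_eq_mul_wordDeriv_scaled hf p.1 p.2 α β, abs_mul,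
    abs_of_pos (sgWeight_pos _ _ _ _ _ _)] at h1
  exact le_of_mul_le_mul_right h1 (sgWeight_pos _ _ _ _ _ _)

theorem norm_fst_le_of_pairing {a : E n × E n} {c : ℝ}
    (h : ∀ d, |pairing a (basisVec d)| ≤ c) : ‖a.1‖ ≤ n * c := by
  have e : a.1 = ∑ i, a.1 i • EuclideanSpace.single i (1 : ℝ) := by
    ext j; simp [Finset.sum_apply, Pi.single_apply]
  rw [e]
  refine (norm_sum_le _ _).trans ?_
  calc _ ≤ ∑ _i : Fin n, c := Finset.sum_le_sum fun i _ => by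
        have := h (.inl i)
        simp only [pairing, basisVec, inner_zero_right, add_zero,
          EuclideanSpace.inner_single_right] at this
        simpa [norm_smul] using this
    _ = _ := by simp

theorem norm_snd_le_of_pairing {a : E n × E n} {c : ℝ}
    (h : ∀ d, |pairing a (basisVec d)| ≤ c) : ‖a.2‖ ≤ n * c := by
  have e : a.2 = ∑ i, a.2 i • EuclideanSpace.single i (1 : ℝ) := by
    ext j; simp [Finset.sum_apply, Pi.single_apply]
  rw [e]
  refine (norm_sum_le _ _).trans ?_
  calc _ ≤ ∑ _i : Fin n, c := Finset.sum_le_sum fun i _ => by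
        have := h (.inr i)
        simp only [pairing, basisVec, inner_zero_right, zero_add,
          EuclideanSpace.inner_single_right] at this
        simpa [norm_smul] using this
    _ = _ := by simp

theorem norm_apply_inl_le {T : (E n × E n) →L[ℝ] E n × E n} {c : ℝ}
    (h : ∀ d, ‖(T (basisVec d)).1‖ ≤ c ∧ ‖(T (basisVec d)).2‖ ≤ c) (v : E n) :
    ‖(T (v, 0)).1‖ ≤ n * c * ‖v‖ ∧ ‖(T (v, 0)).2‖ ≤ n * c * ‖v‖ := by
  have e : (v, (0 : E n)) = ∑ i, v i • basisVec (.inl i) := by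
    ext1
    · rw [Prod.fst_sum]; ext j; simp [Finset.sum_apply, Pi.single_apply, basisVec]
    · rw [Prod.snd_sum]; simp [basisVec]
  rw [e, map_sum, Prod.fst_sum, Prod.snd_sum]
  have key : ∀ g : E n × E n → E n, (∀ (r : ℝ) a, g (r • a) = r • g a) →
      (∀ d, ‖g (T (basisVec d))‖ ≤ c) →
      ‖∑ i, g (T (v i • basisVec (.inl i)))‖ ≤ n * c * ‖v‖ := by
    intro g hg hc
    refine (norm_sum_le _ _).trans ?_
    calc _ ≤ ∑ _i : Fin n, ‖v‖ * c := Finset.sum_le_sum fun i _ => by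
          rw [map_smul, hg, norm_smul]
          exact mul_le_mul (PiLp.norm_apply_le v i) (hc _) (norm_nonneg _) (norm_nonneg _)
      _ = _ := by simp; ring
  exact ⟨key Prod.fst (fun _ _ => rfl) fun d => (h d).1,
    key Prod.snd (fun _ _ => rfl) fun d => (h d).2⟩

theorem norm_apply_inr_le {T : (E n × E n) →L[ℝ] E n × E n} {c : ℝ}
    (h : ∀ d, ‖(T (basisVec d)).1‖ ≤ c ∧ ‖(T (basisVec d)).2‖ ≤ c) (v : E n) :
    ‖(T (0, v)).1‖ ≤ n * c * ‖v‖ ∧ ‖(T (0, v)).2‖ ≤ n * c * ‖v‖ := by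
  have e : ((0 : E n), v) = ∑ i, v i • basisVec (.inr i) := by
    ext1
    · rw [Prod.fst_sum]; simp [basisVec]
    · rw [Prod.snd_sum]; ext j; simp [Finset.sum_apply, Pi.single_apply, basisVec]
  rw [e, map_sum, Prod.fst_sum, Prod.snd_sum]
  have key : ∀ g : E n × E n → E n, (∀ (r : ℝ) a, g (r • a) = r • g a) →
      (∀ d, ‖g (T (basisVec d))‖ ≤ c) →
      ‖∑ i, g (T (v i • basisVec (.inr i)))‖ ≤ n * c * ‖v‖ := by
    intro g hg hc
    refine (norm_sum_le _ _).trans ?_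
    calc _ ≤ ∑ _i : Fin n, ‖v‖ * c := Finset.sum_le_sum fun i _ => by
          rw [map_smul, hg, norm_smul]
          exact mul_le_mul (PiLp.norm_apply_le v i) (hc _) (norm_nonneg _) (norm_nonneg _)
      _ = _ := by simp; ring
  exact ⟨key Prod.fst (fun _ _ => rfl) fun d => (h d).1,
    key Prod.snd (fun _ _ => rfl) fun d => (h d).2⟩

/-- Bounds on the derivatives of orders one and two along the coordinates imply bounds in the
vector sense. For `n = 1` there is no loss. -/
theorem vectorBound_of_mixedDeriv {J : Fun n} (hJ : ContDiff ℝ ∞ J) {τ : ℝ} (hτ : 0 ≤ τ)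
    (h : ∀ α β : MIdx n, α.order + β.order ≤ 2 → ∀ x ξ,
      |mixedDeriv α β J (x, ξ)| ≤ τ * sgWeight 1 1 α β x ξ) : VectorBound ((n : ℝ) ^ 2 * τ) J := by
  have hw : ∀ (p : E n × E n) (w : List (Fin n ⊕ Fin n)), w.length ≤ 2 →
      |wordDeriv w (scaled p J) 0| ≤ τ := fun p =>
    abs_wordDeriv_scaled_zero_le hJ fun α β hαβ => h α β hαβ p.1 p.2
  -- A vector with `n` bounded entries costs a factor `n`, an operator norm costs `n²`; the former
  -- is absorbed in the latter.
  have hn : (n : ℝ) * τ ≤ (n : ℝ) ^ 2 * τ := by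
    gcongr
    exact_mod_cast Nat.le_self_pow two_ne_zero n
  have hgrad : ∀ (p : E n × E n), ‖(sgrad (scaled p J) 0).1‖ ≤ n ^ 2 * τ ∧
      ‖(sgrad (scaled p J) 0).2‖ ≤ n ^ 2 * τ := by
    intro p
    have : ∀ d, |pairing (sgrad (scaled p J) 0) (basisVec d)| ≤ τ := fun d => by
      rw [← wordDeriv_singleton (contDiff_scaled hJ p)]
      exact hw p [d] (by simp)
    exact ⟨(norm_fst_le_of_pairing this).trans hn, (norm_snd_le_of_pairing this).trans hn⟩
  have hhess : ∀ (p : E n × E n) (c : Fin n ⊕ Fin n),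
      ‖(fderiv ℝ (sgrad (scaled p J)) 0 (basisVec c)).1‖ ≤ n * τ ∧
      ‖(fderiv ℝ (sgrad (scaled p J)) 0 (basisVec c)).2‖ ≤ n * τ := by
    intro p c
    have : ∀ d, |pairing (fderiv ℝ (sgrad (scaled p J)) 0 (basisVec c)) (basisVec d)| ≤ τ :=
      fun d => by
        rw [← wordDeriv_pair (contDiff_scaled hJ p)]
        exact hw p [c, d] (by simp)
    exact ⟨norm_fst_le_of_pairing this, norm_snd_le_of_pairing this⟩
  have e1 : ∀ {a : ℝ} {v : E n} {C : ℝ}, 0 < a → ‖a⁻¹ • v‖ ≤ C → ‖v‖ ≤ C * a := by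
    intro a v C ha hv
    rw [norm_smul, norm_inv, Real.norm_of_nonneg ha.le, inv_mul_le_iff₀ ha] at hv
    linarith
  have hsc : ∀ (p e : E n × E n), fderiv ℝ (sgrad (scaled p J)) 0 e =
      dualScale p (fderiv ℝ (sgrad J) p (scaleL p e)) := fun p e => by
    have := fderiv_sgrad_scaled hJ p 0 e
    rwa [rescale_zero] at this
  have hs : ∀ (p : E n × E n), sgrad (scaled p J) 0 = dualScale p (sgrad J p) := fun p => by
    have := sgrad_scaled hJ p 0
    rwa [rescale_zero] at this
  have hl : ∀ (p : E n × E n) (v : E n), scaleL p ((jap p.1)⁻¹ • v, 0) = (v, 0) := fun p v => by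
    simp [smul_smul, (jap_pos p.1).ne']
  have hr : ∀ (p : E n × E n) (v : E n), scaleL p (0, (jap p.2)⁻¹ • v) = (0, v) := fun p v => by
    simp [smul_smul, (jap_pos p.2).ne']
  refine ⟨fun x ξ => ?_, fun x ξ => ?_, fun x ξ => ?_, fun x ξ => ?_, fun x ξ => ?_⟩
  · have := (hgrad (x, ξ)).1
    rw [hs] at this
    exact e1 (jap_pos ξ) this
  · have := (hgrad (x, ξ)).2
    rw [hs] at this
    exact e1 (jap_pos x) this
  · have p1 := jap_pos x
    have p2 := jap_pos ξ
    refine ContinuousLinearMap.opNorm_le_bound _ (by positivity) fun v => ?_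
    rw [fderiv_gradX_left hJ (x, ξ)]
    have := (norm_apply_inl_le (hhess (x, ξ)) ((jap x)⁻¹ • v)).1
    rw [hsc, hl (x, ξ) v] at this
    refine (e1 p2 this).trans (le_of_eq ?_)
    rw [norm_smul, norm_inv, Real.norm_of_nonneg p1.le]
    ring
  · have p2 := jap_pos ξ
    refine ContinuousLinearMap.opNorm_le_bound _ (by positivity) fun v => ?_
    rw [fderiv_gradX_right hJ (x, ξ)]
    have := (norm_apply_inr_le (hhess (x, ξ)) ((jap ξ)⁻¹ • v)).1
    rw [hsc, hr (x, ξ) v] at this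
    refine (e1 p2 this).trans (le_of_eq ?_)
    rw [norm_smul, norm_inv, Real.norm_of_nonneg p2.le]
    field_simp
  · have p1 := jap_pos x
    have p2 := jap_pos ξ
    refine ContinuousLinearMap.opNorm_le_bound _ (by positivity) fun v => ?_
    rw [fderiv_gradXi_right hJ (x, ξ)]
    have := (norm_apply_inr_le (hhess (x, ξ)) ((jap ξ)⁻¹ • v)).2
    rw [hsc, hr (x, ξ) v] at this
    refine (e1 p1 this).trans (le_of_eq ?_)
    rw [norm_smul, norm_inv, Real.norm_of_nonneg p2.le]
    ring

/-- 32/9 is the largest of the constants 20/9, 4/3, 28/9, 32/9 of orders zero, one and two. It is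
free of `n`, as entries are bounded by vector and operator norms. -/
theorem Admissible.abs_mixedDeriv_critVal_le {m : ℕ} {J : Fin m → Fun n} {τ : Fin m → ℝ}
    (h : Admissible J τ) (h0 : ∀ i p, |J i p| ≤ τ i * (jap p.1 * jap p.2))
    {q : E n × E n → Fin m → E n × E n} (hsol : ∀ z, Sol J z (q z)) (α β : MIdx n)
    (hαβ : α.order + β.order ≤ 2) (x ξ : E n) :
    |mixedDeriv α β (fun z => critVal J z (q z)) (x, ξ)| ≤
      32 / 9 * (∑ i, τ i) * sgWeight 1 1 α β x ξ := by
  have hΦ := contDiff_critVal h.smooth (h.contDiff hsol)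
  have ht : 0 ≤ ∑ i, τ i := Finset.sum_nonneg fun i _ => h.nonneg i
  rw [mixedDeriv_eq_mul_wordDeriv_scaled hΦ, abs_mul, abs_of_pos (sgWeight_pos _ _ _ _ _ _)]
  refine mul_le_mul_of_nonneg_right ?_ (sgWeight_pos _ _ _ _ _ _).le
  have p1 := jap_pos x
  have p2 := jap_pos ξ
  have hlen := length_idxWord α β
  set t := ∑ i, τ i
  have hcoord : ∀ (c : Fin n ⊕ Fin n) (a : E n × E n), |pairing a (basisVec c)| ≤ ‖a‖ :=
    fun c a => by
      have := (coordL c).le_of_opNorm_le (norm_coordL_le c) a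
      rwa [one_mul] at this
  match hw : idxWord α β with
  | [] =>
    rw [wordDeriv_nil]
    simp only [scaled, rescale_zero]
    rw [abs_mul, abs_of_pos (by positivity), inv_mul_le_iff₀ (by positivity)]
    calc _ ≤ 20 / 9 * t * (jap x * jap ξ) := h.abs_critVal_le (fun i => le_rfl) h0 hsol (x, ξ)
      _ ≤ 32 / 9 * t * (jap x * jap ξ) := by gcongr; norm_num
      _ = _ := by ring
  | [c] =>
    rw [wordDeriv_singleton (contDiff_scaled hΦ _)]
    refine (hcoord _ _).trans ?_
    rw [sgrad_scaled hΦ, rescale_zero]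
    have h43 : 4 / 3 * t ≤ 32 / 9 * t := by linarith
    exact (max_le (norm_smul_inv_le p2 (h.norm_sgrad_critVal_fst_le hsol (x, ξ)))
      (norm_smul_inv_le p1 (h.norm_sgrad_critVal_snd_le hsol (x, ξ)))).trans h43
  | [c, d] =>
    rw [wordDeriv_pair (contDiff_scaled hΦ _)]
    refine (hcoord _ _).trans ?_
    obtain ⟨b1, b2⟩ := h.hessBound_critVal hsol (x, ξ) (basisVec c)
    refine max_le (b1.trans ?_) (b2.trans ?_) <;> cases c <;> simp [basisVec] <;> linarith
  | c :: d :: e :: w =>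
    rw [hw] at hlen
    simp only [List.length_cons] at hlen
    omega


/-! ### The multi-product of an admissible sequence -/

section Product

variable {φ : ℕ → Fun n} {τ : ℕ → ℝ} {M : ℕ}

theorem exists_chain_of_admissible (hφ : ∀ j, ContDiff ℝ ∞ (φ j))
    (h : Admissible (fun i : Fin (M + 1) => jPart (φ i)) (fun i => τ i)) (x ξ : E n) :
    ∃ Y N, Y 0 = x ∧ N M = ξ ∧ Chain φ M Y N := by
  obtain ⟨q, hq⟩ := h.exists_sol (x, ξ)
  set Y : ℕ → E n := fun k => if hk : k < M + 1 then (q ⟨k, hk⟩).1 else 0 with hY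
  set N : ℕ → E n := fun k => if hk : k < M + 1 then (q ⟨k, hk⟩).2 else 0 with hN
  have hY0 : Y 0 = x := by
    have h1 := hq.fst 0
    simp only [Fin.not_lt_zero, Finset.filter_false, Finset.sum_empty, add_zero] at h1
    simpa [hY] using h1
  have hNM : N M = ξ := by
    have h1 := hq.snd (Fin.last M)
    have h2 : ∀ i : Fin (M + 1), ¬ Fin.last M < i := fun i => (Fin.le_last i).not_gt
    simp only [h2, Finset.filter_false, Finset.sum_empty, add_zero] at h1
    simpa [hN, Fin.last] using h1
  refine ⟨Y, N, hY0, hNM, (sol_iff_chain hφ Y N).1 ?_⟩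
  have e : (fun i : Fin (M + 1) => (Y i, N i)) = q := by
    funext i
    simp only [hY, hN, i.2, dite_true, Fin.eta]
  rw [hY0, hNM, e]
  exact hq

theorem wellDefined_of_admissible (hφ : ∀ j, ContDiff ℝ ∞ (φ j))
    (h : Admissible (fun i : Fin (M + 1) => jPart (φ i)) (fun i => τ i)) :
    WellDefined (firsts M φ) := by
  refine wellDefined_of_chain (exists_chain_of_admissible hφ h) ?_
  intro Y N Y' N' hc hc' h0 hM j hj
  have h1 := (sol_iff_chain hφ Y N).2 hc
  have h2 := (sol_iff_chain hφ Y' N').2 hc'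
  rw [← h0, ← hM] at h2
  have e := h.sol_unique h1 h2
  exact ⟨congrArg Prod.fst (congrFun e ⟨j + 1, by omega⟩),
    congrArg Prod.snd (congrFun e ⟨j, by omega⟩)⟩

/-- The reduced multi-product is the critical value. -/
theorem jPart_multiProduct (hφ : ∀ j, ContDiff ℝ ∞ (φ j))
    (h : Admissible (fun i : Fin (M + 1) => jPart (φ i)) (fun i => τ i))
    {q : E n × E n → Fin (M + 1) → E n × E n}
    (hq : ∀ z, Sol (fun i : Fin (M + 1) => jPart (φ i)) z (q z)) :
    jPart (multiProduct (firsts M φ)) =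
      fun z => critVal (fun i : Fin (M + 1) => jPart (φ i)) z (q z) := by
  funext ⟨x, ξ⟩
  obtain ⟨Y, N, rfl, rfl, hc⟩ := exists_chain_of_admissible hφ h x ξ
  rw [h.sol_unique (hq _) ((sol_iff_chain hφ Y N).2 hc), jPart,
    multiProduct_eq_chainVal (wellDefined_of_admissible hφ h) hc, chainVal_eq_critVal hφ hc]
  simp

theorem multiProduct_eq_jPart_add (f : Fun n) : f = fun p => jPart f p + inner ℝ p.1 p.2 := by
  funext p; simp [jPart]

theorem contDiff_multiProduct (hφ : ∀ j, ContDiff ℝ ∞ (φ j))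
    (h : Admissible (fun i : Fin (M + 1) => jPart (φ i)) (fun i => τ i)) :
    ContDiff ℝ ∞ (multiProduct (firsts M φ)) := by
  choose q hq using h.exists_sol
  rw [multiProduct_eq_jPart_add (multiProduct (firsts M φ)), jPart_multiProduct hφ h hq]
  exact (contDiff_critVal h.smooth (h.contDiff hq)).add contDiff_inner_prod

/-- The gradient of the reduced product is the sum of all `∇J_i`. By the summed system the summands
with `i > 0` add up to `N 0 - ξ` in the first component, those with `i < M` to `Y M - x` in the
second, so just the outermost phase remains. -/
theorem sgrad_multiProduct (hφ : ∀ j, ContDiff ℝ ∞ (φ j))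
    (h : Admissible (fun i : Fin (M + 1) => jPart (φ i)) (fun i => τ i)) {Y N : ℕ → E n}
    (hc : Chain φ M Y N) :
    gradX (multiProduct (firsts M φ)) (Y 0) (N M) = gradX (φ 0) (Y 0) (N 0) ∧
      gradXi (multiProduct (firsts M φ)) (Y 0) (N M) = gradXi (φ M) (Y M) (N M) := by
  choose q hq using h.exists_sol
  have hs := (sol_iff_chain hφ Y N).2 hc
  have hg : sgrad (jPart (multiProduct (firsts M φ))) (Y 0, N M) =
      ∑ i ∈ Finset.range (M + 1), sgrad (jPart (φ i)) (Y i, N i) := by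
    rw [jPart_multiProduct hφ h hq, sgrad_critVal h.smooth (h.contDiff hq) hq,
      h.sol_unique (hq _) hs]
    exact Fin.sum_univ_eq_sum_range (fun i => sgrad (jPart (φ i)) (Y i, N i)) (M + 1)
  have hm := contDiff_multiProduct hφ h
  rw [gradX_eq hm, gradXi_eq hm, gradX_eq (hφ 0), gradXi_eq (hφ M), hg, Prod.fst_sum, Prod.snd_sum]
  constructor
  · have h1 := hs.snd 0
    rw [sum_fin_gt_eq M fun i => (sgrad (jPart (φ i)) (Y i, N i)).1] at h1
    simp only [Fin.val_zero, zero_add] at h1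
    rw [Finset.range_eq_Ico, Finset.sum_eq_sum_Ico_succ_bot (by omega), h1, zero_add]
    abel
  · have h1 := hs.fst (Fin.last M)
    rw [sum_fin_lt_eq M fun i => (sgrad (jPart (φ i)) (Y i, N i)).2] at h1
    simp only [Fin.val_last] at h1
    rw [Finset.sum_range_succ]
    rw [← add_assoc, ← h1]

/-! ### Phase functions -/

/-- The comparison holds at every point, with constants 4/3 and 2/3, so the filter plays no role. -/
theorem isTheta_jap {f g : E n × E n → E n} (h : ∀ p, ‖f p - g p‖ ≤ 1 / 3 * jap (g p))
    (l : Filter (E n × E n)) :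
    Asymptotics.IsTheta l (fun p => jap (f p)) (fun p => jap (g p)) := by
  have h1 : ∀ p, jap (f p) ≤ 4 / 3 * jap (g p) ∧ 2 / 3 * jap (g p) ≤ jap (f p) := fun p => by
    have a1 := jap_add_le (g p) (f p - g p)
    have a2 := jap_sub_le (g p) (f p - g p)
    rw [add_sub_cancel] at a1 a2
    have := h p
    constructor <;> linarith
  constructor
  · refine Asymptotics.IsBigO.of_bound (4 / 3) (Filter.Eventually.of_forall fun p => ?_)
    rw [Real.norm_of_nonneg (jap_pos _).le, Real.norm_of_nonneg (jap_pos _).le]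
    exact (h1 p).1
  · refine Asymptotics.IsBigO.of_bound (3 / 2) (Filter.Eventually.of_forall fun p => ?_)
    rw [Real.norm_of_nonneg (jap_pos _).le, Real.norm_of_nonneg (jap_pos _).le]
    have := (h1 p).2
    linarith

/-- Here `M` is fixed: seminorm bounds `b_i` of the single factors suffice, without uniformity in
`i`, since their sum is finite. -/
theorem isSGSymbol_multiProduct (hφ : ∀ j, IsSGSymbol 1 1 (φ j))
    (h : Admissible (fun i : Fin (M + 1) => jPart (φ i)) (fun i => τ i))
    (h0 : ∀ (i : Fin (M + 1)) p, |jPart (φ i) p| ≤ τ i * (jap p.1 * jap p.2)) :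
    IsSGSymbol 1 1 (multiProduct (firsts M φ)) := by
  have hs : ∀ j, ContDiff ℝ ∞ (φ j) := fun j => (hφ j).1
  choose q hq using h.exists_sol
  rw [multiProduct_eq_jPart_add (multiProduct (firsts M φ)), jPart_multiProduct hs h hq]
  refine IsSGSymbol.add ⟨contDiff_critVal h.smooth (h.contDiff hq), fun α β => ?_⟩ isSGSymbol_inner
  rcases Nat.eq_zero_or_pos (α.order + β.order) with hz | hpos
  · exact ⟨_, h.abs_mixedDeriv_critVal_le h0 hq α β (by omega)⟩
  · have hb : ∀ i : Fin (M + 1), ∃ C, 0 ≤ C ∧ ∀ γ δ : MIdx n,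
        γ.order + δ.order ≤ α.order + β.order + 1 → ∀ x ξ : E n,
          |mixedDeriv γ δ (jPart (φ i)) (x, ξ)| ≤ C * sgWeight 1 1 γ δ x ξ := fun i =>
      exists_common_bound (P := fun γ δ C => ∀ x ξ : E n,
          |mixedDeriv γ δ (jPart (φ i)) (x, ξ)| ≤ C * sgWeight 1 1 γ δ x ξ)
        (fun γ δ C D hCD hC x ξ => (hC x ξ).trans
          (mul_le_mul_of_nonneg_right hCD (sgWeight_pos _ _ _ _ _ _).le))
        (isSGSymbol_jPart (hφ i)).2 _
    choose b hb0 hb using hb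
    obtain ⟨C, -, hC⟩ := exists_mixedDeriv_critVal_bound n (α.order + β.order) (∑ i, b i)
    exact ⟨_, hC _ _ _ b h hb0 le_rfl (fun i γ δ _ h2 => hb i γ δ h2) q hq α β hpos (by omega)⟩

theorem isPhase_multiProduct (hφ : ∀ j, IsSGSymbol 1 1 (φ j))
    (h : Admissible (fun i : Fin (M + 1) => jPart (φ i)) (fun i => τ i))
    (h0 : ∀ (i : Fin (M + 1)) p, |jPart (φ i) p| ≤ τ i * (jap p.1 * jap p.2)) :
    IsPhase (multiProduct (firsts M φ)) := by
  have hs : ∀ j, ContDiff ℝ ∞ (φ j) := fun j => (hφ j).1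
  have hm := contDiff_multiProduct hs h
  have ht := h.sum_lt
  choose q hq using h.exists_sol
  refine ⟨isSGSymbol_multiProduct hφ h h0, isTheta_jap (fun p => ?_) _, isTheta_jap (fun p => ?_) _⟩
  · rw [gradX_eq hm, add_sub_cancel_left, jPart_multiProduct hs h hq]
    refine (h.norm_sgrad_critVal_fst_le hq p).trans ?_
    have := jap_pos p.2
    gcongr
    linarith
  · rw [gradXi_eq hm, add_sub_cancel_left, jPart_multiProduct hs h hq]
    refine (h.norm_sgrad_critVal_snd_le hq p).trans ?_
    have := jap_pos p.1
    gcongr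
    linarith

/-! ### The determinant of the mixed Hessian -/

/-- The term `x · ξ` contributes the identity, and the rest is the `ξ`-derivative of `J'_x`, so the
mixed Hessian is the matrix of `1 + A`. -/
theorem mixedHessian_det {f : Fun n} (hf : ContDiff ℝ ∞ f) (x ξ : E n) {A : E n →L[ℝ] E n}
    (hA : ∀ v, A v = (fderiv ℝ (sgrad (jPart f)) (x, ξ) (0, v)).1) :
    (mixedHessian f x ξ).det = (1 + A).det := by
  set b := (EuclideanSpace.basisFun (Fin n) ℝ).toBasis
  have hd : ∀ p, fderiv ℝ (sgrad (jPart f)) p =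
      fderiv ℝ (sgrad f) p - (ContinuousLinearMap.snd ℝ (E n) (E n)).prod
        (ContinuousLinearMap.fst ℝ (E n) (E n)) := fun p => by
    rw [show sgrad (jPart f) = fun p => sgrad f p - (p.2, p.1) from funext (sgrad_jPart hf)]
    exact ((hasFDerivAt_sgrad hf p).sub ((ContinuousLinearMap.snd ℝ (E n) (E n)).prod
      (ContinuousLinearMap.fst ℝ (E n) (E n))).hasFDerivAt).fderiv
  have key : mixedHessian f x ξ =
      LinearMap.toMatrix b b ((1 + A : E n →L[ℝ] E n) : E n →ₗ[ℝ] E n) := by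
    ext i j
    have e1 : mixedHessian f x ξ i j = wordDeriv [.inr j, .inl i] f (x, ξ) := by
      rw [wordDeriv_perm hf (List.Perm.swap _ _ _)]
      rfl
    have e2 : (1 + A) (EuclideanSpace.single j (1 : ℝ)) =
        (fderiv ℝ (sgrad f) (x, ξ) (0, EuclideanSpace.single j 1)).1 := by
      rw [add_apply, hA, hd]
      simp
    rw [e1, wordDeriv_pair hf, LinearMap.toMatrix_apply]
    simp only [b, OrthonormalBasis.coe_toBasis, EuclideanSpace.basisFun_apply,
      ContinuousLinearMap.coe_coe, e2, OrthonormalBasis.coe_toBasis_repr_apply,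
      EuclideanSpace.basisFun_repr]
    simp [pairing, basisVec, EuclideanSpace.inner_single_right]
  rw [key, LinearMap.det_toMatrix]

/-- For `c < 1` the Neumann series makes `1 + A` invertible; compactness of the ball of operators
makes the bound uniform. -/
theorem exists_det_lower_bound (n : ℕ) {c : ℝ} (hc : c < 1) :
    ∃ r : ℝ, 0 < r ∧ ∀ A : E n →L[ℝ] E n, ‖A‖ ≤ c → r ≤ |(1 + A).det| := by
  have hcont : Continuous fun A : E n →L[ℝ] E n => |(1 + A).det| :=
    (ContinuousLinearMap.continuous_det.comp (continuous_const.add continuous_id)).abs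
  have hpos : ∀ A : E n →L[ℝ] E n, ‖A‖ ≤ c → 0 < |(1 + A).det| := by
    intro A hA
    rw [abs_pos]
    have hu : IsUnit (1 + A) := by
      have := isUnit_one_sub_of_norm_lt_one (x := -A) (by rw [norm_neg]; linarith)
      rwa [sub_neg_eq_add] at this
    have hu' := hu.map (ContinuousLinearMap.toLinearMapRingHom : (E n →L[ℝ] E n) →+* _)
    exact ((LinearMap.isUnit_iff_isUnit_det _).1 hu').ne_zero
  rcases (Metric.closedBall (0 : E n →L[ℝ] E n) c).eq_empty_or_nonempty with he | hne
  · refine ⟨1, one_pos, fun A hA => ?_⟩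
    have : A ∈ Metric.closedBall (0 : E n →L[ℝ] E n) c := by simpa using hA
    rw [he] at this
    exact this.elim
  · obtain ⟨A₀, hA₀, hmin⟩ := (isCompact_closedBall (0 : E n →L[ℝ] E n) c).exists_isMinOn hne
      hcont.continuousOn
    exact ⟨_, hpos A₀ (by simpa using hA₀), fun A hA => hmin (by simpa using hA)⟩

/-- Continuity of the determinant at the identity: any prescribed `r < 1` is reached once `A` is
small. -/
theorem exists_det_near_one (n : ℕ) {r : ℝ} (hr : r < 1) :
    ∃ δ : ℝ, 0 < δ ∧ ∀ A : E n →L[ℝ] E n, ‖A‖ ≤ δ → r ≤ |(1 + A).det| := by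
  have hcont : Continuous fun A : E n →L[ℝ] E n => |(1 + A).det| :=
    (ContinuousLinearMap.continuous_det.comp (continuous_const.add continuous_id)).abs
  have h0 : |((1 : E n →L[ℝ] E n) + 0).det| = 1 := by
    rw [add_zero]
    have : (1 : E n →L[ℝ] E n).det = 1 := LinearMap.det_id
    rw [this, abs_one]
  have hev := (hcont.tendsto 0).eventually (lt_mem_nhds
    (show r < |((1 : E n →L[ℝ] E n) + 0).det| by rw [h0]; exact hr))
  obtain ⟨ε, hε, h⟩ := Metric.eventually_nhds_iff.1 hev
  refine ⟨ε / 2, by positivity, fun A hA => (h ?_).le⟩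
  rw [dist_zero_right]
  linarith

/-- The multi-product is a regular phase function. -/
theorem isRegular_multiProduct {r σ : ℝ} (hφ : ∀ j, IsSGSymbol 1 1 (φ j))
    (h : Admissible (fun i : Fin (M + 1) => jPart (φ i)) (fun i => τ i))
    (h0 : ∀ (i : Fin (M + 1)) p, |jPart (φ i) p| ≤ τ i * (jap p.1 * jap p.2))
    (hr : 0 < r) (hσ0 : 0 ≤ σ) (hσ1 : σ < 1)
    (hdet : ∀ A : E n →L[ℝ] E n, ‖A‖ ≤ 28 / 9 * ∑ i : Fin (M + 1), τ i → r ≤ |(1 + A).det|)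
    (hb : ∀ α β : MIdx n, α.order + β.order ≤ 2 → ∀ x ξ,
      |mixedDeriv α β (jPart (multiProduct (firsts M φ))) (x, ξ)| ≤ σ * sgWeight 1 1 α β x ξ) :
    IsRegular r σ (multiProduct (firsts M φ)) where
  r_pos := hr
  tau_nonneg := hσ0
  tau_lt_one := hσ1
  phase := isPhase_multiProduct hφ h h0
  bound α β hαβ x ξ := (div_le_iff₀ (sgWeight_pos _ _ _ _ _ _)).2 (hb α β hαβ x ξ)
  det_ge x ξ := by
    have hs : ∀ j, ContDiff ℝ ∞ (φ j) := fun j => (hφ j).1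
    have hm := contDiff_multiProduct hs h
    choose q hq using h.exists_sol
    set A : E n →L[ℝ] E n := (ContinuousLinearMap.fst ℝ (E n) (E n)).comp
      ((fderiv ℝ (sgrad (jPart (multiProduct (firsts M φ)))) (x, ξ)).comp
        (ContinuousLinearMap.inr ℝ (E n) (E n))) with hA
    rw [mixedHessian_det hm x ξ (A := A) (fun v => rfl)]
    refine hdet A (ContinuousLinearMap.opNorm_le_bound _ ?_ fun v => ?_)
    · have := Finset.sum_nonneg fun i (_ : i ∈ Finset.univ) => h.nonneg i
      positivity
    have p2 := jap_pos ξ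
    -- Rescaling sends this test vector to `(0, v)`; the factor `⟨ξ⟩` cancels again in the gradient.
    have h1 := (h.hessBound_critVal hq (x, ξ) (0, (jap ξ)⁻¹ • v)).1
    rw [← jPart_multiProduct hs h hq, fderiv_sgrad_scaled (contDiff_jPart hm), rescale_zero] at h1
    simp only [scaleL_apply, smul_smul, smul_zero, mul_inv_cancel₀ p2.ne', one_smul, dualScale,
      norm_smul, norm_inv, Real.norm_of_nonneg p2.le, norm_zero, mul_zero, zero_add] at h1
    rw [inv_mul_le_iff₀ p2] at h1
    refine h1.trans (le_of_eq ?_)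
    field_simp

end Product


/-! ### Consequences of regularity -/

theorem mixedDeriv_zero (f : Fun n) : mixedDeriv 0 0 f = f := by
  simp [mixedDeriv]

theorem IsRegular.abs_mixedDeriv_le {r τ : ℝ} {φ : Fun n} (h : IsRegular r τ φ) (α β : MIdx n)
    (hαβ : α.order + β.order ≤ 2) (x ξ : E n) :
    |mixedDeriv α β (jPart φ) (x, ξ)| ≤ τ * sgWeight 1 1 α β x ξ :=
  (div_le_iff₀ (sgWeight_pos _ _ _ _ _ _)).1 (h.bound α β hαβ x ξ)

theorem IsRegular.abs_jPart_le {r τ : ℝ} {φ : Fun n} (h : IsRegular r τ φ) (p : E n × E n) :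
    |jPart φ p| ≤ τ * (jap p.1 * jap p.2) := by
  have := h.abs_mixedDeriv_le 0 0 (by simp [MIdx.order]) p.1 p.2
  rw [mixedDeriv_zero] at this
  simpa [sgWeight, MIdx.order] using this

theorem IsRegular.contDiff {r τ : ℝ} {φ : Fun n} (h : IsRegular r τ φ) : ContDiff ℝ ∞ φ :=
  h.phase.1.1

theorem IsRegular.vectorBound {r τ : ℝ} {φ : Fun n} (h : IsRegular r τ φ) :
    VectorBound ((n : ℝ) ^ 2 * τ) (jPart φ) :=
  vectorBound_of_mixedDeriv (contDiff_jPart h.contDiff) h.tau_nonneg h.abs_mixedDeriv_le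

theorem admissible_firsts {φ : ℕ → Fun n} {τ : ℕ → ℝ} (hφ : ∀ j, ContDiff ℝ ∞ (φ j))
    (h0 : ∀ j, 0 ≤ τ j) (hv : ∀ j, VectorBound (τ j) (jPart (φ j))) (hs : Summable τ)
    (ht : ∑' j, τ j < 1 / 4) (M : ℕ) :
    Admissible (fun i : Fin (M + 1) => jPart (φ i)) (fun i => τ i) where
  smooth i := contDiff_jPart (hφ i)
  nonneg i := h0 i
  sum_lt := by
    rw [Fin.sum_univ_eq_sum_range τ (M + 1)]
    exact (hs.sum_le_tsum _ fun j _ => h0 j).trans_lt ht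
  vb i := hv i

theorem tsum_shift_le {τ : ℕ → ℝ} (h0 : ∀ j, 0 ≤ τ j) (hs : Summable τ) :
    ∑' j, τ (j + 1) ≤ ∑' j, τ j := by
  rw [hs.tsum_eq_zero_add]
  linarith [h0 0]

/-! ### The seminorms -/

theorem wSup_le {α β : MIdx n} {J : Fun n} {c : ℝ}
    (h : ∀ x ξ, |mixedDeriv α β J (x, ξ)| ≤ c * sgWeight 1 1 α β x ξ) :
    wSup α β J ≤ ENNReal.ofReal c :=
  iSup₂_le fun x ξ => ENNReal.ofReal_le_ofReal ((div_le_iff₀ (sgWeight_pos _ _ _ _ _ _)).2 (h x ξ))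

theorem abs_mixedDeriv_le_of_wSup_le {α β : MIdx n} {J : Fun n} {c : ℝ} (hc : 0 ≤ c)
    (h : wSup α β J ≤ ENNReal.ofReal c) (x ξ : E n) :
    |mixedDeriv α β J (x, ξ)| ≤ c * sgWeight 1 1 α β x ξ := by
  refine (div_le_iff₀ (sgWeight_pos _ _ _ _ _ _)).1 ((ENNReal.ofReal_le_ofReal_iff hc).1 ?_)
  exact (le_iSup₂ (f := fun x ξ => ENNReal.ofReal
    (|mixedDeriv α β J (x, ξ)| / sgWeight 1 1 α β x ξ)) x ξ).trans h

theorem mem_idxPairs {ℓ : ℕ} {α β : MIdx n} (h2 : 2 ≤ α.order + β.order)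
    (hℓ : α.order + β.order ≤ 2 + ℓ) : (α, β) ∈ idxPairs n ℓ := by
  have hle : ∀ (γ : MIdx n) i, γ i ≤ γ.order := fun γ i =>
    Finset.single_le_sum (f := γ) (fun _ _ => Nat.zero_le _) (Finset.mem_univ i)
  simp only [idxPairs, Finset.mem_filter, Finset.mem_product, Fintype.mem_piFinset,
    Finset.mem_range]
  refine ⟨⟨fun i => ?_, fun i => ?_⟩, h2, hℓ⟩
  · have := hle α i
    omega
  · have := hle β i
    omega

theorem IsRegularL.abs_mixedDeriv_le {r τ : ℝ} {ℓ : ℕ} {φ : Fun n} (h : IsRegularL r τ ℓ φ)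
    (α β : MIdx n) (hαβ : α.order + β.order ≤ 2 + ℓ) (x ξ : E n) :
    |mixedDeriv α β (jPart φ) (x, ξ)| ≤ τ * sgWeight 1 1 α β x ξ := by
  by_cases h2 : α.order + β.order ≤ 2
  · exact h.1.abs_mixedDeriv_le α β h2 x ξ
  have h1 : wSup α β (jPart φ) ≤ seminormTwo ℓ (jPart φ) := by
    rw [seminormTwo]
    have hm : (α, β) ∈ idxPairs n ℓ := mem_idxPairs (by omega) hαβ
    rw [← Finset.add_sum_erase _ _ hm]
    exact le_self_add
  have h3 : seminormTwo ℓ (jPart φ) ≤ seminorm ℓ (jPart φ) := by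
    rw [seminorm]
    exact le_add_self
  exact abs_mixedDeriv_le_of_wSup_le h.1.tau_nonneg (h1.trans (h3.trans h.2)) x ξ

/-- The supremum over orders at most one counts once, and each index pair of higher order counts
once. -/
theorem seminorm_le {ℓ : ℕ} {J : Fun n} {c : ℝ} (hc : 0 ≤ c)
    (h : ∀ α β : MIdx n, α.order + β.order ≤ 2 + ℓ → ∀ x ξ,
      |mixedDeriv α β J (x, ξ)| ≤ c * sgWeight 1 1 α β x ξ) :
    seminorm ℓ J ≤ ENNReal.ofReal ((1 + (idxPairs n ℓ).card) * c) := by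
  have h1 : (⨆ (α : MIdx n) (β : MIdx n) (_ : α.order + β.order ≤ 1), wSup α β J) ≤
      ENNReal.ofReal c :=
    iSup₂_le fun α β => iSup_le fun hαβ => wSup_le (h α β (by omega))
  have h2 : seminormTwo ℓ J ≤ (idxPairs n ℓ).card • ENNReal.ofReal c :=
    Finset.sum_le_card_nsmul _ _ _ fun γ hγ => wSup_le (h _ _ (Finset.mem_filter.1 hγ).2.2)
  refine (add_le_add h1 h2).trans (le_of_eq ?_)
  rw [nsmul_eq_mul, ← ENNReal.ofReal_natCast, ← ENNReal.ofReal_mul (by positivity),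
    ← ENNReal.ofReal_add hc (by positivity)]
  congr 1
  ring

/-! ### Multi-products of sequences of phase functions -/

/-- The parameters `τ'` that enter the estimates are separated from the class parameters `τ`: they
are equal when vector bounds are given, and enlarged by a constant when only componentwise bounds
are. -/
theorem isRegular_multiProduct_seq {r r' σ : ℝ} {φ : ℕ → Fun n} {τ τ' : ℕ → ℝ} {M : ℕ}
    (hreg : ∀ j, IsRegular r (τ j) (φ j)) (hτ : ∀ j, τ j ≤ τ' j)
    (h : Admissible (fun i : Fin (M + 1) => jPart (φ i)) (fun i => τ' i)) (hr : 0 < r')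
    (hdet : ∀ A : E n →L[ℝ] E n, ‖A‖ ≤ 28 / 9 * ∑ j ∈ Finset.range (M + 1), τ' j →
      r' ≤ |(1 + A).det|)
    (hσ : 32 / 9 * ∑ j ∈ Finset.range (M + 1), τ' j ≤ σ) (hσ1 : σ < 1) :
    IsRegular r' σ (multiProduct (firsts M φ)) := by
  have hs := fun j => (hreg j).contDiff
  have h0 : ∀ (i : Fin (M + 1)) p, |jPart (φ i) p| ≤ τ' i * (jap p.1 * jap p.2) := fun i p => by
    refine ((hreg i).abs_jPart_le p).trans ?_
    have := jap_pos p.1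
    have := jap_pos p.2
    gcongr
    exact hτ i
  rw [← Fin.sum_univ_eq_sum_range τ' (M + 1)] at hσ hdet
  have hnn := Finset.sum_nonneg fun i (_ : i ∈ Finset.univ) => h.nonneg i
  refine isRegular_multiProduct (fun j => (hreg j).phase.1) h h0 hr (by linarith) hσ1 hdet
    fun α β hαβ x ξ => ?_
  choose q hq using h.exists_sol
  rw [jPart_multiProduct hs h hq]
  have := sgWeight_pos 1 1 α β x ξ
  exact (h.abs_mixedDeriv_critVal_le h0 hq α β hαβ x ξ).trans (by gcongr)

theorem sgBounded_jPart_multiProduct {r : ℝ} {φ : ℕ → Fun n} {τ : ℕ → ℝ}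
    (hreg : ∀ j, IsRegular r (τ j) (φ j))
    (h : ∀ M, Admissible (fun i : Fin (M + 1) => jPart (φ i)) (fun i => τ i))
    (hb : SGBounded 1 1 (fun j => jPart (φ j)) τ) :
    SGBounded 1 1 (fun m => jPart (multiProduct (firsts (m + 1) φ)))
      (fun m => ∑ j ∈ Finset.range (m + 2), τ j) := by
  have hs := fun j => (hreg j).contDiff
  refine ⟨fun m => contDiff_jPart (contDiff_multiProduct hs (h _)), fun α β => ?_⟩
  by_cases hαβ : α.order + β.order ≤ 2
  · refine ⟨32 / 9, fun m x ξ => ?_⟩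
    choose q hq using (h (m + 1)).exists_sol
    beta_reduce
    rw [jPart_multiProduct hs (h _) hq, ← Fin.sum_univ_eq_sum_range τ (m + 2)]
    exact (h (m + 1)).abs_mixedDeriv_critVal_le (fun i p => (hreg i).abs_jPart_le p) hq α β hαβ x ξ
  obtain ⟨D, hD0, hD⟩ := exists_common_bound
    (P := fun α β C => ∀ j x ξ, |mixedDeriv α β (jPart (φ j)) (x, ξ)| ≤
      C * τ j * sgWeight 1 1 α β x ξ)
    (fun α β C D hCD H j x ξ => (H j x ξ).trans (by
      have := (hreg j).tau_nonneg
      have := sgWeight_pos 1 1 α β x ξ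
      gcongr)) hb.2 (α.order + β.order + 1)
  -- The seminorm bounds of the factors are `D τ_i`, whose sum is at most `D / 4` for every `M`;
  -- hence `C` does not depend on `M`.
  obtain ⟨C, -, hC⟩ := exists_mixedDeriv_critVal_bound n (α.order + β.order) (D * (1 / 4))
  refine ⟨C * D, fun m x ξ => ?_⟩
  choose q hq using (h (m + 1)).exists_sol
  beta_reduce
  rw [jPart_multiProduct hs (h _) hq, ← Fin.sum_univ_eq_sum_range τ (m + 2)]
  have key := hC (m + 2) _ _ (fun i => D * τ i) (h (m + 1))
    (fun i => mul_nonneg hD0 (hreg i).tau_nonneg)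
    (by
      rw [← Finset.mul_sum]
      exact mul_le_mul_of_nonneg_left (h (m + 1)).sum_lt.le hD0)
    (fun i α' β' _ h2 x ξ => hD α' β' h2 i x ξ) q hq α β (by omega) (by omega) x ξ
  rwa [← Finset.mul_sum, ← mul_assoc] at key

theorem multiProduct_assoc {φ : ℕ → Fun n} {τ : ℕ → ℝ} (hs : ∀ j, ContDiff ℝ ∞ (φ j))
    (h : ∀ M, Admissible (fun i : Fin (M + 1) => jPart (φ i)) (fun i => τ i))
    (h' : ∀ M, Admissible (fun i : Fin (M + 1) => jPart (φ (i + 1))) (fun i => τ (i + 1)))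
    (m : ℕ) :
    WellDefined (firsts m φ) ∧ WellDefined (firsts m fun j => φ (j + 1)) ∧
      WellDefined ![φ 0, multiProduct (firsts m fun j => φ (j + 1))] ∧
      WellDefined ![multiProduct (firsts m φ), φ (m + 1)] ∧
      multiProduct ![φ 0, multiProduct (firsts m fun j => φ (j + 1))] =
        multiProduct (firsts (m + 1) φ) ∧
      multiProduct ![multiProduct (firsts m φ), φ (m + 1)] = multiProduct (firsts (m + 1) φ) := by
  have hs' : ∀ j, ContDiff ℝ ∞ ((fun j => φ (j + 1)) j) := fun j => hs (j + 1)
  have w := wellDefined_of_admissible hs (h m)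
  have wf := wellDefined_of_admissible hs (h (m + 1))
  have w' := wellDefined_of_admissible (φ := fun j => φ (j + 1)) (τ := fun j => τ (j + 1)) hs' (h' m)
  obtain ⟨l1, l2⟩ := multiProduct_pair_left wf w' fun Y N hc =>
    (sgrad_multiProduct (φ := fun j => φ (j + 1)) (τ := fun j => τ (j + 1)) hs' (h' m) hc).1
  obtain ⟨r1, r2⟩ := multiProduct_pair_right wf w fun Y N hc => (sgrad_multiProduct hs (h m) hc).2
  exact ⟨w, w', l1, r1, l2, r2⟩

theorem grad_multiProduct_of_isCritical {φ : ℕ → Fun n} {τ : ℕ → ℝ} {m : ℕ}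
    (hs : ∀ j, ContDiff ℝ ∞ (φ j))
    (h : Admissible (fun i : Fin (m + 1 + 1) => jPart (φ i)) (fun i => τ i)) {x ξ : E n}
    {Y N : Fin (m + 1) → E n} (hc : IsCritical (firsts (m + 1) φ) x ξ (Y, N)) :
    gradX (multiProduct (firsts (m + 1) φ)) x ξ = gradX (φ 0) x (N 0) ∧
      gradXi (multiProduct (firsts (m + 1) φ)) x ξ = gradXi (φ (m + 1)) (Y (Fin.last m)) ξ := by
  obtain ⟨Y', N', rfl, rfl, e⟩ := exists_seq x ξ (Y, N)
  obtain ⟨rfl, rfl⟩ := Prod.mk.inj e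
  exact sgrad_multiProduct hs h ((isCritical_seq_iff φ _ Y' N').1 hc)

/-- Stability of the refined classes under multi-products. -/
theorem exists_isRegularL_multiProduct (n ℓ : ℕ) {r : ℝ} (hr0 : 0 < r) (hr1 : r < 1) :
    ∃ τs cs : ℝ, 0 < τs ∧ τs < 1 / 4 ∧ 1 ≤ cs ∧
      ∀ (ρ : ℝ) (φ : ℕ → Fun n) (τ : ℕ → ℝ), (∀ j, IsRegularL ρ (τ j) ℓ (φ j)) →
        Summable τ → ∑' j, τ j ≤ τs → ∀ m : ℕ, WellDefined (firsts (m + 1) φ) ∧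
          IsRegularL r (cs * ∑ j ∈ Finset.range (m + 2), τ j) ℓ
            (multiProduct (firsts (m + 1) φ)) := by
  obtain ⟨δ, hδ0, hδ⟩ := exists_det_near_one n hr1
  obtain ⟨C, hC0, hC⟩ := exists_mixedDeriv_critVal_bound n (ℓ + 1) (1 / 4)
  -- `κ τ_j` has to dominate both the vector bounds `n² τ_j` and the componentwise bounds `τ_j`,
  -- also for `n = 0`.
  set κ : ℝ := (n : ℝ) ^ 2 + 1 with hκ
  have hκ1 : 1 ≤ κ := by
    rw [hκ]
    nlinarith [sq_nonneg (n : ℝ)]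
  set D : ℝ := (C + 32 / 9) * κ with hD
  set d : ℝ := 1 + ((idxPairs n ℓ).card : ℝ) with hd
  have hd1 : 1 ≤ d := by
    rw [hd]
    have : (0 : ℝ) ≤ (idxPairs n ℓ).card := Nat.cast_nonneg _
    linarith
  have hD1 : 32 / 9 * κ ≤ D := by
    rw [hD]
    gcongr
    linarith
  have hD0 : 1 ≤ D := by linarith
  have hcs : D ≤ d * D := le_mul_of_one_le_left (by linarith) hd1
  -- The first entry keeps `c* ∑ τ_j` below 1/2. The second keeps the perturbation of the mixed
  -- Hessian below `δ`. As `d * D ≥ 32/9 * κ`, it follows that `κ T ≤ 9/64 < 1/4`, so the enlarged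
  -- parameters are admissible.
  set T : ℝ := min (1 / (2 * (d * D))) (δ * 9 / (28 * κ)) with hT
  have hT0 : 0 < T := by
    rw [hT]
    apply lt_min <;> positivity
  have hT1 : d * D * T ≤ 1 / 2 := by
    have := min_le_left (1 / (2 * (d * D))) (δ * 9 / (28 * κ))
    rw [← hT, le_div_iff₀ (by positivity)] at this
    linarith
  have hT2 : 28 / 9 * (κ * T) ≤ δ := by
    have := min_le_right (1 / (2 * (d * D))) (δ * 9 / (28 * κ))
    rw [← hT, le_div_iff₀ (by positivity)] at this
    linarith
  have hT3 : 32 / 9 * (κ * T) ≤ 1 / 2 := by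
    nlinarith
  have hT4 : T < 1 / 4 := by
    nlinarith
  refine ⟨T, d * D, hT0, hT4, hD0.trans hcs, fun ρ φ τ hreg hsum hts m => ?_⟩
  have hτ0 := fun j => (hreg j).1.tau_nonneg
  have hs := fun j => (hreg j).1.contDiff
  have hle : ∀ j, τ j ≤ κ * τ j := fun j => le_mul_of_one_le_left (hτ0 j) hκ1
  have hadm := admissible_firsts (τ := fun j => κ * τ j) hs
    (fun j => mul_nonneg (by linarith) (hτ0 j))
    (fun j => (hreg j).1.vectorBound.mono (by
      rw [hκ]
      linarith [hτ0 j])) (hsum.mul_left κ)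
    (by
      rw [tsum_mul_left]
      nlinarith) (m + 1)
  set t := ∑ j ∈ Finset.range (m + 2), τ j with ht
  have ht0 : 0 ≤ t := Finset.sum_nonneg fun j _ => hτ0 j
  have htT : t ≤ T := (hsum.sum_le_tsum _ fun j _ => hτ0 j).trans hts
  have hsum' : ∑ j ∈ Finset.range (m + 1 + 1), κ * τ j = κ * t := by rw [← Finset.mul_sum]
  have hregM : IsRegular r (d * D * t) (multiProduct (firsts (m + 1) φ)) := by
    refine isRegular_multiProduct_seq (fun j => (hreg j).1) hle hadm hr0
      (fun A hA => hδ A (hA.trans ?_)) ?_ ?_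
    · rw [hsum']
      refine le_trans ?_ hT2
      gcongr
    · rw [hsum', ← mul_assoc]
      exact mul_le_mul_of_nonneg_right (hD1.trans hcs) ht0
    · refine lt_of_le_of_lt ?_ (show (1 / 2 : ℝ) < 1 by norm_num)
      refine le_trans ?_ hT1
      gcongr
  refine ⟨wellDefined_of_admissible (τ := fun j => κ * τ j) hs hadm, hregM, ?_⟩
  rw [mul_assoc]
  refine seminorm_le (by positivity) fun α β hαβ x ξ => ?_
  have hw := sgWeight_pos 1 1 α β x ξ
  choose q hq using hadm.exists_sol
  rw [jPart_multiProduct (τ := fun j => κ * τ j) hs hadm hq]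
  have hfin : ∑ i : Fin (m + 1 + 1), κ * τ i = κ * t := by
    rw [← hsum', Fin.sum_univ_eq_sum_range (fun j => κ * τ j) (m + 1 + 1)]
  by_cases h2 : α.order + β.order ≤ 2
  · have h0 : ∀ (i : Fin (m + 1 + 1)) p, |jPart (φ i) p| ≤ κ * τ i * (jap p.1 * jap p.2) :=
      fun i p => by
        refine ((hreg i).1.abs_jPart_le p).trans ?_
        have := jap_pos p.1
        have := jap_pos p.2
        gcongr
        exact hle i
    refine (hadm.abs_mixedDeriv_critVal_le h0 hq α β h2 x ξ).trans ?_
    rw [hfin, ← mul_assoc]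
    gcongr
  · refine (hC (m + 2) _ _ (fun i => κ * τ i) hadm hadm.nonneg hadm.sum_lt.le
      (fun i α' β' _ h2 x ξ => ((hreg i).abs_mixedDeriv_le α' β' (by omega) x ξ).trans ?_)
      q hq α β (by omega) (by omega) x ξ).trans ?_
    · have := sgWeight_pos 1 1 α' β' x ξ
      gcongr
      exact hle i
    · rw [hfin, ← mul_assoc]
      gcongr
      rw [hD]
      gcongr
      linarith

end SGPhase

/- The sequences are indexed from `0`: `φ j`, `τ j` stand for `φ_{j+1}`, `τ_{j+1}`, and `m` stands
for `M - 1`, so that `m : ℕ` ranges over all `M ≥ 1`. -/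
theorem theorem3p11 (n : ℕ) :
    (∀ (r : ℝ) (φ : ℕ → SGPhase.Fun n) (τ : ℕ → ℝ),
      (∀ j, SGPhase.IsRegular r (τ j) (φ j)) →
      (2 ≤ n → ∀ j, SGPhase.VectorBound (τ j) (SGPhase.jPart (φ j))) →
      Summable τ → ∑' j, τ j < 1 / 4 →
      -- the multi-product is well defined for every `M ≥ 1`
      (∀ m : ℕ, SGPhase.WellDefined (SGPhase.firsts (m + 1) φ)) ∧
      -- (1), membership in the class of regular phase functions
      (∃ k r' : ℝ, 1 ≤ k ∧ 0 < r' ∧ ∀ m : ℕ,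
        SGPhase.IsRegular r' (k * ∑ j ∈ Finset.range (m + 2), τ j)
          (SGPhase.multiProduct (SGPhase.firsts (m + 1) φ))) ∧
      -- (1), boundedness in the symbol class
      (SGPhase.SGBounded 1 1 (fun j => SGPhase.jPart (φ j)) τ →
        SGPhase.SGBounded 1 1
          (fun m => SGPhase.jPart (SGPhase.multiProduct (SGPhase.firsts (m + 1) φ)))
          (fun m => ∑ j ∈ Finset.range (m + 2), τ j)) ∧
      -- (2), the gradients at the critical point
      (∀ (m : ℕ) (x ξ : SGPhase.E n) (Y N : Fin (m + 1) → SGPhase.E n),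
        SGPhase.IsCritical (SGPhase.firsts (m + 1) φ) x ξ (Y, N) →
        SGPhase.gradX (SGPhase.multiProduct (SGPhase.firsts (m + 1) φ)) x ξ =
          SGPhase.gradX (φ 0) x (N 0) ∧
        SGPhase.gradXi (SGPhase.multiProduct (SGPhase.firsts (m + 1) φ)) x ξ =
          SGPhase.gradXi (φ (m + 1)) (Y (Fin.last m)) ξ) ∧
      -- (3), associativity; all products involved are well defined
      (∀ m : ℕ,
        SGPhase.WellDefined (SGPhase.firsts m φ) ∧
        SGPhase.WellDefined (SGPhase.firsts m fun j => φ (j + 1)) ∧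
        SGPhase.WellDefined
          ![φ 0, SGPhase.multiProduct (SGPhase.firsts m fun j => φ (j + 1))] ∧
        SGPhase.WellDefined ![SGPhase.multiProduct (SGPhase.firsts m φ), φ (m + 1)] ∧
        SGPhase.multiProduct ![φ 0, SGPhase.multiProduct (SGPhase.firsts m fun j => φ (j + 1))] =
          SGPhase.multiProduct (SGPhase.firsts (m + 1) φ) ∧
        SGPhase.multiProduct ![SGPhase.multiProduct (SGPhase.firsts m φ), φ (m + 1)] =
          SGPhase.multiProduct (SGPhase.firsts (m + 1) φ))) ∧
    -- (4), the refined classes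
    (∀ (ℓ : ℕ) (r : ℝ), 0 < r → r < 1 →
      ∃ τs cs : ℝ, 0 < τs ∧ τs < 1 / 4 ∧ 1 ≤ cs ∧
        ∀ (ρ : ℝ) (φ : ℕ → SGPhase.Fun n) (τ : ℕ → ℝ),
          (∀ j, SGPhase.IsRegularL ρ (τ j) ℓ (φ j)) →
          Summable τ → ∑' j, τ j ≤ τs →
          ∀ m : ℕ, SGPhase.WellDefined (SGPhase.firsts (m + 1) φ) ∧
            SGPhase.IsRegularL r (cs * ∑ j ∈ Finset.range (m + 2), τ j) ℓ
              (SGPhase.multiProduct (SGPhase.firsts (m + 1) φ))) := by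
  refine ⟨fun r φ τ hreg hvec hsum ht => ?_, fun ℓ r hr0 hr1 =>
    SGPhase.exists_isRegularL_multiProduct n ℓ hr0 hr1⟩
  have hs := fun j => (hreg j).contDiff
  have hτ0 := fun j => (hreg j).tau_nonneg
  have hv : ∀ j, SGPhase.VectorBound (τ j) (SGPhase.jPart (φ j)) := fun j => by
    rcases le_or_gt 2 n with hn | hn
    · exact hvec hn j
    -- For `n ≤ 1` the loss `n²` is at most 1, so componentwise bounds already are vector bounds.
    · refine (hreg j).vectorBound.mono (mul_le_of_le_one_left (hτ0 j) ?_)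
      exact_mod_cast pow_le_one₀ (Nat.zero_le n) (Nat.lt_succ_iff.1 hn)
  have hadm := SGPhase.admissible_firsts hs hτ0 hv hsum ht
  have hadm' := SGPhase.admissible_firsts (φ := fun j => φ (j + 1)) (τ := fun j => τ (j + 1))
    (fun j => hs (j + 1)) (fun j => hτ0 (j + 1)) (fun j => hv (j + 1))
    ((summable_nat_add_iff 1).2 hsum) ((SGPhase.tsum_shift_le hτ0 hsum).trans_lt ht)
  refine ⟨fun m => SGPhase.wellDefined_of_admissible hs (hadm (m + 1)), ?_,
    SGPhase.sgBounded_jPart_multiProduct hreg hadm,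
    fun m x ξ Y N hc => SGPhase.grad_multiProduct_of_isCritical hs (hadm (m + 1)) hc,
    SGPhase.multiProduct_assoc hs hadm hadm'⟩
  -- `7/9 = 28/9 · 1/4` bounds the mixed block of the Hessian for every `M`. Likewise `k = 32/9`
  -- works because `32/9 · 1/4 = 8/9 < 1`.
  obtain ⟨r', hr', hdet⟩ := SGPhase.exists_det_lower_bound n (c := 7 / 9) (by norm_num)
  refine ⟨32 / 9, r', by norm_num, hr', fun m => ?_⟩
  have hlt : ∑ j ∈ Finset.range (m + 2), τ j < 1 / 4 :=
    (hsum.sum_le_tsum _ fun j _ => hτ0 j).trans_lt ht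
  exact SGPhase.isRegular_multiProduct_seq hreg (fun j => le_rfl) (hadm (m + 1)) hr'
    (fun A hA => hdet A (by linarith)) le_rfl (by linarith)
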